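/- Let $A$ be a finite set of monadic predicate symbols. A monadic model is a pair $(D,V)$ with $D$ a (possibly empty) set and $V:A\to\wp(D)$. The formulas of $\mathrm{FOE}^\infty(A)$ are given by $$\varphi ::= \top\mid\bot\mid a(x)\mid\neg a(x)\mid x\approx y\mid x\not\approx y\mid\varphi\lor\varphi\mid\varphi\land\varphi\mid\exists x.\varphi\mid\forall x.\varphi\mid\exists^\infty x.\varphi\mid\forall^\infty x.\varphi\qquad(a\in A),$$ where $\exists^\infty x$ means "for infinitely many $x$" and $\forall^\infty x$ means "for all but finitely many $x$"; $\mathrm{M}(A)$ consists of those formulas without $\approx,\not\approx,\exists^\infty,\forall^\infty$. In the empty model, sentences beginning with $\exists$ or $\exists^\infty$ are false and sentences beginning with $\forall$ or $\forall^\infty$ are true. Two sentences are equivalent if they are true in the same monadic models, including the empty one. Let $B\subseteq A$. For valuations $U,V$ on $D$ write $U\le_B V$ if $U(b)\subseteq V(b)$ for all $b\in B$ and $U(a)=V(a)$ for all $a\in A\setminus B$, and $U\le_B^\omega V$ if moreover $U(b)$ is finite for all $b\in B$. A formula $\varphi$ is (Scott) continuous in $B$ if for all models and assignments $g$: (i)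 $(D,V),g\models\varphi$ and $V\le_B V'$ imply $(D,V'),g\models\varphi$; (ii) $(D,V),g\models\varphi$ implies $(D,U),g\models\varphi$ for some $U\le_B^\omega V$. The syntactically $B$-continuous fragments are given by $$\mathrm{M}:\ \varphi::=\psi\mid b(x)\mid\varphi\land\varphi\mid\varphi\lor\varphi\mid\exists x.\varphi,\qquad \mathrm{FOE}^\infty:\ \varphi::=\psi\mid b(x)\mid\varphi\land\varphi\mid\varphi\lor\varphi\mid\exists x.\varphi\mid \mathbf{W}x.(\varphi,\psi),$$ where $b\in B$, $\psi$ ranges over the formulas of the logic in question in which no symbol of $B$ occurs, and $\mathbf{W}x.(\varphi,\psi):=\forall x.(\varphi\lor\psi)\land\forall^\infty x.\psi$. Let $\mathrm{Con}_B(L(A))$ be the set of sentences in the fragment for $L$. Theorem. Let $L\in\{\mathrm{M},\mathrm{FOE}^\infty\}$, $A$ finite and $B\subseteq A$. 1. A sentence $\varphi\in L(A)$ is continuous in $B$ if and only if it is equivalent to some sentence $\varphi^\ominus\in\mathrm{Con}_B(L(A))$. 2. There is an effectively computable translation $(\cdot)^\ominus$ from the sentences of $L(A)$ to $\mathrm{Con}_B(L(A))$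 such that a sentence $\varphi\in L(A)$ is continuous in $B$ if and only if $\varphi\equiv\varphi^\ominus$. 3. It is decidable whether a sentence $\varphi\in L(A)$ is continuous in $B$. -/

import Mathlib

universe u v

namespace MonadicFO

/-- Formulas of monadic first-order logic with equality and the quantifiers `∃∞`, `∀∞`, in negation
normal form, over the set `A` of monadic predicate symbols. Individual variables are natural
numbers. -/
inductive Formula (A : Type v) : Type v
  | top : Formula A
  | bot : Formula A
  | pos (a : A) (x : ℕ) : Formula A
  | neg (a : A) (x : ℕ) : Formula A
  | eq (x y : ℕ) : Formula A
  | ne (x y : ℕ) : Formula A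
  | or (φ ψ : Formula A) : Formula A
  | and (φ ψ : Formula A) : Formula A
  | ex (x : ℕ) (φ : Formula A) : Formula A
  | all (x : ℕ) (φ : Formula A) : Formula A
  | exInf (x : ℕ) (φ : Formula A) : Formula A
  | allInf (x : ℕ) (φ : Formula A) : Formula A

/-- The two logics: `M`, monadic first-order logic without equality, and `FOEinf`, monadic
first-order logic with equality and the quantifiers `∃∞`, `∀∞`. -/
inductive MLogic : Type
  | M
  | FOEinf

namespace Formula

variable {A : Type v}

/-- The free variables of a formula. -/
def freeVars : Formula A → Finset ℕ
  | top => ∅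
  | bot => ∅
  | pos _ x => {x}
  | neg _ x => {x}
  | eq x y => {x, y}
  | ne x y => {x, y}
  | or φ ψ => φ.freeVars ∪ ψ.freeVars
  | and φ ψ => φ.freeVars ∪ ψ.freeVars
  | ex x φ => φ.freeVars.erase x
  | all x φ => φ.freeVars.erase x
  | exInf x φ => φ.freeVars.erase x
  | allInf x φ => φ.freeVars.erase x

/-- A sentence is a formula without free variables. -/
def IsSentence (φ : Formula A) : Prop := φ.freeVars = ∅

/-- No equalities or inequalities and no `∃∞`, `∀∞` occur. -/
def IsM : Formula A → Prop
  | top => True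
  | bot => True
  | pos _ _ => True
  | neg _ _ => True
  | eq _ _ => False
  | ne _ _ => False
  | or φ ψ => φ.IsM ∧ ψ.IsM
  | and φ ψ => φ.IsM ∧ ψ.IsM
  | ex _ φ => φ.IsM
  | all _ φ => φ.IsM
  | exInf _ _ => False
  | allInf _ _ => False

/-- `φ.InLogic L`: the formula `φ` belongs to `L(A)`. -/
def InLogic (φ : Formula A) : MLogic → Prop
  | MLogic.M => φ.IsM
  | MLogic.FOEinf => True

/-- No predicate symbol from `B` occurs in the formula. -/
def Avoids (B : Set A) : Formula A → Prop
  | top => True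
  | bot => True
  | pos a _ => a ∉ B
  | neg a _ => a ∉ B
  | eq _ _ => True
  | ne _ _ => True
  | or φ ψ => φ.Avoids B ∧ ψ.Avoids B
  | and φ ψ => φ.Avoids B ∧ ψ.Avoids B
  | ex _ φ => φ.Avoids B
  | all _ φ => φ.Avoids B
  | exInf _ φ => φ.Avoids B
  | allInf _ φ => φ.Avoids B

/-- The derived quantifier `W x.(φ, ψ) := ∀ x.(φ ∨ ψ) ∧ ∀∞ x.ψ`. -/
def W (x : ℕ) (φ ψ : Formula A) : Formula A := and (all x (or φ ψ)) (allInf x ψ)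

/-- Truth of a formula in the monadic model with domain `D` and valuation `V`, under an assignment
of the variables. -/
def Realize {D : Type u} (V : A → Set D) : Formula A → (ℕ → D) → Prop
  | top, _ => True
  | bot, _ => False
  | pos a x, g => g x ∈ V a
  | neg a x, g => g x ∉ V a
  | eq x y, g => g x = g y
  | ne x y, g => g x ≠ g y
  | or φ ψ, g => φ.Realize V g ∨ ψ.Realize V g
  | and φ ψ, g => φ.Realize V g ∧ ψ.Realize V g
  | ex x φ, g => ∃ d, φ.Realize V (Function.update g x d)
  | all x φ, g => ∀ d, φ.Realize V (Function.update g x d)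
  | exInf x φ, g => {d | φ.Realize V (Function.update g x d)}.Infinite
  | allInf x φ, g => {d | ¬ φ.Realize V (Function.update g x d)}.Finite

/-- Truth of a sentence in the model with empty domain. A sentence is a Boolean combination of
`⊤`, `⊥` and quantified formulas, so the value given to the other atomic formulas is irrelevant. -/
def TrueOnEmpty : Formula A → Prop
  | top => True
  | bot => False
  | pos _ _ => False
  | neg _ _ => False
  | eq _ _ => False
  | ne _ _ => False
  | or φ ψ => φ.TrueOnEmpty ∨ ψ.TrueOnEmpty
  | and φ ψ => φ.TrueOnEmpty ∧ ψ.TrueOnEmpty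
  | ex _ _ => False
  | all _ _ => True
  | exInf _ _ => False
  | allInf _ _ => True

/-- Truth of a sentence in a monadic model, whose domain may be empty. -/
def Models {D : Type u} (V : A → Set D) (φ : Formula A) : Prop :=
  (IsEmpty D ∧ φ.TrueOnEmpty) ∨ (Nonempty D ∧ ∀ g : ℕ → D, φ.Realize V g)

/-- Equivalence of sentences: truth in the same monadic models, the empty one included. -/
def Equivalent (φ ψ : Formula A) : Prop :=
  ∀ (D : Type u) (V : A → Set D), φ.Models V ↔ ψ.Models V

end Formula

/-- `V ≤_B V'`: the valuation `V'` is a `B`-extension of `V`. -/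
def ValLE {A : Type v} {D : Type u} (B : Set A) (V V' : A → Set D) : Prop :=
  (∀ b ∈ B, V b ⊆ V' b) ∧ ∀ a ∉ B, V a = V' a

/-- `U ≤^ω_B V`: moreover, `U b` is finite for every `b ∈ B`. -/
def ValFinLE {A : Type v} {D : Type u} (B : Set A) (U V : A → Set D) : Prop :=
  ValLE B U V ∧ ∀ b ∈ B, (U b).Finite

/-- Monotonicity in `B`. The domain is nonempty here as soon as there is an assignment; on the empty
domain there is only one valuation, so that nothing is lost. -/
def MonotoneIn {A : Type v} (B : Set A) (φ : Formula A) : Prop :=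
  ∀ (D : Type u) (V V' : A → Set D) (g : ℕ → D),
    φ.Realize V g → ValLE B V V' → φ.Realize V' g

/-- (Scott) continuity in `B`. -/
def ContinuousIn {A : Type v} (B : Set A) (φ : Formula A) : Prop :=
  MonotoneIn.{u} B φ ∧
    ∀ (D : Type u) (V : A → Set D) (g : ℕ → D),
      φ.Realize V g → ∃ U : A → Set D, ValFinLE B U V ∧ φ.Realize U g

/-- The formulas of `L(A)` that are syntactically continuous in `B`: generated from the `B`-free
formulas of `L(A)` and the atoms `b(x)`, `b ∈ B`, by `∧`, `∨`, `∃` and, for the logic with `∀∞`,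
by `W x.(φ, ψ)` with `ψ` a `B`-free formula. -/
inductive SynContinuous {A : Type v} (L : MLogic) (B : Set A) : Formula A → Prop
  | free (ψ : Formula A) (hL : ψ.InLogic L) (hB : ψ.Avoids B) : SynContinuous L B ψ
  | atom (b : A) (hb : b ∈ B) (x : ℕ) : SynContinuous L B (Formula.pos b x)
  | and {φ₁ φ₂ : Formula A} (h₁ : SynContinuous L B φ₁) (h₂ : SynContinuous L B φ₂) :
      SynContinuous L B (Formula.and φ₁ φ₂)
  | or {φ₁ φ₂ : Formula A} (h₁ : SynContinuous L B φ₁) (h₂ : SynContinuous L B φ₂) :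
      SynContinuous L B (Formula.or φ₁ φ₂)
  | ex (x : ℕ) {φ : Formula A} (h : SynContinuous L B φ) : SynContinuous L B (Formula.ex x φ)
  | w (x : ℕ) {φ ψ : Formula A} (hL : L = MLogic.FOEinf) (h : SynContinuous L B φ)
      (hB : ψ.Avoids B) : SynContinuous L B (Formula.W x φ ψ)

/-- The sentences of `L(A)`. -/
def Sentences (L : MLogic) (A : Type v) : Set (Formula A) :=
  {φ | φ.InLogic L ∧ φ.IsSentence}

/-- The sentences in the syntactically `B`-continuous fragment of `L(A)`. -/
def ContSentences {A : Type v} (L : MLogic) (B : Set A) : Set (Formula A) :=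
  {φ | SynContinuous L B φ ∧ φ.IsSentence}

/-- Gödel numbers of formulas, from a numbering of the predicate symbols. -/
def Formula.code {A : Type v} [Encodable A] : Formula A → ℕ
  | .top => Nat.pair 0 0
  | .bot => Nat.pair 1 0
  | .pos a x => Nat.pair 2 (Nat.pair (Encodable.encode a) x)
  | .neg a x => Nat.pair 3 (Nat.pair (Encodable.encode a) x)
  | .eq x y => Nat.pair 4 (Nat.pair x y)
  | .ne x y => Nat.pair 5 (Nat.pair x y)
  | .or φ ψ => Nat.pair 6 (Nat.pair φ.code ψ.code)
  | .and φ ψ => Nat.pair 7 (Nat.pair φ.code ψ.code)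
  | .ex x φ => Nat.pair 8 (Nat.pair x φ.code)
  | .all x φ => Nat.pair 9 (Nat.pair x φ.code)
  | .exInf x φ => Nat.pair 10 (Nat.pair x φ.code)
  | .allInf x φ => Nat.pair 11 (Nat.pair x φ.code)

/-- Different formulas have different Gödel numbers. -/
theorem Formula.code_injective {A : Type v} [Encodable A] :
    Function.Injective (Formula.code : Formula A → ℕ) := by
  intro φ
  induction φ <;> intro χ h <;> cases χ <;> simp_all [Formula.code, Nat.pair_eq_pair] <;>
    grind

/-- The map `t` is effective on the set `S` of formulas: some computable function sends the Gödel
number of every `φ ∈ S` to the Gödel number of `t φ`. -/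
def EffectiveOn {A : Type v} [Encodable A] (S : Set (Formula A)) (t : Formula A → Formula A) :
    Prop :=
  ∃ f : ℕ → ℕ, Computable f ∧ ∀ φ ∈ S, f φ.code = (t φ).code

/-- The property `P` is decidable on the set `S` of formulas: some computable function tells from the
Gödel number of any `φ ∈ S` whether `φ` has the property. -/
def DecidableOn {A : Type v} [Encodable A] (S : Set (Formula A)) (P : Formula A → Prop) : Prop :=
  ∃ f : ℕ → Bool, Computable f ∧ ∀ φ ∈ S, (f φ.code = true ↔ P φ)

end MonadicFO

/-! That the syntactic fragments are continuous is an induction on formulas. For the converse, a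
model is described by how often each colour (the set of predicates of an element) occurs. A sentence
of `FOEinf` with all variables below `K` sees these cardinalities only up to `K`, apart from whether
they are infinite (`realize_iff_of_sameCount`). A sentence of `M` sees only which colours occur
(`realize_sentence_iff_of_isM`).

Let a continuous `φ` hold in a model. It still holds after the predicates in `B` have been cut down
to a finite set, and then every colour that occurs infinitely often is free of `B`. A basic form
describes the cut-down model, but gives only lower bounds for colours: it names finitely many
elements and controls the others by `W`. In any model of this form the predicates in `B` can be
shrunk so that the colours occur as in the cut-down model; `φ` holds there, and by monotonicity it
holds in the given model (`exists_labelling_of_basicForm`, `ContinuousIn.exists_basicForm`). For `M`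
this is done after multiplying the domain by `ℕ` (`ContinuousIn.exists_basicFormM`). Only finitely
many basic forms are needed, so `φ` is a finite disjunction of them, corrected for the empty model.

For decidability, two valuations on one domain are coded by counting pairs of colours up to `K`.
Monotonicity becomes a condition on all such counts. In the finiteness clause, the unknown finite
set can be replaced by one explicit set: all elements of finite colours and `K` elements of each
infinite colour. Continuity thus becomes a statement about finitely many finite structures
(`continuousIn_iff_forall_count`), where truth is primitive recursive in the code; equivalence of
sentences is treated alike. The translation searches the fragment for an equivalent of the input if
the input is continuous, and otherwise accepts any member of the fragment, since none can be
equivalent to the input. -/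

namespace MonadicFO

open Function

variable {A : Type v} {X : Type*} {D : Type*} {D' : Type*}

/-! ### Variables of formulas. -/

namespace Formula

/-- All variables of the formula, free or bound, are smaller than `K`. -/
def VarsLT (K : ℕ) : Formula A → Prop
  | top => True
  | bot => True
  | pos _ x => x < K
  | neg _ x => x < K
  | eq x y => x < K ∧ y < K
  | ne x y => x < K ∧ y < K
  | or φ ψ => φ.VarsLT K ∧ ψ.VarsLT K
  | and φ ψ => φ.VarsLT K ∧ ψ.VarsLT K
  | ex x φ => x < K ∧ φ.VarsLT K
  | all x φ => x < K ∧ φ.VarsLT K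
  | exInf x φ => x < K ∧ φ.VarsLT K
  | allInf x φ => x < K ∧ φ.VarsLT K

theorem VarsLT.mono {K K' : ℕ} (h : K ≤ K') {φ : Formula A} (hφ : φ.VarsLT K) :
    φ.VarsLT K' := by
  induction φ <;> simp_all [VarsLT] <;> omega

theorem exists_varsLT (φ : Formula A) : ∃ K, φ.VarsLT K := by
  induction φ with
  | top => exact ⟨0, trivial⟩
  | bot => exact ⟨0, trivial⟩
  | pos a x => exact ⟨x + 1, Nat.lt_succ_self x⟩
  | neg a x => exact ⟨x + 1, Nat.lt_succ_self x⟩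
  | eq x y => exact ⟨x + y + 1, by simp only [VarsLT]; omega⟩
  | ne x y => exact ⟨x + y + 1, by simp only [VarsLT]; omega⟩
  | or φ ψ h₁ h₂ | and φ ψ h₁ h₂ =>
    obtain ⟨k, hk⟩ := h₁
    obtain ⟨l, hl⟩ := h₂
    exact ⟨k + l, hk.mono (by omega), hl.mono (by omega)⟩
  | ex x φ h | all x φ h | exInf x φ h | allInf x φ h =>
    obtain ⟨k, hk⟩ := h
    exact ⟨x + 1 + k, by omega, hk.mono (by omega)⟩

theorem VarsLT.lt_of_mem_freeVars {K : ℕ} {φ : Formula A} (h : φ.VarsLT K) {x : ℕ}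
    (hx : x ∈ φ.freeVars) : x < K := by
  induction φ with
  | top | bot => simp [freeVars] at hx
  | pos a y | neg a y =>
    rw [freeVars, Finset.mem_singleton] at hx
    exact hx ▸ h
  | eq y z | ne y z =>
    simp only [freeVars, Finset.mem_insert, Finset.mem_singleton] at hx
    rcases hx with rfl | rfl
    exacts [h.1, h.2]
  | or φ ψ ih₁ ih₂ | and φ ψ ih₁ ih₂ =>
    exact (Finset.mem_union.1 hx).elim (ih₁ h.1) (ih₂ h.2)
  | ex y φ ih | all y φ ih | exInf y φ ih | allInf y φ ih =>
    exact ih h.2 (Finset.mem_of_mem_erase hx)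

/-- The truth value of a formula depends only on the free variables. -/
theorem realize_congr {V : A → Set D} {φ : Formula A} :
    ∀ {g g' : ℕ → D}, (∀ x ∈ φ.freeVars, g x = g' x) → (φ.Realize V g ↔ φ.Realize V g') := by
  have key : ∀ (x : ℕ) (φ : Formula A) (g g' : ℕ → D),
      (∀ y ∈ φ.freeVars.erase x, g y = g' y) →
      ∀ d, ∀ y ∈ φ.freeVars, update g x d y = update g' x d y := by
    intro x φ g g' h d y hy
    rcases eq_or_ne y x with rfl | hne
    · simp
    · simpa [hne] using h y (Finset.mem_erase.2 ⟨hne, hy⟩)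
  induction φ with
  | top | bot => intros; rfl
  | pos a x | neg a x | eq x y | ne x y =>
    intro g g' h
    simp_all [Realize, freeVars]
  | or φ ψ h₁ h₂ | and φ ψ h₁ h₂ =>
    intro g g' h
    simp only [freeVars, Finset.mem_union] at h
    simp only [Realize]
    rw [h₁ fun x hx => h x (Or.inl hx), h₂ fun x hx => h x (Or.inr hx)]
  | ex x φ ih => exact fun h => exists_congr fun d => ih (key x φ _ _ h d)
  | all x φ ih => exact fun h => forall_congr' fun d => ih (key x φ _ _ h d)
  | exInf x φ ih =>
    intro g g' h
    simp only [Realize]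
    rw [Set.ext fun d => ih (key x φ _ _ h d)]
  | allInf x φ ih =>
    intro g g' h
    simp only [Realize]
    rw [Set.ext fun d => not_congr (ih (key x φ _ _ h d))]

theorem IsSentence.realize_iff {V : A → Set D} {φ : Formula A} (hφ : φ.IsSentence)
    (g g' : ℕ → D) : φ.Realize V g ↔ φ.Realize V g' :=
  realize_congr fun x hx => by simp [show φ.freeVars = ∅ from hφ] at hx

theorem IsSentence.models_iff {D : Type u} {V : A → Set D} {φ : Formula A} (hφ : φ.IsSentence)
    (g : ℕ → D) : φ.Models V ↔ φ.Realize V g := by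
  have : Nonempty D := ⟨g 0⟩
  simp only [Models, not_isEmpty_of_nonempty, this, false_and, true_and, false_or]
  exact ⟨fun h => h g, fun h g' => (hφ.realize_iff g g').1 h⟩

end Formula

/-! ### Labelled structures and the pebble game with `K` pebbles. -/

open Formula

/-- `d` is not the value under `g` of a variable below `K` other than `x`. -/
def IsFresh (K x : ℕ) (g : ℕ → D) (d : D) : Prop := ∀ y < K, y ≠ x → g y ≠ d

/-- Truth in the structure that is labelled by `lab`, where `π c` is the set of predicates of the
elements with label `c`. The quantifiers `∃∞` and `∀∞` range over the fresh elements with a label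
in `I`. -/
def FreshRealize (π : X → Set A) (I : Set X) (K : ℕ) (lab : D → X) :
    Formula A → (ℕ → D) → Prop
  | .top, _ => True
  | .bot, _ => False
  | .pos a x, g => a ∈ π (lab (g x))
  | .neg a x, g => a ∉ π (lab (g x))
  | .eq x y, g => g x = g y
  | .ne x y, g => g x ≠ g y
  | .or φ ψ, g => FreshRealize π I K lab φ g ∨ FreshRealize π I K lab ψ g
  | .and φ ψ, g => FreshRealize π I K lab φ g ∧ FreshRealize π I K lab ψ g
  | .ex x φ, g => ∃ d, FreshRealize π I K lab φ (update g x d)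
  | .all x φ, g => ∀ d, FreshRealize π I K lab φ (update g x d)
  | .exInf x φ, g =>
    ∃ d, lab d ∈ I ∧ IsFresh K x g d ∧ FreshRealize π I K lab φ (update g x d)
  | .allInf x φ, g =>
    ∀ d, lab d ∈ I → IsFresh K x g d → FreshRealize π I K lab φ (update g x d)

/-- Every label occurs equally often in both structures, if one counts up to `K`. -/
def SameCount (K : ℕ) (lab : D → X) (lab' : D' → X) : Prop :=
  ∀ c, ∀ n ≤ K, (n : ℕ∞) ≤ (lab ⁻¹' {c}).encard ↔ (n : ℕ∞) ≤ (lab' ⁻¹' {c}).encard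

/-- The variables below `K` define a partial isomorphism of the labelled structures. -/
def SameType (K : ℕ) (lab : D → X) (lab' : D' → X) (g : ℕ → D) (g' : ℕ → D') : Prop :=
  (∀ y < K, lab (g y) = lab' (g' y)) ∧ ∀ y < K, ∀ z < K, g y = g z ↔ g' y = g' z

section EF

variable {K : ℕ} {lab : D → X} {lab' : D' → X} {g : ℕ → D} {g' : ℕ → D'}

theorem SameCount.symm (h : SameCount K lab lab') : SameCount K lab' lab :=
  fun c n hn => (h c n hn).symm

theorem SameType.symm (h : SameType K lab lab' g g') : SameType K lab' lab g' g :=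
  ⟨fun y hy => (h.1 y hy).symm, fun y hy z hz => (h.2 y hy z hz).symm⟩

theorem SameType.update_of_fresh {x : ℕ} {d : D} {d' : D'} (h : SameType K lab lab' g g')
    (hl : lab d = lab' d') (hd : IsFresh K x g d) (hd' : IsFresh K x g' d') :
    SameType K lab lab' (update g x d) (update g' x d') := by
  refine ⟨fun y hy => ?_, fun y hy z hz => ?_⟩
  · rcases eq_or_ne y x with rfl | hne
    · simpa using hl
    · simpa [hne] using h.1 y hy
  · by_cases hy' : y = x <;> by_cases hz' : z = x
    · simp [hy', hz']
    · simpa [hy', hz', eq_comm] using iff_of_false (hd z hz hz') (hd' z hz hz')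
    · simpa [hy', hz'] using iff_of_false (hd y hy hy') (hd' y hy hy')
    · simpa [hy', hz'] using h.2 y hy z hz

theorem SameType.isFresh {x : ℕ} {d : D} {d' : D'} (hx : x < K) (hd : IsFresh K x g d)
    (h : SameType K lab lab' (update g x d) (update g' x d')) : IsFresh K x g' d' := by
  intro y hy hyx he
  have := (h.2 y hy x hx).2 (by simpa [hyx] using he)
  exact hd y hy hyx (by simpa [hyx] using this)

/-- By the hypothesis `f i ↦ f' i` is a well-defined surjection between the images. -/
theorem encard_image_le_of_eq_imp {ι : Type*} (S : Set ι) (f : ι → D) (f' : ι → D')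
    (h : ∀ i ∈ S, ∀ j ∈ S, f i = f j → f' i = f' j) : (f' '' S).encard ≤ (f '' S).encard := by
  classical
  rcases S.eq_empty_or_nonempty with rfl | ⟨i₀, -⟩
  · simp
  have : Nonempty ι := ⟨i₀⟩
  have : f' '' S = (fun d => f' (invFunOn f S d)) '' (f '' S) := by
    rw [Set.image_image]
    refine Set.image_congr fun i hi => ?_
    have hm : f i ∈ f '' S := ⟨i, hi, rfl⟩
    exact h _ hi _ (invFunOn_mem hm) (invFunOn_eq hm).symm
  rw [this]
  exact Set.encard_image_le _ _

/-- The answer to a move of pebble `x`. If `d` is fresh, its label class has one element more than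
the pebbled ones seen there, and this number is at most `K`, so the other structure also has an
unpebbled element with that label. -/
theorem SameType.extend (hc : SameCount K lab lab') (h : SameType K lab lab' g g') {x : ℕ}
    (hx : x < K) (d : D) :
    ∃ d', lab' d' = lab d ∧ SameType K lab lab' (update g x d) (update g' x d') := by
  classical
  by_cases hd : IsFresh K x g d
  · let S : Set ℕ := {y | y < K ∧ y ≠ x ∧ lab (g y) = lab d}
    have hS : S.encard + 1 ≤ K := by
      have hsub : insert x S ⊆ (Finset.range K : Set ℕ) := by
        rintro y (rfl | hy)
        · simpa using hx
        · simpa using hy.1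
      have := Set.encard_le_encard hsub
      rw [Set.encard_insert_of_notMem (fun h => h.2.1 rfl)] at this
      rwa [Set.encard_coe_eq_coe_finsetCard, Finset.card_range] at this
    have himg : (g '' S).encard = (g' '' S).encard := by
      apply le_antisymm
      · exact encard_image_le_of_eq_imp S g' g fun i hi j hj => (h.2 i hi.1 j hj.1).2
      · exact encard_image_le_of_eq_imp S g g' fun i hi j hj => (h.2 i hi.1 j hj.1).1
    have hgS : (g '' S).encard + 1 ≤ K :=
      (add_le_add_left (Set.encard_image_le g S) 1).trans hS
    obtain ⟨n, hn⟩ := ENat.ne_top_iff_exists.1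
      (ne_top_of_le_ne_top (ENat.natCast_ne_top K) (le_self_add.trans hgS))
    have hnK : n + 1 ≤ K := by rw [← hn] at hgS; exact_mod_cast hgS
    have hclass : ((n + 1 : ℕ) : ℕ∞) ≤ (lab ⁻¹' {lab d}).encard := by
      have hsub : insert d (g '' S) ⊆ lab ⁻¹' {lab d} := by
        rintro _ (rfl | ⟨y, hy, rfl⟩)
        · rfl
        · exact hy.2.2
      have := Set.encard_le_encard hsub
      rw [Set.encard_insert_of_notMem (by rintro ⟨y, hy, he⟩; exact hd y hy.1 hy.2.1 he), ← hn]
        at this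
      exact_mod_cast this
    have hclass' := (hc (lab d) (n + 1) hnK).1 hclass
    obtain ⟨d', hd', hnot⟩ : ∃ d' ∈ lab' ⁻¹' {lab d}, d' ∉ g' '' S := by
      by_contra! hcon
      have := hclass'.trans (Set.encard_le_encard hcon)
      rw [← himg, ← hn] at this
      have : n + 1 ≤ n := by exact_mod_cast this
      omega
    refine ⟨d', hd', h.update_of_fresh hd'.symm hd fun y hy hyx he => hnot ⟨y, ⟨hy, hyx, ?_⟩, he⟩⟩
    rw [h.1 y hy, he]
    exact hd'
  -- If `d` already carries another pebble `y`, the answer must be `g' y`.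
  · simp only [IsFresh, not_forall, not_not, ne_eq] at hd
    obtain ⟨y, hy, hyx, rfl⟩ := hd
    refine ⟨g' y, (h.1 y hy).symm, fun z hz => ?_, fun z hz w hw => ?_⟩
    · rcases eq_or_ne z x with rfl | hne
      · simpa using h.1 y hy
      · simpa [hne] using h.1 z hz
    · by_cases hz' : z = x <;> by_cases hw' : w = x
      · simp [hz', hw']
      · simpa [hz', hw'] using h.2 y hy w hw
      · simpa [hz', hw'] using h.2 z hz y hy
      · simpa [hz', hw'] using h.2 z hz w hw

/-- Back-and-forth induction. Pebbles are reused, so the condition on counts does not weaken with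
the quantifier depth. A fresh move is answered by a fresh move with the same label, which covers the
quantifiers `∃∞` and `∀∞`. -/
theorem freshRealize_iff (π : X → Set A) (I : Set X) (hc : SameCount K lab lab')
    {φ : Formula A} (hφ : φ.VarsLT K) {g : ℕ → D} {g' : ℕ → D'} (h : SameType K lab lab' g g') :
    FreshRealize π I K lab φ g ↔ FreshRealize π I K lab' φ g' := by
  induction φ generalizing g g' with
  | top | bot => rfl
  | pos a x | neg a x => simp only [FreshRealize, h.1 x hφ]
  | eq x y | ne x y => simp only [FreshRealize, ne_eq, h.2 x hφ.1 y hφ.2]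
  | or φ ψ h₁ h₂ | and φ ψ h₁ h₂ => simp only [FreshRealize, h₁ hφ.1 h, h₂ hφ.2 h]
  | ex x φ ih =>
    constructor
    · rintro ⟨d, hd⟩
      obtain ⟨d', -, h'⟩ := h.extend hc hφ.1 d
      exact ⟨d', (ih hφ.2 h').1 hd⟩
    · rintro ⟨d, hd⟩
      obtain ⟨d', -, h'⟩ := h.symm.extend hc.symm hφ.1 d
      exact ⟨d', (ih hφ.2 h'.symm).2 hd⟩
  | all x φ ih =>
    constructor
    · intro hall d
      obtain ⟨d', -, h'⟩ := h.symm.extend hc.symm hφ.1 d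
      exact (ih hφ.2 h'.symm).1 (hall d')
    · intro hall d
      obtain ⟨d', -, h'⟩ := h.extend hc hφ.1 d
      exact (ih hφ.2 h').2 (hall d')
  | exInf x φ ih =>
    constructor
    · rintro ⟨d, hI, hf, hd⟩
      obtain ⟨d', hl, h'⟩ := h.extend hc hφ.1 d
      exact ⟨d', hl ▸ hI, h'.isFresh hφ.1 hf, (ih hφ.2 h').1 hd⟩
    · rintro ⟨d, hI, hf, hd⟩
      obtain ⟨d', hl, h'⟩ := h.symm.extend hc.symm hφ.1 d
      exact ⟨d', hl ▸ hI, h'.isFresh hφ.1 hf, (ih hφ.2 h'.symm).2 hd⟩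
  | allInf x φ ih =>
    constructor
    · intro hall d hI hf
      obtain ⟨d', hl, h'⟩ := h.symm.extend hc.symm hφ.1 d
      exact (ih hφ.2 h'.symm).1 (hall d' (hl ▸ hI) (h'.isFresh hφ.1 hf))
    · intro hall d hI hf
      obtain ⟨d', hl, h'⟩ := h.extend hc hφ.1 d
      exact (ih hφ.2 h').2 (hall d' (hl ▸ hI) (h'.isFresh hφ.1 hf))

/-- The valuation of a labelled structure. -/
def labVal (π : X → Set A) (lab : D → X) (a : A) : Set D := {d | a ∈ π (lab d)}

/-- There are finitely many labels and finitely many pebbled elements, so an infinite set contains a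
fresh element of an infinite label class. Conversely, one fresh witness spreads to all fresh
elements of its class. -/
theorem infinite_iff_exists_fresh [Finite X] {I : Set X}
    (hI : ∀ d, lab d ∈ I ↔ (lab ⁻¹' {lab d}).Infinite) {x : ℕ} {P : D → Prop}
    (hP : ∀ d d', lab d = lab d' → IsFresh K x g d → IsFresh K x g d' → P d → P d') :
    {d | P d}.Infinite ↔ ∃ d, lab d ∈ I ∧ IsFresh K x g d ∧ P d := by
  have hfin : (g '' Set.Iio K).Finite := (Set.finite_Iio K).image g
  constructor
  · intro hinf
    obtain ⟨c, hc⟩ : ∃ c, ({d | P d} ∩ lab ⁻¹' {c}).Infinite := by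
      by_contra! hcon
      refine hinf (((Set.finite_iUnion fun c => hcon c)).subset ?_)
      intro d hd
      exact Set.mem_iUnion.2 ⟨lab d, hd, rfl⟩
    obtain ⟨d, ⟨hPd, hdc⟩, hd⟩ := (hc.sdiff hfin).nonempty
    refine ⟨d, (hI _).2 ?_, fun y hy _ he => hd ⟨y, hy, he⟩, hPd⟩
    rw [show lab d = c from hdc]
    exact hc.mono Set.inter_subset_right
  · rintro ⟨d, hd, hf, hPd⟩
    refine (((hI _).1 hd).sdiff hfin).mono fun d' hd' => ?_
    exact hP d d' (Eq.symm hd'.1) hf (fun y hy _ he => hd'.2 ⟨y, hy, he⟩) hPd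

/-- The invariance required by `infinite_iff_exists_fresh` is `freshRealize_iff` for the structure
and itself: exchanging a fresh element for another one with the same label preserves the type. -/
theorem freshRealize_iff_realize [Finite X] (π : X → Set A) {I : Set X}
    (hI : ∀ d, lab d ∈ I ↔ (lab ⁻¹' {lab d}).Infinite) {φ : Formula A} (hφ : φ.VarsLT K) {g : ℕ → D} :
    FreshRealize π I K lab φ g ↔ φ.Realize (labVal π lab) g := by
  have hc : SameCount K lab lab := fun _ _ _ => Iff.rfl
  have hg : ∀ g, SameType K lab lab g g := fun g => ⟨fun _ _ => rfl, fun _ _ _ _ => Iff.rfl⟩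
  induction φ generalizing g with
  | top | bot | pos a x | neg a x | eq x y | ne x y => rfl
  | or φ ψ h₁ h₂ | and φ ψ h₁ h₂ => simp only [FreshRealize, Realize, h₁ hφ.1, h₂ hφ.2]
  | ex x φ ih => exact exists_congr fun d => ih hφ.2
  | all x φ ih => exact forall_congr' fun d => ih hφ.2
  | exInf x φ ih =>
    simp only [FreshRealize, Realize, ← ih hφ.2]
    refine (infinite_iff_exists_fresh hI fun d d' hl hf hf' h => ?_).symm
    exact (freshRealize_iff π I hc hφ.2 ((hg g).update_of_fresh hl hf hf')).1 h
  | allInf x φ ih =>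
    simp only [FreshRealize, Realize, ← ih hφ.2, ← Set.not_infinite]
    rw [infinite_iff_exists_fresh hI (g := g) (K := K) (x := x) fun d d' hl hf hf' h => ?_]
    · push Not
      rfl
    · exact (not_congr (freshRealize_iff π I hc hφ.2
        ((hg g).update_of_fresh hl hf hf'))).1 h

theorem sameType_const {d : D} {d' : D'} (h : lab d = lab' d') :
    SameType K lab lab' (fun _ => d) (fun _ => d') :=
  ⟨fun _ _ => h, fun _ _ _ _ => by simp⟩

theorem SameCount.exists_eq (hc : SameCount K lab lab') (hK : 0 < K) (d : D) :
    ∃ d', lab d = lab' d' := by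
  have h : ((1 : ℕ) : ℕ∞) ≤ (lab ⁻¹' {lab d}).encard := by
    rw [Nat.cast_one, Set.one_le_encard_iff_nonempty]
    exact ⟨d, rfl⟩
  have := (hc _ 1 hK).1 h
  rw [Nat.cast_one, Set.one_le_encard_iff_nonempty] at this
  obtain ⟨d', hd'⟩ := this
  exact ⟨d', hd'.symm⟩

/-- Sentences are evaluated at constant assignments; asking for the existence of one also makes
everything false in the empty structure. -/
theorem exists_const_freshRealize_iff (π : X → Set A) (I : Set X) (hc : SameCount K lab lab')
    (hK : 0 < K) {φ : Formula A} (hφ : φ.VarsLT K) :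
    (∃ d, FreshRealize π I K lab φ fun _ => d) ↔ ∃ d, FreshRealize π I K lab' φ fun _ => d := by
  constructor
  · rintro ⟨d, hd⟩
    obtain ⟨d', h⟩ := hc.exists_eq hK d
    exact ⟨d', (freshRealize_iff π I hc hφ (sameType_const h)).1 hd⟩
  · rintro ⟨d, hd⟩
    obtain ⟨d', h⟩ := hc.symm.exists_eq hK d
    exact ⟨d', (freshRealize_iff π I hc hφ (sameType_const h.symm)).2 hd⟩

/-- Sentences do not distinguish models in which every colour occurs equally often, up to `K`, and
the same colours occur infinitely often. -/
theorem realize_iff_of_sameCount [Finite X] (π : X → Set A) (hc : SameCount K lab lab')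
    (hinf : ∀ c, (lab ⁻¹' {c}).Infinite ↔ (lab' ⁻¹' {c}).Infinite) (hK : 0 < K)
    {φ : Formula A} (hs : φ.IsSentence) (hφ : φ.VarsLT K) (g : ℕ → D) (g' : ℕ → D') :
    φ.Realize (labVal π lab) g ↔ φ.Realize (labVal π lab') g' := by
  obtain ⟨d', h⟩ := hc.exists_eq hK (g 0)
  rw [hs.realize_iff g (fun _ => g 0), hs.realize_iff g' (fun _ => d'),
    ← freshRealize_iff_realize π (I := {c | (lab ⁻¹' {c}).Infinite}) (fun _ => Iff.rfl) hφ,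
    ← freshRealize_iff_realize π (I := {c | (lab ⁻¹' {c}).Infinite})
      (fun _ => hinf _) hφ]
  exact freshRealize_iff π _ hc hφ (sameType_const h)

end EF

end MonadicFO

/-! ### Colours, restrictions of valuations, and continuity of the syntactic fragments. -/

namespace MonadicFO

open Function Formula

variable {A : Type v} {D : Type*}

/-- The set of predicates that hold of `d`. -/
def colour (V : A → Set D) (d : D) : Set A := {a | d ∈ V a}

/-- The colour `c'` contains `c` and agrees with `c` outside `B`. -/
def ColourLE (B c c' : Set A) : Prop := c ⊆ c' ∧ ∀ a ∈ c', a ∉ B → a ∈ c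

/-- A `B`-free lower bound of a colour is unique. This identifies the colours that occur infinitely
often in a model of a basic form. -/
theorem ColourLE.eq_diff {B c c' : Set A} (h : ColourLE B c c') (hc : Disjoint c B) :
    c = c' \ B := by
  ext a
  exact ⟨fun ha => ⟨h.1 ha, Set.disjoint_left.1 hc ha⟩, fun ha => h.2 a ha.1 ha.2⟩

theorem colourLE_diff (B c : Set A) : ColourLE B (c \ B) c :=
  ⟨Set.sdiff_subset, fun _ h h' => ⟨h, h'⟩⟩

theorem valLE_iff {B : Set A} {U V : A → Set D} :
    ValLE B U V ↔ ∀ d, ColourLE B (colour U d) (colour V d) := by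
  constructor
  · refine fun h d => ⟨fun a ha => ?_, fun a ha hB => ?_⟩
    · by_cases hB : a ∈ B
      · exact h.1 a hB ha
      · exact (h.2 a hB ▸ ha : d ∈ V a)
    · exact (h.2 a hB ▸ ha : d ∈ U a)
  · refine fun h => ⟨fun _ _ d hd => (h d).1 hd, fun a ha => Set.ext fun d => ?_⟩
    exact ⟨fun hd => (h d).1 hd, fun hd => (h d).2 a hd ha⟩

/-- The valuation in which the predicates in `B` are restricted to `F`. -/
def restrictVal (B : Set A) (F : Set D) (V : A → Set D) : A → Set D :=
  fun a => {d | d ∈ V a ∧ (a ∈ B → d ∈ F)}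

theorem restrictVal_valLE (B : Set A) (F : Set D) (V : A → Set D) :
    ValLE B (restrictVal B F V) V :=
  ⟨fun _ _ _ h => h.1, fun a ha => Set.ext fun d => by simp [restrictVal, ha]⟩

theorem restrictVal_valFinLE (B : Set A) {F : Set D} (hF : F.Finite) (V : A → Set D) :
    ValFinLE B (restrictVal B F V) V :=
  ⟨restrictVal_valLE B F V, fun _ hb => hF.subset fun _ h => h.2 hb⟩

theorem restrictVal_mono (B : Set A) {F F' : Set D} (h : F ⊆ F') (V : A → Set D) :
    ValLE B (restrictVal B F V) (restrictVal B F' V) :=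
  ⟨fun _ _ _ hd => ⟨hd.1, fun hb => h (hd.2 hb)⟩,
    fun a ha => Set.ext fun d => by simp [restrictVal, ha]⟩

/-- As `A` is finite, the union of the finite sets `U b` is a single finite set to restrict to. -/
theorem ValFinLE.exists_restrictVal [Finite A] {B : Set A} {U V : A → Set D}
    (h : ValFinLE B U V) : ∃ F : Set D, F.Finite ∧ ValLE B U (restrictVal B F V) := by
  refine ⟨⋃ b ∈ B, U b, (Set.toFinite B).biUnion h.2, fun b hb d hd => ?_, fun a ha => ?_⟩
  · exact ⟨h.1.1 b hb hd, fun _ => Set.mem_biUnion hb hd⟩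
  · rw [h.1.2 a ha]
    exact Set.ext fun d => by simp [restrictVal, ha]

theorem realize_congr_of_avoids {B : Set A} {φ : Formula A} (hφ : φ.Avoids B)
    {V V' : A → Set D} (h : ∀ a ∉ B, V a = V' a) {g : ℕ → D} :
    φ.Realize V g ↔ φ.Realize V' g := by
  induction φ generalizing g with
  | top | bot | eq x y | ne x y => rfl
  | pos a x | neg a x => simp only [Realize, h a hφ]
  | or φ ψ h₁ h₂ | and φ ψ h₁ h₂ => simp only [Realize, h₁ hφ.1, h₂ hφ.2]
  | ex x φ ih | all x φ ih | exInf x φ ih | allInf x φ ih => simp only [Realize, ih hφ]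

theorem SynContinuous.realize_mono {L : MLogic} {B : Set A} {φ : Formula A}
    (hφ : SynContinuous L B φ) {V V' : A → Set D} (hV : ValLE B V V') {g : ℕ → D}
    (h : φ.Realize V g) : φ.Realize V' g := by
  induction hφ generalizing g with
  | free ψ hL hB => exact (realize_congr_of_avoids hB hV.2).1 h
  | atom b hb x => exact hV.1 b hb h
  | and h₁ h₂ ih₁ ih₂ => exact ⟨ih₁ h.1, ih₂ h.2⟩
  | or h₁ h₂ ih₁ ih₂ => exact h.imp ih₁ ih₂
  | ex x h' ih => exact h.imp fun d => ih
  | @w x φ ψ hL h' hB ih =>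
    obtain ⟨hall, hinf⟩ := h
    refine ⟨fun d => (hall d).imp ih (realize_congr_of_avoids hB hV.2).1, hinf.subset ?_⟩
    exact fun d hd hd' => hd ((realize_congr_of_avoids hB hV.2).1 hd')

/-- Enlarging the finite set preserves truth by `realize_mono`, so finitely many finite sets can be
united. -/
theorem SynContinuous.exists_restrictVal {L : MLogic} {B : Set A} {φ : Formula A}
    (hφ : SynContinuous L B φ) {V : A → Set D} {g : ℕ → D} (h : φ.Realize V g) :
    ∃ F : Set D, F.Finite ∧ φ.Realize (restrictVal B F V) g := by
  induction hφ generalizing g with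
  | free ψ hL hB =>
    exact ⟨∅, Set.finite_empty,
      (realize_congr_of_avoids hB (restrictVal_valLE B ∅ V).2).2 h⟩
  | atom b hb x => exact ⟨{g x}, Set.finite_singleton _, h, fun _ => rfl⟩
  | and h₁ h₂ ih₁ ih₂ =>
    obtain ⟨F₁, hF₁, hr₁⟩ := ih₁ h.1
    obtain ⟨F₂, hF₂, hr₂⟩ := ih₂ h.2
    exact ⟨F₁ ∪ F₂, hF₁.union hF₂,
      h₁.realize_mono (restrictVal_mono B Set.subset_union_left V) hr₁,
      h₂.realize_mono (restrictVal_mono B Set.subset_union_right V) hr₂⟩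
  | or h₁ h₂ ih₁ ih₂ =>
    rcases h with h | h
    · obtain ⟨F, hF, hr⟩ := ih₁ h
      exact ⟨F, hF, Or.inl hr⟩
    · obtain ⟨F, hF, hr⟩ := ih₂ h
      exact ⟨F, hF, Or.inr hr⟩
  | ex x h' ih =>
    obtain ⟨d, hd⟩ := h
    obtain ⟨F, hF, hr⟩ := ih hd
    exact ⟨F, hF, d, hr⟩
  | @w x φ ψ hL h' hB ih =>
    obtain ⟨hall, hinf⟩ := h
    have hψ : ∀ (F : Set D) (g : ℕ → D), ψ.Realize (restrictVal B F V) g ↔ ψ.Realize V g :=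
      fun F g => realize_congr_of_avoids hB (restrictVal_valLE B F V).2
    have hex : ∀ d, ∃ F : Set D, F.Finite ∧ (¬ ψ.Realize V (update g x d) →
        φ.Realize (restrictVal B F V) (update g x d)) := by
      intro d
      rcases hall d with hd | hd
      · obtain ⟨F, hF, hr⟩ := ih hd
        exact ⟨F, hF, fun _ => hr⟩
      · exact ⟨∅, Set.finite_empty, fun h => absurd hd h⟩
    choose F hF hr using hex
    -- Only the elements violating `ψ` need `φ`. The conjunct with `∀∞` makes them finite in number,
    -- and `ψ` does not notice the restriction.
    refine ⟨⋃ d ∈ {d | ¬ ψ.Realize V (update g x d)}, F d, hinf.biUnion fun d _ => hF d,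
      fun d => ?_, ?_⟩
    · by_cases hd : ψ.Realize V (update g x d)
      · exact Or.inr ((hψ _ _).2 hd)
      · exact Or.inl (h'.realize_mono
          (restrictVal_mono B (Set.subset_biUnion_of_mem (u := F) hd) V) (hr d hd))
    · simpa only [Realize, hψ] using hinf

theorem SynContinuous.continuousIn {L : MLogic} {B : Set A} {φ : Formula A}
    (hφ : SynContinuous L B φ) : ContinuousIn.{u} B φ := by
  refine ⟨fun D V V' g h hV => hφ.realize_mono hV h, fun D V g h => ?_⟩
  obtain ⟨F, hF, hr⟩ := hφ.exists_restrictVal h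
  exact ⟨_, restrictVal_valFinLE B hF V, hr⟩

/-- Monotonicity allows the valuation `U` from the definition to be enlarged to a restriction of
`V`. -/
theorem ContinuousIn.exists_restrictVal [Finite A] {B : Set A} {φ : Formula A}
    (hφ : ContinuousIn.{u} B φ) {D : Type u} {V : A → Set D} {g : ℕ → D} (h : φ.Realize V g) :
    ∃ F : Set D, F.Finite ∧ φ.Realize (restrictVal B F V) g := by
  obtain ⟨U, hU, hr⟩ := hφ.2 D V g h
  obtain ⟨F, hF, hle⟩ := hU.exists_restrictVal
  exact ⟨F, hF, hφ.1 D _ _ g hr hle⟩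

theorem ContinuousIn.congr {B : Set A} {φ ψ : Formula A} (hφ : ContinuousIn.{u} B φ)
    (h : ∀ (D : Type u) (V : A → Set D) (g : ℕ → D), φ.Realize V g ↔ ψ.Realize V g) :
    ContinuousIn.{u} B ψ := by
  simpa only [ContinuousIn, MonotoneIn, h] using hφ

theorem Formula.Equivalent.realize_iff {φ ψ : Formula A} (h : Equivalent.{u} φ ψ)
    (hφ : φ.IsSentence) (hψ : ψ.IsSentence) (D : Type u) (V : A → Set D) (g : ℕ → D) :
    φ.Realize V g ↔ ψ.Realize V g := by
  rw [← hφ.models_iff, ← hψ.models_iff, h D V]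

theorem Formula.equivalent_iff {φ ψ : Formula A} (hφ : φ.IsSentence) (hψ : ψ.IsSentence) :
    Equivalent.{u} φ ψ ↔ (φ.TrueOnEmpty ↔ ψ.TrueOnEmpty) ∧
      ∀ (D : Type u) (V : A → Set D) (g : ℕ → D), φ.Realize V g ↔ ψ.Realize V g := by
  refine ⟨fun h => ⟨?_, h.realize_iff hφ hψ⟩, fun h D V => ?_⟩
  · have : IsEmpty PEmpty.{u + 1} := inferInstance
    simpa [Models, this] using h PEmpty fun _ => ∅
  · rcases isEmpty_or_nonempty D with hD | ⟨⟨d⟩⟩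
    · simpa [Models, hD, not_nonempty_iff.2 hD] using h.1
    · rw [hφ.models_iff fun _ => d, hψ.models_iff fun _ => d, h.2]

/-! ### Basic forms. -/

namespace Formula

/-- The disjunction of a list of formulas. -/
def bigOr : List (Formula A) → Formula A
  | [] => bot
  | φ :: l => or φ (bigOr l)

/-- The conjunction of a list of formulas. -/
def bigAnd : List (Formula A) → Formula A
  | [] => top
  | φ :: l => and φ (bigAnd l)

theorem realize_bigOr {V : A → Set D} {g : ℕ → D} {l : List (Formula A)} :
    (bigOr l).Realize V g ↔ ∃ φ ∈ l, φ.Realize V g := by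
  induction l with
  | nil => simp [bigOr, Realize]
  | cons φ l ih => simp [bigOr, Realize, ih]

theorem realize_bigAnd {V : A → Set D} {g : ℕ → D} {l : List (Formula A)} :
    (bigAnd l).Realize V g ↔ ∀ φ ∈ l, φ.Realize V g := by
  induction l with
  | nil => simp [bigAnd, Realize]
  | cons φ l ih => simp [bigAnd, Realize, ih]

theorem freeVars_bigOr {S : Finset ℕ} {l : List (Formula A)} (h : ∀ φ ∈ l, φ.freeVars ⊆ S) :
    (bigOr l).freeVars ⊆ S := by
  induction l with
  | nil => simp [bigOr, freeVars]
  | cons φ l ih =>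
    simp only [List.forall_mem_cons] at h
    exact Finset.union_subset h.1 (ih h.2)

theorem freeVars_bigAnd {S : Finset ℕ} {l : List (Formula A)} (h : ∀ φ ∈ l, φ.freeVars ⊆ S) :
    (bigAnd l).freeVars ⊆ S := by
  induction l with
  | nil => simp [bigAnd, freeVars]
  | cons φ l ih =>
    simp only [List.forall_mem_cons] at h
    exact Finset.union_subset h.1 (ih h.2)

theorem avoids_bigOr {B : Set A} {l : List (Formula A)} (h : ∀ φ ∈ l, φ.Avoids B) :
    (bigOr l).Avoids B := by
  induction l with
  | nil => trivial
  | cons φ l ih =>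
    simp only [List.forall_mem_cons] at h
    exact ⟨h.1, ih h.2⟩

theorem avoids_bigAnd {B : Set A} {l : List (Formula A)} (h : ∀ φ ∈ l, φ.Avoids B) :
    (bigAnd l).Avoids B := by
  induction l with
  | nil => trivial
  | cons φ l ih =>
    simp only [List.forall_mem_cons] at h
    exact ⟨h.1, ih h.2⟩

theorem isM_bigOr {l : List (Formula A)} (h : ∀ φ ∈ l, φ.IsM) : (bigOr l).IsM := by
  induction l with
  | nil => trivial
  | cons φ l ih =>
    simp only [List.forall_mem_cons] at h
    exact ⟨h.1, ih h.2⟩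

theorem isM_bigAnd {l : List (Formula A)} (h : ∀ φ ∈ l, φ.IsM) : (bigAnd l).IsM := by
  induction l with
  | nil => trivial
  | cons φ l ih =>
    simp only [List.forall_mem_cons] at h
    exact ⟨h.1, ih h.2⟩

theorem IsM.inLogic {φ : Formula A} (h : φ.IsM) : ∀ L : MLogic, φ.InLogic L
  | MLogic.M => h
  | MLogic.FOEinf => trivial

theorem synContinuous_bigOr {L : MLogic} {B : Set A} {l : List (Formula A)}
    (h : ∀ φ ∈ l, SynContinuous L B φ) : SynContinuous L B (bigOr l) := by
  induction l with
  | nil => exact .free bot (IsM.inLogic (φ := bot) trivial L) trivial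
  | cons φ l ih =>
    simp only [List.forall_mem_cons] at h
    exact .or h.1 (ih h.2)

theorem synContinuous_bigAnd {L : MLogic} {B : Set A} {l : List (Formula A)}
    (h : ∀ φ ∈ l, SynContinuous L B φ) : SynContinuous L B (bigAnd l) := by
  induction l with
  | nil => exact .free top (IsM.inLogic (φ := top) trivial L) trivial
  | cons φ l ih =>
    simp only [List.forall_mem_cons] at h
    exact .and h.1 (ih h.2)

/-- Existential quantification of the variables below `r`. -/
def exs : ℕ → Formula A → Formula A
  | 0, φ => φ
  | r + 1, φ => exs r (ex r φ)

theorem realize_exs {V : A → Set D} {r : ℕ} {φ : Formula A} {g : ℕ → D} :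
    (exs r φ).Realize V g ↔ ∃ g', (∀ y, r ≤ y → g' y = g y) ∧ φ.Realize V g' := by
  induction r generalizing φ with
  | zero =>
    refine ⟨fun h => ⟨g, fun _ _ => rfl, h⟩, ?_⟩
    rintro ⟨g', hg', h⟩
    rwa [← funext fun y => hg' y (Nat.zero_le y)]
  | succ r ih =>
    rw [exs, ih]
    constructor
    · rintro ⟨g', hg', d, hd⟩
      refine ⟨_, fun y hy => ?_, hd⟩
      rw [update_of_ne (by omega), hg' y (by omega)]
    · rintro ⟨g', hg', h⟩
      refine ⟨update g' r (g r), fun y hy => ?_, g' r, by simpa using h⟩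
      rcases eq_or_ne y r with rfl | hne
      · simp
      · rw [update_of_ne hne, hg' y (by omega)]

theorem freeVars_exs {r : ℕ} {φ : Formula A} (h : φ.freeVars ⊆ Finset.range r) :
    (exs r φ).freeVars = ∅ := by
  induction r generalizing φ with
  | zero => simpa [exs] using h
  | succ r ih =>
    refine ih fun y hy => ?_
    simp only [freeVars, Finset.mem_erase] at hy
    have := Finset.mem_range.1 (h hy.2)
    exact Finset.mem_range.2 (by omega)

theorem synContinuous_exs {L : MLogic} {B : Set A} {r : ℕ} {φ : Formula A}
    (h : SynContinuous L B φ) : SynContinuous L B (exs r φ) := by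
  induction r generalizing φ with
  | zero => exact h
  | succ r ih => exact ih (.ex r h)

section Colour

variable [Finite A] (B : Set A)

open Classical in
/-- The formula that describes the elements whose colour is at least `c` in the sense of
`ColourLE B`. -/
noncomputable def colourForm (c : Set A) (x : ℕ) : Formula A :=
  bigAnd ((Set.finite_univ (α := A)).toFinset.toList.map fun a =>
    if a ∈ c then pos a x else if a ∈ B then top else neg a x)

theorem forall_mem_colourForm {P : Formula A → Prop} {c : Set A} {x : ℕ}
    (hpos : ∀ a ∈ c, P (pos a x)) (htop : P top) (hneg : ∀ a ∉ B, P (neg a x)) :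
    open Classical in
    ∀ φ ∈ ((Set.finite_univ (α := A)).toFinset.toList.map fun a =>
      if a ∈ c then pos a x else if a ∈ B then top else neg a x), P φ := by
  simp only [List.mem_map, forall_exists_index, and_imp]
  rintro _ a - rfl
  split_ifs with h₁ h₂
  exacts [hpos a h₁, htop, hneg a h₂]

theorem realize_colourForm {V : A → Set D} {c : Set A} {x : ℕ} {g : ℕ → D} :
    (colourForm B c x).Realize V g ↔ ColourLE B c (colour V (g x)) := by
  classical
  simp only [colourForm, realize_bigAnd, List.mem_map, Finset.mem_toList,
    Set.Finite.mem_toFinset, Set.mem_univ, true_and, forall_exists_index,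
    forall_apply_eq_imp_iff]
  constructor
  · refine fun h => ⟨fun a ha => ?_, fun a ha hB => ?_⟩
    · have := h a
      rwa [if_pos ha] at this
    · by_contra hc
      have := h a
      rw [if_neg hc, if_neg hB] at this
      exact this ha
  · intro h a
    split_ifs with h₁ h₂
    · exact h.1 h₁
    · trivial
    · exact fun ha => h₁ (h.2 a ha h₂)

theorem freeVars_colourForm (c : Set A) (x : ℕ) : (colourForm B c x).freeVars ⊆ {x} :=
  freeVars_bigAnd <| forall_mem_colourForm B (by simp [freeVars]) (by simp [freeVars])
    (by simp [freeVars])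

theorem isM_colourForm (c : Set A) (x : ℕ) : (colourForm B c x).IsM :=
  isM_bigAnd <| forall_mem_colourForm B (by simp [IsM]) (by simp [IsM]) (by simp [IsM])

/-- Predicates in `B` outside `c` contribute only `top`. For `B`-free colours the formula may
therefore stand under `all`, `exInf` and `allInf`. -/
theorem avoids_colourForm {c : Set A} (hc : Disjoint c B) (x : ℕ) :
    (colourForm B c x).Avoids B :=
  avoids_bigAnd <| forall_mem_colourForm B (fun _ ha => Set.disjoint_left.1 hc ha)
    trivial fun _ ha => ha

theorem synContinuous_colourForm (L : MLogic) (c : Set A) (x : ℕ) :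
    SynContinuous L B (colourForm B c x) := by
  refine synContinuous_bigAnd <| forall_mem_colourForm B (fun a _ => ?_)
    (.free top (IsM.inLogic (φ := top) trivial L) trivial)
    fun a ha => .free _ (IsM.inLogic (φ := neg a x) trivial L) ha
  by_cases ha : a ∈ B
  · exact .atom a ha x
  · exact .free _ (IsM.inLogic (φ := pos a x) trivial L) ha

theorem freeVars_bigOr_colourForm (S : Finset (Set A)) (x : ℕ) :
    (bigOr (S.toList.map fun c => colourForm B c x)).freeVars ⊆ {x} :=
  freeVars_bigOr <| by
    simp only [List.mem_map, forall_exists_index, and_imp]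
    rintro _ c - rfl
    exact freeVars_colourForm B c x

theorem avoids_bigOr_colourForm {S : Finset (Set A)} (hS : ∀ c ∈ S, Disjoint c B) (x : ℕ) :
    (bigOr (S.toList.map fun c => colourForm B c x)).Avoids B :=
  avoids_bigOr <| by
    simp only [List.mem_map, Finset.mem_toList, forall_exists_index, and_imp]
    rintro _ c hc rfl
    exact avoids_colourForm B (hS c hc) x

theorem isM_bigOr_colourForm (S : Finset (Set A)) (x : ℕ) :
    (bigOr (S.toList.map fun c => colourForm B c x)).IsM :=
  isM_bigOr <| by
    simp only [List.mem_map, forall_exists_index, and_imp]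
    rintro _ c - rfl
    exact isM_colourForm B c x

/-- The `B`-continuous basic form of `M`: the colours in `T` occur, up to an increase of the
predicates in `B`, and outside `B` every element has a colour in `E`. -/
noncomputable def basicFormM (T E : Finset (Set A)) : Formula A :=
  and (bigAnd (T.toList.map fun c => ex 0 (colourForm B c 0)))
    (all 0 (bigOr (E.toList.map fun c => colourForm B c 0)))

theorem realize_basicFormM {T E : Finset (Set A)} {V : A → Set D} {g : ℕ → D} :
    (basicFormM B T E).Realize V g ↔
      (∀ c ∈ T, ∃ d, ColourLE B c (colour V d)) ∧ ∀ d, ∃ c ∈ E, ColourLE B c (colour V d) := by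
  simp [basicFormM, Realize, realize_bigAnd, realize_bigOr, realize_colourForm]

theorem basicFormM_mem {L : MLogic} {T E : Finset (Set A)} (hE : ∀ c ∈ E, Disjoint c B) :
    basicFormM B T E ∈ ContSentences L B := by
  have erase_subset : ∀ {φ : Formula A}, φ.freeVars ⊆ {0} → φ.freeVars.erase 0 ⊆ ∅ := by
    intro φ h y hy
    rw [Finset.mem_erase] at hy
    exact absurd (Finset.mem_singleton.1 (h hy.2)) hy.1
  refine ⟨.and (synContinuous_bigAnd ?_) (.free _ ?_ ?_), ?_⟩
  · simp only [List.mem_map, forall_exists_index, and_imp]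
    rintro _ c - rfl
    exact .ex 0 (synContinuous_colourForm B L c 0)
  · exact IsM.inLogic (φ := all 0 _) (isM_bigOr_colourForm B E 0) L
  · exact avoids_bigOr_colourForm B hE 0
  · refine Finset.subset_empty.1 (Finset.union_subset (freeVars_bigAnd ?_) ?_)
    · simp only [List.mem_map, forall_exists_index, and_imp]
      rintro _ c - rfl
      exact erase_subset (freeVars_colourForm B c 0)
    · exact erase_subset (freeVars_bigOr_colourForm B E 0)

/-- The quantifier-free part of `basicForm`, with a free variable for each of the `x i`. -/
noncomputable def basicFormBody {r : ℕ} (cs : Fin r → Set A) (P S : Finset (Set A)) :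
    Formula A :=
  and
    (and (bigAnd ((List.finRange r).map fun i => colourForm B (cs i) i))
      (bigAnd ((List.finRange r).flatMap fun i : Fin r => (List.finRange r).map fun j : Fin r =>
        if i = j then top else ne (i : ℕ) (j : ℕ))))
    (and
      -- The variable `r` is the first one that does not stand for one of the named elements.
      (W r (or (bigOr ((List.finRange r).map fun i : Fin r => eq r (i : ℕ)))
          (bigOr (P.toList.map fun c => colourForm B c r)))
        (bigOr (S.toList.map fun c => colourForm B c r)))
      (bigAnd (S.toList.map fun c => exInf r (colourForm B c r))))

/-- The `B`-continuous basic form of `FOE∞`: there are different elements `x i` with colours at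
least `cs i`, every other element has a colour at least one in `P` or in `S`, all but finitely many
elements have one in `S`, and each of the colours in `S` occurs infinitely often. -/
noncomputable def basicForm {r : ℕ} (cs : Fin r → Set A) (P S : Finset (Set A)) : Formula A :=
  exs r (basicFormBody B cs P S)

theorem realize_basicForm {r : ℕ} {cs : Fin r → Set A} {P S : Finset (Set A)} {V : A → Set D}
    {g : ℕ → D} :
    (basicForm B cs P S).Realize V g ↔ ∃ f : Fin r → D, Injective f ∧
      (∀ i, ColourLE B (cs i) (colour V (f i))) ∧
      (∀ d, (∃ i, d = f i) ∨ (∃ c ∈ P, ColourLE B c (colour V d)) ∨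
        ∃ c ∈ S, ColourLE B c (colour V d)) ∧
      {d | ¬ ∃ c ∈ S, ColourLE B c (colour V d)}.Finite ∧
      ∀ c ∈ S, {d | ColourLE B c (colour V d)}.Infinite := by
  have key : ∀ (g' : ℕ → D) (f : Fin r → D), (∀ i : Fin r, g' i = f i) →
      ((basicFormBody B cs P S).Realize V g' ↔
      Injective f ∧
      (∀ i, ColourLE B (cs i) (colour V (f i))) ∧
      (∀ d, (∃ i, d = f i) ∨ (∃ c ∈ P, ColourLE B c (colour V d)) ∨
        ∃ c ∈ S, ColourLE B c (colour V d)) ∧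
      {d | ¬ ∃ c ∈ S, ColourLE B c (colour V d)}.Finite ∧
      ∀ c ∈ S, {d | ColourLE B c (colour V d)}.Infinite) := by
    intro g' f hf
    have hne : ∀ (i : Fin r) (d : D), update g' r d i = f i := fun i d => by
      rw [update_of_ne i.2.ne, hf]
    have hinj : (∀ i j : Fin r, (if i = j then top else ne (A := A) (i : ℕ) (j : ℕ)).Realize V g') ↔
        Injective f := by
      refine forall_congr' fun i => forall_congr' fun j => ?_
      split_ifs with h
      · simp [Realize, h]
      · simp [Realize, hf, h]
    simp only [basicFormBody, Realize, W, realize_bigAnd, realize_bigOr, List.mem_map, List.mem_flatMap,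
      List.mem_finRange, true_and, forall_exists_index, forall_apply_eq_imp_iff,
      realize_colourForm, exists_exists_eq_and, Finset.mem_toList, and_imp,
      forall_apply_eq_imp_iff₂, update_self, hne, hf, exists_exists_and_eq_and,
      or_assoc]
    have hinj' : (∀ (a : Formula A) (x x_1 : Fin r),
        (if x = x_1 then top else ne (x : ℕ) (x_1 : ℕ)) = a → a.Realize V g') ↔ Injective f := by
      rw [← hinj]
      exact ⟨fun h i j => h _ i j rfl, fun h a i j e => e ▸ h i j⟩
    rw [hinj']
    tauto
  rw [basicForm, realize_exs]
  constructor
  · rintro ⟨g', -, h⟩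
    exact ⟨fun i => g' i, (key g' _ fun _ => rfl).1 h⟩
  · rintro ⟨f, hf⟩
    refine ⟨fun y => if h : y < r then f ⟨y, h⟩ else g y, fun y hy => dif_neg hy.not_gt, ?_⟩
    exact (key _ f fun i => dif_pos i.2).2 hf

/-- The colours in `S` occur in the second argument of `W` and under `exInf`, so they must be free
of `B`. Those in `P` occur only in the first argument of `W`, where atoms from `B` are allowed. -/
theorem basicForm_mem {r : ℕ} (cs : Fin r → Set A) (P : Finset (Set A)) {S : Finset (Set A)}
    (hS : ∀ c ∈ S, Disjoint c B) : basicForm B cs P S ∈ ContSentences MLogic.FOEinf B := by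
  refine ⟨synContinuous_exs (.and (.and (synContinuous_bigAnd ?_) (.free _ trivial ?_))
    (.and (.w r rfl (.or (.free _ trivial ?_) (synContinuous_bigOr ?_))
      (avoids_bigOr_colourForm B hS r)) (.free _ trivial ?_))), freeVars_exs ?_⟩
  · simp only [List.mem_map, forall_exists_index, and_imp]
    rintro _ i - rfl
    exact synContinuous_colourForm B _ _ _
  · refine avoids_bigAnd ?_
    simp only [List.mem_flatMap, List.mem_map, forall_exists_index, and_imp]
    rintro _ i - j - rfl
    split_ifs <;> trivial
  · refine avoids_bigOr ?_
    simp only [List.mem_map, forall_exists_index, and_imp]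
    rintro _ i - rfl
    trivial
  · simp only [List.mem_map, forall_exists_index, and_imp]
    rintro _ c - rfl
    exact synContinuous_colourForm B _ _ _
  · refine avoids_bigAnd ?_
    simp only [List.mem_map, Finset.mem_toList, forall_exists_index, and_imp]
    rintro _ c hc rfl
    exact avoids_colourForm B (hS c hc) r
  · have hr : ∀ {φ : Formula A}, φ.freeVars ⊆ {r} → φ.freeVars.erase r ⊆ Finset.range r := by
      intro φ h y hy
      rw [Finset.mem_erase] at hy
      exact absurd (Finset.mem_singleton.1 (h hy.2)) hy.1
    refine Finset.union_subset (Finset.union_subset (freeVars_bigAnd ?_) (freeVars_bigAnd ?_))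
      (Finset.union_subset (Finset.union_subset ?_ (hr (freeVars_bigOr_colourForm B S r)))
        (freeVars_bigAnd ?_))
    · simp only [List.mem_map, forall_exists_index, and_imp]
      rintro _ i - rfl
      exact (freeVars_colourForm B _ _).trans (by simp)
    · simp only [List.mem_flatMap, List.mem_map, forall_exists_index, and_imp]
      rintro _ i - j - rfl
      split_ifs
      · simp [freeVars]
      · simp [freeVars, Finset.insert_subset_iff]
    · intro y hy
      simp only [freeVars, Finset.mem_erase, Finset.mem_union] at hy
      rcases hy with ⟨hyr, (hy | hy) | hy⟩
      · have : (bigOr ((List.finRange r).map fun i : Fin r => eq (A := A) r (i : ℕ))).freeVars ⊆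
            Finset.range (r + 1) := by
          refine freeVars_bigOr ?_
          simp only [List.mem_map, forall_exists_index, and_imp]
          rintro _ i - rfl
          simp only [freeVars, Finset.insert_subset_iff, Finset.singleton_subset_iff,
            Finset.mem_range]
          omega
        have := Finset.mem_range.1 (this hy)
        exact Finset.mem_range.2 (by omega)
      · exact absurd (Finset.mem_singleton.1 (freeVars_bigOr_colourForm B P r hy)) hyr
      · exact absurd (Finset.mem_singleton.1 (freeVars_bigOr_colourForm B S r hy)) hyr
    · simp only [List.mem_map, forall_exists_index, and_imp]
      rintro _ c - rfl
      exact hr (freeVars_colourForm B c r)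

end Colour

end Formula

end MonadicFO

/-! ### Continuous sentences as disjunctions of basic forms. -/

namespace MonadicFO

open Function Formula

variable {A : Type v} {D : Type*} {D' : Type*}

/-- Without equality the back-and-forth argument has to match only the colour of the chosen element,
not its freshness. -/
theorem realize_iff_of_isM {φ : Formula A} (hφ : φ.IsM) {V : A → Set D} {V' : A → Set D'}
    (h : Set.range (colour V) = Set.range (colour V')) {g : ℕ → D} {g' : ℕ → D'}
    (hg : ∀ y, colour V (g y) = colour V' (g' y)) : φ.Realize V g ↔ φ.Realize V' g' := by
  have hto : ∀ d, ∃ d', colour V d = colour V' d' := fun d => by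
    obtain ⟨d', hd'⟩ : colour V d ∈ Set.range (colour V') := h ▸ ⟨d, rfl⟩
    exact ⟨d', hd'.symm⟩
  have hfrom : ∀ d', ∃ d, colour V d = colour V' d' := fun d' => by
    obtain ⟨d, hd⟩ : colour V' d' ∈ Set.range (colour V) := h ▸ ⟨d', rfl⟩
    exact ⟨d, hd⟩
  have hupd : ∀ {g : ℕ → D} {g' : ℕ → D'}, (∀ y, colour V (g y) = colour V' (g' y)) →
      ∀ x {d d'}, colour V d = colour V' d' →
      ∀ y, colour V (update g x d y) = colour V' (update g' x d' y) := by
    intro g g' hg x d d' hd y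
    rcases eq_or_ne y x with rfl | hne
    · simpa using hd
    · simpa [hne] using hg y
  induction φ generalizing g g' with
  | top | bot => rfl
  | pos a x => exact Set.ext_iff.1 (hg x) a
  | neg a x => exact not_congr (Set.ext_iff.1 (hg x) a)
  | eq x y | ne x y | exInf x φ | allInf x φ => exact hφ.elim
  | or φ ψ h₁ h₂ | and φ ψ h₁ h₂ => simp only [Realize, h₁ hφ.1 hg, h₂ hφ.2 hg]
  | ex x φ ih =>
    constructor
    · rintro ⟨d, hd⟩
      obtain ⟨d', hd'⟩ := hto d
      exact ⟨d', (ih hφ (hupd hg x hd')).1 hd⟩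
    · rintro ⟨d', hd⟩
      obtain ⟨d, hd'⟩ := hfrom d'
      exact ⟨d, (ih hφ (hupd hg x hd')).2 hd⟩
  | all x φ ih =>
    constructor
    · intro hall d'
      obtain ⟨d, hd'⟩ := hfrom d'
      exact (ih hφ (hupd hg x hd')).1 (hall d)
    · intro hall d
      obtain ⟨d', hd'⟩ := hto d
      exact (ih hφ (hupd hg x hd')).2 (hall d')

theorem realize_sentence_iff_of_isM {φ : Formula A} (hφ : φ.IsM) (hs : φ.IsSentence)
    {V : A → Set D} {V' : A → Set D'} (h : Set.range (colour V) = Set.range (colour V'))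
    (g : ℕ → D) (g' : ℕ → D') : φ.Realize V g ↔ φ.Realize V' g' := by
  obtain ⟨d', hd'⟩ : colour V (g 0) ∈ Set.range (colour V') := h ▸ ⟨g 0, rfl⟩
  rw [hs.realize_iff g fun _ => g 0, hs.realize_iff g' fun _ => d']
  exact realize_iff_of_isM hφ h fun _ => hd'.symm

/-- The valuation in which `lab d` is the set of predicates of `d`. -/
theorem colour_labVal (lab : D → Set A) : colour (labVal id lab) = lab := rfl

/-- A property of models that is a union of properties from a finite set of syntactically
continuous sentences is defined by such a sentence. -/
theorem exists_contSentence_of_finite {L : MLogic} {B : Set A} {φ : Formula A} {T : Set (Formula A)}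
    (hT : T.Finite)
    (h : ∀ (D : Type u) (V : A → Set D) (g : ℕ → D), φ.Realize V g →
      ∃ χ ∈ T, χ ∈ ContSentences L B ∧ χ.Realize V g ∧
        ∀ (D' : Type u) (V' : A → Set D') (g' : ℕ → D'), χ.Realize V' g' → φ.Realize V' g') :
    ∃ χ ∈ ContSentences L B, ∀ (D : Type u) (V : A → Set D) (g : ℕ → D),
      φ.Realize V g ↔ χ.Realize V g := by
  classical
  let l := (hT.toFinset.filter fun χ => χ ∈ ContSentences L B ∧
    ∀ (D' : Type u) (V' : A → Set D') (g' : ℕ → D'), χ.Realize V' g' → φ.Realize V' g').toList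
  have hl : ∀ χ, χ ∈ l ↔ χ ∈ T ∧ χ ∈ ContSentences L B ∧
      ∀ (D' : Type u) (V' : A → Set D') (g' : ℕ → D'), χ.Realize V' g' → φ.Realize V' g' := by
    simp [l]
  refine ⟨bigOr l, ⟨synContinuous_bigOr fun χ hχ => ((hl χ).1 hχ).2.1.1, ?_⟩,
    fun D V g => ⟨fun hφ => ?_, fun hχ => ?_⟩⟩
  · exact Finset.subset_empty.1 (freeVars_bigOr fun χ hχ =>
      (show χ.freeVars = ∅ from ((hl χ).1 hχ).2.1.2).subset)
  · obtain ⟨χ, hχ, hc, hr, himp⟩ := h D V g hφ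
    exact realize_bigOr.2 ⟨χ, (hl χ).2 ⟨hχ, hc, himp⟩, hr⟩
  · obtain ⟨χ, hχ, hr⟩ := realize_bigOr.1 hχ
    exact ((hl χ).1 hχ).2.2 D V g hr

section BasicForms

variable [Finite A] {B : Set A}

/-- Passing to `D × ℕ` does not change which colours occur, hence not the truth of `φ`. Every
element then has a copy outside the finite set `F`, so the restricted model contains the `B`-free
part of each original colour. The colours of the restricted model form `T`, the `B`-free ones among
them `E`. -/
theorem ContinuousIn.exists_basicFormM {φ : Formula A} (hM : φ.IsM) (hs : φ.IsSentence)
    (hφ : ContinuousIn.{u} B φ) {D : Type u} {V : A → Set D} {g : ℕ → D}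
    (h : φ.Realize V g) : ∃ T E : Finset (Set A), (∀ c ∈ E, Disjoint c B) ∧
      (basicFormM B T E).Realize V g ∧
      ∀ (D' : Type u) (V' : A → Set D') (g' : ℕ → D'),
        (basicFormM B T E).Realize V' g' → φ.Realize V' g' := by
  classical
  have hprod : ∀ {D : Type u} (V : A → Set D),
      Set.range (colour V) = Set.range (colour fun a => {p : D × ℕ | p.1 ∈ V a}) := by
    intro D V
    ext c
    constructor
    · rintro ⟨d, rfl⟩
      exact ⟨(d, 0), rfl⟩
    · rintro ⟨p, rfl⟩
      exact ⟨p.1, rfl⟩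
  let V₁ : A → Set (D × ℕ) := fun a => {p | p.1 ∈ V a}
  have h₁ : φ.Realize V₁ fun y => (g y, 0) :=
    (realize_sentence_iff_of_isM hM hs (hprod V) _ _).1 h
  obtain ⟨F, hF, hU⟩ := hφ.exists_restrictVal h₁
  let U := restrictVal B F V₁
  have hle : ∀ p, ColourLE B (colour U p) (colour V p.1) :=
    valLE_iff.1 (restrictVal_valLE B F V₁)
  have hbase : ∀ d, colour V d \ B ∈ Set.range (colour U) := by
    intro d
    obtain ⟨n, hn⟩ : ∃ n, (d, n) ∉ F := by
      by_contra! hcon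
      have : (Set.range fun n : ℕ => (d, n)).Infinite :=
        Set.infinite_range_of_injective fun m n h => (Prod.mk.inj h).2
      refine this (hF.subset ?_)
      rintro _ ⟨n, rfl⟩
      exact hcon n
    refine ⟨(d, n), ?_⟩
    ext a
    simp [U, V₁, colour, restrictVal, hn]
  refine ⟨(Set.range (colour U)).toFinite.toFinset,
    (Set.range (colour U) ∩ {c | Disjoint c B}).toFinite.toFinset, ?_, ?_, ?_⟩
  · intro c hc
    exact ((Set.Finite.mem_toFinset _).1 hc).2
  · rw [realize_basicFormM]
    simp only [Set.Finite.mem_toFinset]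
    refine ⟨?_, fun d => ⟨colour V d \ B, ⟨hbase d, Set.disjoint_sdiff_left⟩,
      colourLE_diff B _⟩⟩
    rintro _ ⟨p, rfl⟩
    exact ⟨p.1, hle p⟩
  · intro D' V' g' h'
    rw [realize_basicFormM] at h'
    simp only [Set.Finite.mem_toFinset] at h'
    obtain ⟨hT, hE⟩ := h'
    have : Nonempty D' := ⟨g' 0⟩
    choose! w hw using hT
    choose e he hle' using hE
    -- The map `w` may choose one witness for several colours; copies with different second
    -- coordinate `ι c` separate them. All other copies receive the `B`-free colour `e`.
    obtain ⟨ι⟩ : Nonempty (Set A ↪ ℕ) := by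
      obtain ⟨n, ⟨f⟩⟩ := Finite.exists_equiv_fin (Set A)
      exact ⟨f.toEmbedding.trans Fin.valEmbedding⟩
    let lab : D' × ℕ → Set A := fun p =>
      if ∃ c ∈ Set.range (colour U), p = (w c, ι c) then {a | ∃ c ∈ Set.range (colour U),
        p = (w c, ι c) ∧ a ∈ c} else e p.1
    have hlab : ∀ c ∈ Set.range (colour U), lab (w c, ι c) = c := by
      intro c hc
      simp only [lab]
      rw [if_pos ⟨c, hc, rfl⟩]
      ext a
      constructor
      · rintro ⟨c', -, h, ha⟩
        rwa [ι.injective (Prod.mk.inj h).2]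
      · exact fun ha => ⟨c, hc, rfl, ha⟩
    have hlab' : ∀ p, (∃ c ∈ Set.range (colour U), p = (w c, ι c)) ∨ lab p = e p.1 := by
      intro p
      by_cases hp : ∃ c ∈ Set.range (colour U), p = (w c, ι c)
      · exact Or.inl hp
      · exact Or.inr (if_neg hp)
    have hrange : Set.range (colour U) = Set.range (colour (labVal id lab)) := by
      rw [colour_labVal]
      ext c
      constructor
      · exact fun hc => ⟨_, hlab c hc⟩
      · rintro ⟨p, rfl⟩
        rcases hlab' p with ⟨c, hc, rfl⟩ | hp
        · rwa [hlab c hc]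
        · rw [hp]
          exact (he p.1).1
    have hr := (realize_sentence_iff_of_isM hM hs hrange _ fun y => (g' y, 0)).1 hU
    refine (realize_sentence_iff_of_isM hM hs (hprod V') _ _).2 (hφ.1 _ _ _ _ hr ?_)
    rw [valLE_iff]
    intro p
    rw [colour_labVal]
    rcases hlab' p with ⟨c, hc, rfl⟩ | hp
    · rw [hlab c hc]
      exact hw c hc
    · rw [hp]
      exact hle' p.1

/-- The named elements copy the colours of the finite sample `F`, which contains all elements of
colours outside `P` and at least `K` of each colour in `P`. This settles all counts up to `K`; the
unnamed elements settle which colours are infinite. -/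
theorem exists_labelling_of_basicForm {lab : D → Set A} {K : ℕ} {F : Finset D}
    {P S : Finset (Set A)} (hP : ∀ c, c ∈ P ↔ (K : ℕ∞) ≤ (lab ⁻¹' {c}).encard)
    (hS : ∀ c, c ∈ S ↔ (lab ⁻¹' {c}).Infinite) (hSB : ∀ c ∈ S, Disjoint c B)
    (hF : ∀ c, c ∉ P → lab ⁻¹' {c} ⊆ F)
    (hF' : ∀ c ∈ P, (K : ℕ∞) ≤ (lab ⁻¹' {c} ∩ F).encard) {r : ℕ} (e : Fin r ≃ F)
    {V' : A → Set D'} {g' : ℕ → D'}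
    (h : (basicForm B (fun i => lab (e i)) P S).Realize V' g') :
    ∃ lab' : D' → Set A, (∀ d, ColourLE B (lab' d) (colour V' d)) ∧ SameCount K lab lab' ∧
      ∀ c, (lab ⁻¹' {c}).Infinite ↔ (lab' ⁻¹' {c}).Infinite := by
  classical
  obtain ⟨f, hf, hcol, hall, hfin, hinf⟩ := (realize_basicForm B).1 h
  -- An unnamed element receives a colour from `S` if possible, and otherwise one from `P`. The
  -- value `∅` at named elements is never used.
  have hfresh : ∀ d, ∃ c, d ∉ Set.range f → ColourLE B c (colour V' d) ∧
      ((∃ c' ∈ S, ColourLE B c' (colour V' d)) → c ∈ S) ∧ (c ∈ P ∨ c ∈ S) := by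
    intro d
    by_cases hd : ∃ c' ∈ S, ColourLE B c' (colour V' d)
    · obtain ⟨c, hc, hle⟩ := hd
      exact ⟨c, fun _ => ⟨hle, fun _ => hc, Or.inr hc⟩⟩
    · rcases hall d with ⟨i, rfl⟩ | ⟨c, hc, hle⟩ | h
      · exact ⟨∅, fun h => absurd ⟨i, rfl⟩ h⟩
      · exact ⟨c, fun _ => ⟨hle, fun h => absurd h hd, Or.inl hc⟩⟩
      · exact absurd h hd
  choose q hq using hfresh
  let lab' : D' → Set A := fun d => if h : d ∈ Set.range f then lab (e h.choose) else q d
  have hlabf : ∀ i, lab' (f i) = lab (e i) := by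
    intro i
    have hi : f i ∈ Set.range f := ⟨i, rfl⟩
    simp only [lab', dif_pos hi]
    rw [hf hi.choose_spec]
  have hlabq : ∀ d, d ∉ Set.range f → lab' d = q d := fun d hd => dif_neg hd
  have hSP : ∀ c ∈ S, c ∈ P := fun c hc => by
    rw [hP, ((hS c).1 hc).encard_eq]
    exact le_top
  have hle : ∀ d, ColourLE B (lab' d) (colour V' d) := by
    intro d
    by_cases hd : d ∈ Set.range f
    · obtain ⟨i, rfl⟩ := hd
      rw [hlabf]
      exact hcol i
    · rw [hlabq d hd]
      exact (hq d hd).1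
  have himage : ∀ c, lab ⁻¹' {c} ∩ F = (fun i => (e i : D)) '' {i | lab (e i) = c} := by
    intro c
    ext d
    constructor
    · rintro ⟨hd, hdF⟩
      exact ⟨e.symm ⟨d, hdF⟩, by simpa using hd, by simp⟩
    · rintro ⟨i, hi, rfl⟩
      exact ⟨hi, (e i).2⟩
  have hcard : ∀ c, (lab ⁻¹' {c} ∩ F).encard = (f '' {i | lab (e i) = c}).encard := by
    intro c
    rw [himage, hf.encard_image]
    exact (Subtype.val_injective.comp e.injective).encard_image _
  have hsub : ∀ c, f '' {i | lab (e i) = c} ⊆ lab' ⁻¹' {c} := by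
    rintro c _ ⟨i, hi, rfl⟩
    exact (hlabf i).trans hi
  refine ⟨lab', hle, fun c n hn => ?_, fun c => ?_⟩
  · by_cases hc : c ∈ P
    · have hn' : (n : ℕ∞) ≤ K := by exact_mod_cast hn
      refine iff_of_true (hn'.trans ((hP c).1 hc)) (hn'.trans ((hF' c hc).trans ?_))
      rw [hcard]
      exact Set.encard_le_encard (hsub c)
    -- A colour outside `P` is carried by named elements only, and its whole class in `D` lies in
    -- `F`; so the counts agree exactly.
    · have : lab' ⁻¹' {c} = f '' {i | lab (e i) = c} := by
        refine (hsub c).antisymm' fun d hd => ?_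
        by_cases hdf : d ∈ Set.range f
        · obtain ⟨i, rfl⟩ := hdf
          exact ⟨i, (hlabf i).symm.trans hd, rfl⟩
        · exfalso
          have hqd : q d = c := (hlabq d hdf).symm.trans hd
          rcases hqd ▸ (hq d hdf).2.2 with h | h
          · exact hc h
          · exact hc (hSP c h)
      rw [this, ← hcard, Set.inter_eq_left.2 (hF c hc)]
  · rw [← hS]
    constructor
    · intro hc
      refine ((hinf c hc).sdiff (Set.finite_range f)).mono ?_
      rintro d ⟨hd, hdf⟩
      rw [Set.mem_preimage, hlabq d hdf, Set.mem_singleton_iff]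
      obtain ⟨h₁, h₂, -⟩ := hq d hdf
      -- Both `q d` and `c` are `B`-free and below the colour of `d`, hence equal.
      rw [h₁.eq_diff (hSB _ (h₂ ⟨c, hc, hd⟩)), ColourLE.eq_diff hd (hSB c hc)]
    · intro hc
      by_contra hcS
      -- A colour outside `S` is used only for named elements and for the finitely many elements
      -- without a lower bound in `S`.
      refine hc (((Set.finite_range f).union hfin).subset fun d hd => ?_)
      by_cases hdf : d ∈ Set.range f
      · exact Or.inl hdf
      · refine Or.inr fun h => hcS ?_
        rw [← (hlabq d hdf).symm.trans hd]
        exact (hq d hdf).2.1 h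

/-- The form is read off from a finite restriction in which `φ` holds. The bound on `r` does not
depend on the model, so finitely many forms suffice for `φ`. -/
theorem ContinuousIn.exists_basicForm {K : ℕ} (hK : 0 < K) {φ : Formula A} (hv : φ.VarsLT K)
    (hs : φ.IsSentence) (hφ : ContinuousIn.{u} B φ) {D : Type u} {V : A → Set D} {g : ℕ → D}
    (h : φ.Realize V g) :
    ∃ r ≤ Nat.card (Set A) * K, ∃ (cs : Fin r → Set A) (P S : Finset (Set A)),
      (∀ c ∈ S, Disjoint c B) ∧ (basicForm B cs P S).Realize V g ∧
      ∀ (D' : Type u) (V' : A → Set D') (g' : ℕ → D'),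
        (basicForm B cs P S).Realize V' g' → φ.Realize V' g' := by
  classical
  obtain ⟨F₀, hF₀, hU⟩ := hφ.exists_restrictVal h
  let U := restrictVal B F₀ V
  let lab := colour U
  have hle : ∀ d, ColourLE B (lab d) (colour V d) := valLE_iff.1 (restrictVal_valLE B F₀ V)
  -- The sample `G c` is the whole class of `c` if that has fewer than `K` elements, and `K` of its
  -- elements otherwise.
  have hsel : ∀ c, ∃ G : Finset D, (G : Set D) ⊆ lab ⁻¹' {c} ∧ G.card ≤ K ∧
      ((K : ℕ∞) ≤ (lab ⁻¹' {c}).encard → G.card = K) ∧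
      (¬ (K : ℕ∞) ≤ (lab ⁻¹' {c}).encard → lab ⁻¹' {c} ⊆ G) := by
    intro c
    by_cases hc : (K : ℕ∞) ≤ (lab ⁻¹' {c}).encard
    · obtain ⟨t, ht, htc⟩ := Set.exists_subset_encard_eq hc
      have hfin : t.Finite := Set.finite_of_encard_eq_coe htc
      have hcard : hfin.toFinset.card = K := by
        have := hfin.encard_eq_coe_toFinset_card
        rw [htc] at this
        exact_mod_cast this.symm
      exact ⟨hfin.toFinset, by simpa using ht, hcard.le, fun _ => hcard, fun h => absurd hc h⟩
    · have hfin : (lab ⁻¹' {c}).Finite := by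
        refine Set.encard_ne_top_iff.1 fun htop => hc ?_
        rw [htop]
        exact le_top
      refine ⟨hfin.toFinset, by simp, ?_, fun h => absurd h hc, fun _ => by simp⟩
      have := (not_le.1 hc).le
      rw [hfin.encard_eq_coe_toFinset_card] at this
      exact_mod_cast this
  choose G hG hGK hG₁ hG₂ using hsel
  have : Fintype (Set A) := Fintype.ofFinite _
  let F : Finset D := Finset.univ.biUnion G
  have hFcard : F.card ≤ Nat.card (Set A) * K := by
    rw [Nat.card_eq_fintype_card]
    exact Finset.card_biUnion_le_card_mul _ _ _ fun c _ => hGK c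
  have hGF : ∀ c, G c ⊆ F := fun c => Finset.subset_biUnion_of_mem G (Finset.mem_univ c)
  let P : Finset (Set A) := Finset.univ.filter fun c => (K : ℕ∞) ≤ (lab ⁻¹' {c}).encard
  let S : Finset (Set A) := Finset.univ.filter fun c => (lab ⁻¹' {c}).Infinite
  have hP : ∀ c, c ∈ P ↔ (K : ℕ∞) ≤ (lab ⁻¹' {c}).encard := fun c => by simp [P]
  have hS : ∀ c, c ∈ S ↔ (lab ⁻¹' {c}).Infinite := fun c => by simp [S]
  -- In the restricted model only elements of the finite set `F₀` have a predicate in `B`.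
  have hSB : ∀ c ∈ S, Disjoint c B := by
    intro c hc
    rw [Set.disjoint_left]
    intro a ha haB
    refine (hS c).1 hc (hF₀.subset ?_)
    rintro d rfl
    exact ha.2 haB
  have hdown : ∀ d, lab d ∉ P → d ∈ F := by
    intro d hd
    rw [hP] at hd
    exact hGF _ (hG₂ _ hd rfl)
  refine ⟨F.card, hFcard, fun i => lab (F.equivFin.symm i), P, S, hSB, ?_, ?_⟩
  · rw [realize_basicForm]
    have hSd : ∀ d, lab d ∈ S → ∃ c ∈ S, ColourLE B c (colour V d) :=
      fun d hd => ⟨_, hd, hle d⟩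
    refine ⟨fun i => F.equivFin.symm i,
      Subtype.val_injective.comp F.equivFin.symm.injective, fun i => hle _, fun d => ?_, ?_, ?_⟩
    · by_cases hd : lab d ∈ P
      · exact Or.inr (Or.inl ⟨_, hd, hle d⟩)
      · exact Or.inl ⟨F.equivFin ⟨d, hdown d hd⟩, by simp⟩
    · have : (⋃ c ∈ {c | c ∉ S}, lab ⁻¹' {c}).Finite :=
        (Set.toFinite _).biUnion fun c hc => Set.not_infinite.1 fun hinf => hc ((hS c).2 hinf)
      refine this.subset fun d hd => ?_
      exact Set.mem_biUnion (x := lab d) (fun hS' => hd (hSd d hS')) rfl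
    · intro c hc
      refine ((hS c).1 hc).mono ?_
      rintro d rfl
      exact hle d
  · intro D' V' g' h'
    obtain ⟨lab', hle', hcount, hinf⟩ := exists_labelling_of_basicForm hP hS hSB
      (F := F) (fun c hc d hd => hdown d (by rwa [show lab d = c from hd]))
      (fun c hc => by
        have hsub : (G c : Set D) ⊆ lab ⁻¹' {c} ∩ F := Set.subset_inter (hG c) (hGF c)
        have := Set.encard_le_encard hsub
        rwa [Set.encard_coe_eq_coe_finsetCard, hG₁ c ((hP c).1 hc)] at this)
      F.equivFin.symm h'
    have hr : φ.Realize (labVal id lab') g' :=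
      (realize_iff_of_sameCount id hcount hinf hK hs hv g g').1 hU
    exact hφ.1 _ _ _ _ hr (valLE_iff.2 hle')

theorem ContinuousIn.exists_contSentence {L : MLogic} {φ : Formula A}
    (hL : φ ∈ Sentences L A) (hφ : ContinuousIn.{u} B φ) :
    ∃ χ ∈ ContSentences L B, ∀ (D : Type u) (V : A → Set D) (g : ℕ → D),
      φ.Realize V g ↔ χ.Realize V g := by
  obtain ⟨hL, hs⟩ := hL
  cases L with
  | M =>
    refine exists_contSentence_of_finite
      (T := Set.range fun p : Finset (Set A) × Finset (Set A) => basicFormM B p.1 p.2)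
      (Set.finite_range _) fun D V g h => ?_
    obtain ⟨T, E, hE, hr, himp⟩ := hφ.exists_basicFormM hL hs h
    exact ⟨_, ⟨(T, E), rfl⟩, basicFormM_mem B hE, hr, himp⟩
  | FOEinf =>
    obtain ⟨K, hK⟩ := φ.exists_varsLT
    -- The bound is `K + 1` because the game needs at least one pebble.
    refine exists_contSentence_of_finite
      (T := ⋃ r ∈ Set.Iic (Nat.card (Set A) * (K + 1)),
        Set.range fun p : (Fin r → Set A) × Finset (Set A) × Finset (Set A) =>
          basicForm B p.1 p.2.1 p.2.2)
      ((Set.finite_Iic _).biUnion fun r _ => Set.finite_range _) fun D V g h => ?_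
    obtain ⟨r, hr, cs, P, S, hS, hreal, himp⟩ :=
      hφ.exists_basicForm K.succ_pos (hK.mono K.le_succ) hs h
    exact ⟨_, Set.mem_biUnion (x := r) hr ⟨(cs, P, S), rfl⟩, basicForm_mem B cs P hS, hreal, himp⟩

/-- `Realize` says nothing about the empty model. Its truth value is adjusted by a disjunct `∀x.⊥`
or a conjunct `∃x.⊤`, which have no effect on nonempty models. -/
theorem ContinuousIn.exists_equivalent {L : MLogic} {φ : Formula A}
    (hL : φ ∈ Sentences L A) (hφ : ContinuousIn.{u} B φ) :
    ∃ χ ∈ ContSentences L B, Equivalent.{u} φ χ := by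
  obtain ⟨χ, hχ, h⟩ := hφ.exists_contSentence hL
  by_cases hE : φ.TrueOnEmpty
  · have hχ' : or χ (all 0 bot) ∈ ContSentences L B :=
      ⟨.or hχ.1 (.free _ (IsM.inLogic (φ := all 0 bot) trivial L) trivial), by
        simp [IsSentence, freeVars, show χ.freeVars = ∅ from hχ.2]⟩
    refine ⟨_, hχ', (equivalent_iff hL.2 hχ'.2).2 ⟨by simp [hE, TrueOnEmpty], fun D V g => ?_⟩⟩
    have : Nonempty D := ⟨g 0⟩
    simp [Realize, h]
  · have hχ' : and χ (ex 0 top) ∈ ContSentences L B :=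
      ⟨.and hχ.1 (.free _ (IsM.inLogic (φ := ex 0 top) trivial L) trivial), by
        simp [IsSentence, freeVars, show χ.freeVars = ∅ from hχ.2]⟩
    refine ⟨_, hχ', (equivalent_iff hL.2 hχ'.2).2 ⟨by simp [hE, TrueOnEmpty], fun D V g => ?_⟩⟩
    have : Nonempty D := ⟨g 0⟩
    simp [Realize, h]

/-- The semantic characterization of the continuous fragments. -/
theorem continuousIn_iff_exists_equivalent {L : MLogic} {φ : Formula A}
    (hL : φ ∈ Sentences L A) :
    ContinuousIn.{u} B φ ↔ ∃ χ ∈ ContSentences L B, Equivalent.{u} φ χ := by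
  refine ⟨fun h => h.exists_equivalent hL, ?_⟩
  rintro ⟨χ, hχ, he⟩
  exact hχ.1.continuousIn.congr fun D V g => (he.realize_iff hL.2 hχ.2 D V g).symm

end BasicForms

end MonadicFO

/-! ### Counting functions as finite descriptions of models. -/

namespace MonadicFO

open Function Formula

variable {A : Type v} {X : Type*} {D : Type*}

section Count

variable {K : ℕ} {I : Set X} {w : X → ℕ}

/-- The labels in `I`, of which there are supposed to be infinitely many elements, are counted as
`K` if they occur at all. -/
def IsCount (K : ℕ) (I : Set X) (w : X → ℕ) : Prop :=
  ∀ c, w c ≤ K ∧ (c ∈ I → w c = 0 ∨ w c = K)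

/-- Truth in the finite labelled structure in which the label `c` occurs `w c` times. -/
def CountTrue (π : X → Set A) (I : Set X) (K : ℕ) (w : X → ℕ) (φ : Formula A) : Prop :=
  ∃ d : Σ c, Fin (w c), FreshRealize π I K Sigma.fst φ fun _ => d

theorem encard_sigma_fst (w : X → ℕ) (c : X) :
    ((Sigma.fst : (Σ c, Fin (w c)) → X) ⁻¹' {c}).encard = w c := by
  have : (Sigma.fst : (Σ c, Fin (w c)) → X) ⁻¹' {c} = Set.range (Sigma.mk c) := by
    rw [Set.range_sigmaMk]
  rw [this, ← Set.image_univ, sigma_mk_injective.encard_image, Set.encard_univ, ENat.card_eq_coe_fintype_card,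
    Fintype.card_fin]

/-- A finite structure can replace an infinite model because `FreshRealize` refers to infinity only
through the set `I` of labels. -/
theorem countTrue_iff [Finite X] (π : X → Set A) (hK : 0 < K) {lab : D → X}
    (hI : ∀ d, lab d ∈ I ↔ (lab ⁻¹' {lab d}).Infinite)
    (hc : SameCount K lab (Sigma.fst : (Σ c, Fin (w c)) → X)) {φ : Formula A}
    (hs : φ.IsSentence) (hφ : φ.VarsLT K) (g : ℕ → D) :
    CountTrue π I K w φ ↔ φ.Realize (labVal π lab) g := by
  rw [CountTrue, ← exists_const_freshRealize_iff π I hc hK hφ]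
  simp only [freshRealize_iff_realize π hI hφ]
  exact ⟨fun ⟨d, hd⟩ => (hs.realize_iff _ _).1 hd, fun h => ⟨g 0, (hs.realize_iff _ _).1 h⟩⟩

/-- The function `w` gives the multiplicities truncated at `K`; a label in `I` that occurs is
infinite and so receives `K`. -/
theorem exists_isCount {lab : D → X} (K : ℕ)
    (hI : ∀ d, lab d ∈ I ↔ (lab ⁻¹' {lab d}).Infinite) :
    ∃ w, IsCount K I w ∧ SameCount K lab (Sigma.fst : (Σ c, Fin (w c)) → X) ∧
      (∀ c, 0 < w c → ∃ d, lab d = c) ∧ ∀ c, (K : ℕ∞) ≤ (lab ⁻¹' {c}).encard → w c = K := by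
  have hex : ∀ c, ∃ n : ℕ, (n : ℕ∞) = min (K : ℕ∞) (lab ⁻¹' {c}).encard := fun c =>
    ENat.ne_top_iff_exists.1 (ne_top_of_le_ne_top (ENat.natCast_ne_top K) (min_le_left _ _))
  choose w hw using hex
  have hK : ∀ c, (K : ℕ∞) ≤ (lab ⁻¹' {c}).encard → w c = K := fun c hc => by
    have := hw c
    rw [min_eq_left hc] at this
    exact_mod_cast this
  have hpos : ∀ c, 0 < w c → ∃ d, lab d = c := by
    intro c hc
    by_contra! hcon
    have hempty : lab ⁻¹' {c} = ∅ := Set.eq_empty_of_forall_notMem fun d hd => hcon d hd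
    have := hw c
    rw [hempty, Set.encard_empty, min_eq_right zero_le] at this
    exact hc.ne' (by exact_mod_cast this)
  refine ⟨w, fun c => ⟨?_, fun hc => ?_⟩, fun c n hn => ?_, hpos, hK⟩
  · have := (hw c).le.trans (min_le_left _ _)
    exact_mod_cast this
  · rcases Nat.eq_zero_or_pos (w c) with h | h
    · exact Or.inl h
    · obtain ⟨d, rfl⟩ := hpos c h
      refine Or.inr (hK _ ?_)
      rw [((hI d).1 hc).encard_eq]
      exact le_top
  · have : (n : ℕ∞) ≤ K := by exact_mod_cast hn
    rw [encard_sigma_fst, hw, le_min_iff]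
    exact ⟨fun h => ⟨this, h⟩, fun h => h.2⟩

/-- A label in `I` that occurs receives a copy of `ℕ`, any other label exactly `w c` elements.
Indexing by `Fin n` instead of `X` allows the domain to live in the universe `u`. -/
theorem IsCount.exists_model [Finite X] (hw : IsCount K I w) :
    ∃ (D : Type u) (lab : D → X), (∀ d, lab d ∈ I ↔ (lab ⁻¹' {lab d}).Infinite) ∧
      SameCount K lab (Sigma.fst : (Σ c, Fin (w c)) → X) := by
  obtain ⟨n, ⟨e⟩⟩ := Finite.exists_equiv_fin X
  let s : X → Set ℕ := fun c => {k | k < w c ∨ c ∈ I ∧ w c ≠ 0}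
  let lab : ULift.{u} (Σ i : Fin n, s (e.symm i)) → X := fun d => e.symm d.down.1
  have hencard : ∀ c, (lab ⁻¹' {c}).encard = (s c).encard := by
    intro c
    obtain ⟨i, rfl⟩ := e.symm.surjective c
    have : lab ⁻¹' {e.symm i} = Set.range fun k : s (e.symm i) => ULift.up (Sigma.mk i k) := by
      ext ⟨⟨j, k⟩⟩
      constructor
      · intro h
        obtain rfl : j = i := e.symm.injective h
        exact ⟨k, rfl⟩
      · rintro ⟨k', h⟩
        obtain ⟨rfl, -⟩ := Sigma.mk.inj (ULift.up.inj h)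
        rfl
    have hinj : Injective fun k : s (e.symm i) =>
        (ULift.up (Sigma.mk i k) : ULift.{u} (Σ i : Fin n, s (e.symm i))) :=
      fun k k' h => sigma_mk_injective (i := i) (ULift.up.inj h)
    rw [this, ← Set.image_univ, hinj.encard_image, Set.encard_univ]
    rfl
  have hfin : ∀ c, ¬ (c ∈ I ∧ w c ≠ 0) → (s c).encard = w c := by
    intro c hc
    have : s c = (Finset.range (w c) : Set ℕ) := by
      ext k
      simp [s, hc]
    rw [this, Set.encard_coe_eq_coe_finsetCard, Finset.card_range]
  have hinf : ∀ c, c ∈ I ∧ w c ≠ 0 → (s c).encard = ⊤ := by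
    intro c hc
    have : s c = Set.univ := by
      ext k
      simp [s, hc]
    rw [this]
    exact Set.infinite_univ.encard_eq
  refine ⟨_, lab, fun d => ?_, fun c k hk => ?_⟩
  · rw [← Set.encard_eq_top_iff, hencard]
    by_cases hd : lab d ∈ I ∧ w (lab d) ≠ 0
    · exact iff_of_true hd.1 (hinf _ hd)
    · rw [hfin _ hd]
      refine iff_of_false (fun hI => ?_) (ENat.natCast_ne_top _)
      have hs : (d.down.2 : ℕ) ∈ s (lab d) := d.down.2.2
      rcases hs with hs | hs
      · exact hd ⟨hI, by omega⟩
      · exact hd hs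
  · rw [hencard, encard_sigma_fst]
    by_cases hc : c ∈ I ∧ w c ≠ 0
    · rw [hinf c hc]
      refine iff_of_true le_top ?_
      rw [((hw c).2 hc.1).resolve_left hc.2]
      exact_mod_cast hk
    · rw [hfin c hc]

end Count

section Flag

variable {Y : Type*}

open Classical in
/-- The labelling `lab`, together with the information whether there are infinitely many elements
with the same label. -/
noncomputable def flagged (lab : D → Y) (d : D) : Y × Bool :=
  (lab d, decide (lab ⁻¹' {lab d}).Infinite)

/-- The labels of which there are infinitely many elements. -/
def infLabels (Y : Type*) : Set (Y × Bool) := {c | c.2 = true}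

theorem flagged_preimage (lab : D → Y) (d : D) :
    flagged lab ⁻¹' {flagged lab d} = lab ⁻¹' {lab d} := by
  ext d'
  simp only [flagged, Set.mem_preimage, Set.mem_singleton_iff, Prod.mk.injEq]
  exact ⟨fun h => h.1, fun h => ⟨h, by rw [h]⟩⟩

/-- With the flag included in the label, the set of infinite labels is the same for all models. -/
theorem flagged_mem_infLabels (lab : D → Y) (d : D) :
    flagged lab d ∈ infLabels Y ↔ (flagged lab ⁻¹' {flagged lab d}).Infinite := by
  rw [flagged_preimage]
  simp [flagged, infLabels]

end Flag

/-! ### Testing equivalence and continuity on counting functions. -/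

section Criteria

/-- Labels for a pair of valuations. -/
abbrev PairLabel (A : Type v) : Type v := (Set A × Set A) × Bool

/-- The colour in the first valuation. -/
def firstColour (c : PairLabel A) : Set A := c.1.1

/-- The colour in the second valuation. -/
def secondColour (c : PairLabel A) : Set A := c.1.2

variable {B : Set A} {K : ℕ}

/-- `φ` is true in the first model that belongs to the counting function `w`. -/
def FirstTrue (K : ℕ) (w : PairLabel A → ℕ) (φ : Formula A) : Prop :=
  CountTrue firstColour (infLabels _) K w φ

/-- `φ` is true in the second model that belongs to the counting function `w`. -/
def SecondTrue (K : ℕ) (w : PairLabel A → ℕ) (φ : Formula A) : Prop :=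
  CountTrue secondColour (infLabels _) K w φ

variable [Finite A]

theorem exists_count_of_pair (hK : 0 < K) (U V : A → Set D) (g : ℕ → D) :
    ∃ w, IsCount K (infLabels _) w ∧
      (∀ c, 0 < w c → ∃ d, flagged (fun d => (colour U d, colour V d)) d = c) ∧
      (∀ c, (K : ℕ∞) ≤ (flagged (fun d => (colour U d, colour V d)) ⁻¹' {c}).encard → w c = K) ∧
      ∀ φ : Formula A, φ.IsSentence → φ.VarsLT K →
        (FirstTrue K w φ ↔ φ.Realize U g) ∧ (SecondTrue K w φ ↔ φ.Realize V g) := by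
  have hI := flagged_mem_infLabels fun d => (colour U d, colour V d)
  obtain ⟨w, hw, hc, hpos, hwK⟩ := exists_isCount K hI
  exact ⟨w, hw, hpos, hwK, fun φ hs hφ => ⟨countTrue_iff firstColour hK hI hc hs hφ g,
    countTrue_iff secondColour hK hI hc hs hφ g⟩⟩

/-- Equivalence on nonempty models can be tested on finite labelled structures. -/
theorem forall_realize_iff {φ ψ : Formula A} (hK : 0 < K) (hs : φ.IsSentence)
    (hs' : ψ.IsSentence) (hφ : φ.VarsLT K) (hψ : ψ.VarsLT K) :
    (∀ (D : Type u) (V : A → Set D) (g : ℕ → D), φ.Realize V g ↔ ψ.Realize V g) ↔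
      ∀ w, IsCount K (infLabels _) w → (FirstTrue K w φ ↔ FirstTrue K w ψ) := by
  constructor
  · intro h w hw
    obtain ⟨D, lab, hI, hc⟩ := hw.exists_model.{u}
    rcases isEmpty_or_nonempty D with hD | ⟨⟨d⟩⟩
    · have hfalse : ∀ χ, ¬ FirstTrue K w χ := by
        rintro χ ⟨d, -⟩
        obtain ⟨d', -⟩ := hc.symm.exists_eq hK d
        exact hD.false d'
      exact iff_of_false (hfalse φ) (hfalse ψ)
    · rw [FirstTrue, FirstTrue, countTrue_iff _ hK hI hc hs hφ fun _ => d,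
        countTrue_iff _ hK hI hc hs' hψ fun _ => d, h]
  · intro h D V g
    obtain ⟨w, hw, -, -, hr⟩ := exists_count_of_pair hK V V g
    rw [← (hr φ hs hφ).1, ← (hr ψ hs' hψ).1, h w hw]

/-- The second colours of the elements where the valuations differ occur at least `K` times in the
first valuation, and their first colours infinitely often. -/
def LargePart (B : Set A) (K : ℕ) (w : PairLabel A → ℕ) : Prop :=
  ∀ c, 0 < w c → ColourLE B (firstColour c) (secondColour c) ∧
    (firstColour c = secondColour c ∨
      c.2 = true ∧ w ((secondColour c, secondColour c), false) = K)

/-- For a continuous `φ` some finite `F` suffices, though nothing is known about it. By monotonicity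
`φ` holds if elements of `F` have their second colour and the others their first. Passing from there
to the first colours everywhere changes only finitely many elements, and `φ` does not notice: the
colours that gain elements are infinite, those that lose elements still occur `K` times. -/
theorem realize_first_of_large {lab : D → PairLabel A} (hK : 0 < K) {φ : Formula A}
    (hs : φ.IsSentence) (hv : φ.VarsLT K) (hmono : ∀ (V V' : A → Set D) (g : ℕ → D),
      φ.Realize V g → ValLE B V V' → φ.Realize V' g)
    (hle : ∀ d, ColourLE B (firstColour (lab d)) (secondColour (lab d)))
    (hlarge : ∀ d, firstColour (lab d) = secondColour (lab d) ∨
      (lab ⁻¹' {lab d}).Infinite ∧ (K : ℕ∞) ≤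
        (lab ⁻¹' {((secondColour (lab d), secondColour (lab d)), false)}).encard)
    {F : Set D} (hF : F.Finite) {g : ℕ → D}
    (h : φ.Realize (restrictVal B F (labVal secondColour lab)) g) :
    φ.Realize (labVal firstColour lab) g := by
  classical
  let lab₁ : D → Set A := fun d => firstColour (lab d)
  let lab' : D → Set A := fun d => if d ∈ F then secondColour (lab d) else firstColour (lab d)
  have hr : φ.Realize (labVal id lab') g := by
    refine hmono _ _ _ h (valLE_iff.2 fun d => ?_)
    rw [colour_labVal]
    by_cases hd : d ∈ F
    · simp only [lab', if_pos hd]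
      exact ⟨fun a ha => ha.1, fun a ha haB => ⟨ha, fun h => absurd h haB⟩⟩
    · simp only [lab', if_neg hd]
      exact ⟨fun a ha => (hle d).2 a ha.1 fun haB => hd (ha.2 haB),
        fun a ha haB => ⟨(hle d).1 ha, fun h => absurd h haB⟩⟩
  have hne : ∀ d, lab' d ≠ lab₁ d → d ∈ F := by
    intro d hd
    by_contra hdF
    exact hd (if_neg hdF)
  have hinf : ∀ c, (lab' ⁻¹' {c}).Infinite ↔ (lab₁ ⁻¹' {c}).Infinite := by
    intro c
    constructor
    · refine fun hc => (hc.sdiff hF).mono ?_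
      rintro d ⟨rfl, hd⟩
      by_contra h
      exact hd (hne d fun h' => h h'.symm)
    · refine fun hc => (hc.sdiff hF).mono ?_
      rintro d ⟨rfl, hd⟩
      by_contra h
      exact hd (hne d h)
  have hcount : SameCount K lab' lab₁ := by
    intro c n hn
    have hn' : (n : ℕ∞) ≤ K := by exact_mod_cast hn
    by_cases hc : (lab₁ ⁻¹' {c}).Infinite
    · rw [hc.encard_eq, ((hinf c).2 hc).encard_eq]
    · have hsub : lab₁ ⁻¹' {c} ⊆ lab' ⁻¹' {c} := by
        rintro d rfl
        by_contra hd
        have hdF := hne d hd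
        have hd' : secondColour (lab d) ≠ firstColour (lab d) := by
          simpa [lab', hdF, lab₁] using hd
        rcases hlarge d with h | h
        · exact hd' h.symm
        · refine hc (h.1.mono fun d' hd' => ?_)
          exact congrArg firstColour hd'
      by_cases hsub' : lab' ⁻¹' {c} ⊆ lab₁ ⁻¹' {c}
      · rw [hsub.antisymm hsub']
      · obtain ⟨d, rfl, hd₁⟩ := Set.not_subset.1 hsub'
        have hd : lab' d ≠ lab₁ d := fun h => hd₁ h.symm
        have hdF := hne d hd
        have hd2 : lab' d = secondColour (lab d) := if_pos hdF
        have hK' : (K : ℕ∞) ≤ (lab₁ ⁻¹' {lab' d}).encard := by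
          rcases hlarge d with h | h
          · exact absurd (hd2.trans h.symm) hd
          · refine h.2.trans (Set.encard_le_encard fun d' hd' => ?_)
            rw [hd2]
            exact congrArg firstColour hd'
        exact iff_of_true (hn'.trans (hK'.trans (Set.encard_le_encard hsub))) (hn'.trans hK')
  exact (realize_iff_of_sameCount id hcount hinf hK hs hv g g).1 hr

/-- The set `F` contains all elements of finite colours and `K` elements of each infinite colour.
Only elements of infinite colours are changed by the restriction to `F`, and almost all elements of
such a colour change in the same way. -/
theorem exists_large_restrictVal (B : Set A) (K : ℕ) (V : A → Set D) :
    ∃ F : Set D, F.Finite ∧ ∀ w : PairLabel A → ℕ,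
      (∀ c, 0 < w c →
        ∃ d, flagged (fun d => (colour (restrictVal B F V) d, colour V d)) d = c) →
      (∀ c, (K : ℕ∞) ≤
        (flagged (fun d => (colour (restrictVal B F V) d, colour V d)) ⁻¹' {c}).encard →
          w c = K) → LargePart B K w := by
  classical
  have hsel : ∀ c, ∃ G : Set D, G.Finite ∧ G ⊆ colour V ⁻¹' {c} ∧
      ((colour V ⁻¹' {c}).Infinite → (K : ℕ∞) ≤ G.encard) ∧
      (¬ (colour V ⁻¹' {c}).Infinite → G = colour V ⁻¹' {c}) := by
    intro c
    by_cases hc : (colour V ⁻¹' {c}).Infinite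
    · obtain ⟨t, ht, htc⟩ := hc.exists_subset_card_eq K
      refine ⟨t, t.finite_toSet, ht, fun _ => ?_, fun h => absurd hc h⟩
      rw [Set.encard_coe_eq_coe_finsetCard, htc]
    · exact ⟨_, Set.not_infinite.1 hc, subset_rfl, fun h => absurd h hc, fun _ => rfl⟩
  choose G hG hGsub hGK hGfin using hsel
  let F : Set D := ⋃ c, G c
  have hF : F.Finite := Set.finite_iUnion hG
  have hGF : ∀ c, G c ⊆ F := Set.subset_iUnion G
  have hin : ∀ d ∈ F, colour (restrictVal B F V) d = colour V d := by
    intro d hd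
    ext a
    exact ⟨fun h => h.1, fun h => ⟨h, fun _ => hd⟩⟩
  have hout : ∀ d ∉ F, colour (restrictVal B F V) d = colour V d \ B := by
    intro d hd
    ext a
    exact ⟨fun h => ⟨h.1, fun hB => hd (h.2 hB)⟩, fun h => ⟨h.1, fun hB => absurd hB h.2⟩⟩
  refine ⟨F, hF, fun w hpos hwK c hc => ?_⟩
  obtain ⟨d, rfl⟩ := hpos c hc
  refine ⟨valLE_iff.1 (restrictVal_valLE B F V) d, ?_⟩
  by_cases hd : colour (restrictVal B F V) d = colour V d
  · exact Or.inl hd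
  right
  have hdF : d ∉ F := fun h => hd (hin d h)
  have hinf : (colour V ⁻¹' {colour V d}).Infinite := by
    by_contra h
    exact hdF (hGF _ (by rw [hGfin _ h]; rfl))
  constructor
  · have := (flagged_mem_infLabels (fun d => (colour (restrictVal B F V) d, colour V d)) d).2
    refine this ?_
    rw [flagged_preimage]
    refine (hinf.sdiff hF).mono ?_
    rintro d' ⟨hd', hdF'⟩
    have hd' : colour V d' = colour V d := hd'
    simp [hout d hdF, hout d' hdF', hd']
  · refine hwK _ ((hGK _ hinf).trans (Set.encard_le_encard fun d' hd' => ?_))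
    have hcol : colour V d' = colour V d := hGsub _ hd'
    -- The flag is `false`: outside `F` the first colour is `colour V d \ B`, which differs from
    -- `colour V d` by `hd`, so this class lies in `F`.
    have hfin : ¬ ((fun d => (colour (restrictVal B F V) d, colour V d)) ⁻¹'
        {(colour V d, colour V d)}).Infinite := by
      refine Set.not_infinite.2 (hF.subset fun d'' hd'' => ?_)
      by_contra hdF''
      have h₁ := (Prod.mk.inj hd'').1
      have h₂ := (Prod.mk.inj hd'').2
      rw [hout d'' hdF'', h₂, ← hout d hdF] at h₁
      exact hd h₁
    have hd'' : colour (restrictVal B F V) d' = colour V d := (hin d' (hGF _ hd')).trans hcol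
    simp only [Set.mem_preimage, Set.mem_singleton_iff, flagged, secondColour, hd'', hcol]
    simpa using hfin

/-- Continuity can be tested on finite labelled structures. -/
theorem continuousIn_iff_forall_count {φ : Formula A} (hK : 0 < K) (hs : φ.IsSentence)
    (hv : φ.VarsLT K) :
    ContinuousIn.{u} B φ ↔ ∀ w, IsCount K (infLabels _) w →
      ((∀ c, 0 < w c → ColourLE B (firstColour c) (secondColour c)) →
        FirstTrue K w φ → SecondTrue K w φ) ∧
      (LargePart B K w → SecondTrue K w φ → FirstTrue K w φ) := by
  constructor
  · intro hφ w hw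
    obtain ⟨D, lab, hI, hc⟩ := hw.exists_model.{u}
    have hoccurs : ∀ d, 0 < w (lab d) := by
      intro d
      obtain ⟨⟨c, i⟩, hd⟩ := hc.exists_eq hK d
      rw [hd]
      exact i.pos
    have hr : ∀ (π : PairLabel A → Set A), CountTrue π (infLabels _) K w φ →
        ∃ g : ℕ → D, True := by
      rintro π ⟨d, -⟩
      obtain ⟨d', -⟩ := hc.symm.exists_eq hK d
      exact ⟨fun _ => d', trivial⟩
    constructor
    · intro hle h
      obtain ⟨g, -⟩ := hr _ h
      refine (countTrue_iff _ hK hI hc hs hv g).2 (hφ.1 D _ _ g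
        ((countTrue_iff _ hK hI hc hs hv g).1 h) (valLE_iff.2 fun d => hle _ (hoccurs d)))
    · intro hlarge h
      obtain ⟨g, -⟩ := hr _ h
      obtain ⟨F, hF, hreal⟩ := hφ.exists_restrictVal ((countTrue_iff _ hK hI hc hs hv g).1 h)
      refine (countTrue_iff _ hK hI hc hs hv g).2 (realize_first_of_large hK hs hv
        (hφ.1 D) (fun d => (hlarge _ (hoccurs d)).1) (fun d => ?_) hF hreal)
      refine (hlarge _ (hoccurs d)).2.imp id fun h => ⟨(hI d).1 h.1, ?_⟩
      rw [hc _ K le_rfl, encard_sigma_fst, h.2]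
  · intro h
    refine ⟨fun D V V' g hr hle => ?_, fun D V g hr => ?_⟩
    · obtain ⟨w, hw, hpos, -, ht⟩ := exists_count_of_pair hK V V' g
      refine ((ht φ hs hv).2).1 ((h w hw).1 (fun c hc => ?_) (((ht φ hs hv).1).2 hr))
      obtain ⟨d, rfl⟩ := hpos c hc
      exact valLE_iff.1 hle d
    -- The explicit large restriction is the witness for the second clause of continuity.
    · obtain ⟨F, hF, hlarge⟩ := exists_large_restrictVal B K V
      obtain ⟨w, hw, hpos, hwK, ht⟩ := exists_count_of_pair hK (restrictVal B F V) V g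
      exact ⟨_, restrictVal_valFinLE B hF V, ((ht φ hs hv).1).1
        ((h w hw).2 (hlarge w hpos hwK) (((ht φ hs hv).2).2 hr))⟩

end Criteria

end MonadicFO

/-! ### Primitive recursive predicates and recursion on codes. -/

section PrimrecAux

variable {α β : Type*} [Primcodable α] [Primcodable β]

theorem PrimrecPred.of_const (c : Prop) : PrimrecPred fun _ : α => c :=
  ⟨fun _ => Classical.propDecidable c, Primrec.const _⟩

theorem PrimrecPred.imp {p q : α → Prop} (hp : PrimrecPred p) (hq : PrimrecPred q) :
    PrimrecPred fun a => p a → q a :=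
  (hp.not.or hq).of_eq fun _ => by tauto

theorem PrimrecPred.iff {p q : α → Prop} (hp : PrimrecPred p) (hq : PrimrecPred q) :
    PrimrecPred fun a => p a ↔ q a :=
  ((hp.imp hq).and (hq.imp hp)).of_eq fun _ => by tauto

theorem PrimrecPred.forall_finite {ι : Type*} [Finite ι] {p : ι → α → Prop}
    (hp : ∀ i, PrimrecPred (p i)) : PrimrecPred fun a => ∀ i, p i a := by
  have key : ∀ l : List ι, PrimrecPred fun a => ∀ i ∈ l, p i a := by
    intro l
    induction l with
    | nil => exact (PrimrecPred.of_const True).of_eq fun _ => by simp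
    | cons i l ih => exact ((hp i).and ih).of_eq fun _ => by simp
  exact (key (Set.finite_univ (α := ι)).toFinset.toList).of_eq fun _ => by simp

theorem PrimrecPred.forall_lt' {p : α → ℕ → Prop} (hp : PrimrecRel p) {f : α → ℕ}
    (hf : Primrec f) : PrimrecPred fun a => ∀ x < f a, p a x :=
  ((PrimrecRel.forall_mem_list (R := fun x a => p a x) (PrimrecPred.comp hp
    (Primrec.snd.pair Primrec.fst))).comp (Primrec.list_range.comp hf) Primrec.id).of_eq
      fun _ => by simp

theorem PrimrecPred.exists_mem_list' {p : α → β → Prop} (hp : PrimrecRel p) {f : α → List β}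
    (hf : Primrec f) : PrimrecPred fun a => ∃ x ∈ f a, p a x :=
  (PrimrecRel.exists_mem_list (R := fun x a => p a x) (PrimrecPred.comp hp
    (Primrec.snd.pair Primrec.fst))).comp hf Primrec.id

theorem PrimrecPred.mem_list {f : α → β} (hf : Primrec f) {l : α → List β} (hl : Primrec l) :
    PrimrecPred fun a => f a ∈ l a :=
  (PrimrecPred.exists_mem_list' (p := fun a x => x = f a)
    (Primrec.eq.comp Primrec.snd (hf.comp Primrec.fst)) hl).of_eq fun _ => by simp

theorem Primrec.nat_pow {f g : α → ℕ} (hf : Primrec f) (hg : Primrec g) :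
    Primrec fun a => f a ^ g a :=
  (Primrec₂.unpaired'.1 Nat.Primrec.pow).comp hf hg

theorem Primrec.filter_range {E : α → ℕ} (hE : Primrec E) {p : α → ℕ → Prop}
    (hp : PrimrecRel p) [∀ a, DecidablePred (p a)] :
    Primrec fun a => (List.range (E a)).filter (fun e => decide (p a e)) :=
  (PrimrecRel.listFilter (R := fun e a => p a e) (PrimrecPred.comp hp
    (Primrec.snd.pair Primrec.fst))).comp (Primrec.list_range.comp hE) Primrec.id

/-- Unbounded search for a witness that is known to exist. -/
theorem exists_computable_witness {p : α → ℕ → Prop} (hp : PrimrecRel p)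
    (h : ∀ a, ∃ c, p a c) : ∃ f : α → ℕ, Computable f ∧ ∀ a, p a (f a) := by
  classical
  refine ⟨fun a => Nat.find (h a), ?_, fun a => Nat.find_spec (h a)⟩
  have hdec : Computable₂ fun a c => decide (p a c) :=
    (show Primrec fun x : α × ℕ => decide (p x.1 x.2) from PrimrecPred.decide hp).to_comp
  refine (Partrec.rfind (p := fun a c => Part.some (decide (p a c))) hdec).of_eq fun a => ?_
  refine Part.eq_some_iff.2 (Nat.mem_rfind.2 ⟨?_, fun {m} hm => ?_⟩)
  · simpa using Nat.find_spec (h a)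
  · simpa using Nat.find_min (h a) hm

/-- The data for a recursion step at the number `⟨t, p, q⟩`: a parameter, the numbers `t`, `p`, `q`,
the values at `p` and `q`, and a candidate for membership in the value. -/
abbrev RecData (α : Type*) : Type _ := α × (ℕ × ℕ × ℕ) × (List ℕ × List ℕ) × ℕ

namespace RecData

theorem primrec_param : Primrec fun x : RecData α => x.1 := Primrec.fst

theorem primrec_tag : Primrec fun x : RecData α => x.2.1.1 :=
  Primrec.fst.comp (Primrec.fst.comp Primrec.snd)

theorem primrec_arg₁ : Primrec fun x : RecData α => x.2.1.2.1 :=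
  Primrec.fst.comp (Primrec.snd.comp (Primrec.fst.comp Primrec.snd))

theorem primrec_arg₂ : Primrec fun x : RecData α => x.2.1.2.2 :=
  Primrec.snd.comp (Primrec.snd.comp (Primrec.fst.comp Primrec.snd))

theorem primrec_val₁ : Primrec fun x : RecData α => x.2.2.1.1 :=
  Primrec.fst.comp (Primrec.fst.comp (Primrec.snd.comp Primrec.snd))

theorem primrec_val₂ : Primrec fun x : RecData α => x.2.2.1.2 :=
  Primrec.snd.comp (Primrec.fst.comp (Primrec.snd.comp Primrec.snd))

theorem primrec_elem : Primrec fun x : RecData α => x.2.2.2 :=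
  Primrec.snd.comp (Primrec.snd.comp Primrec.snd)

theorem primrecPred_tag (t : ℕ) : PrimrecPred fun x : RecData α => x.2.1.1 = t :=
  Primrec.eq.comp primrec_tag (Primrec.const t)

end RecData

/-- Primitive recursion along the pairing function, with finite sets of numbers as values. -/
theorem exists_primrec_pair_rec {E : α → ℕ} (hE : Primrec E) {step : RecData α → Prop}
    (hstep : PrimrecPred step) :
    ∃ F : α → ℕ → List ℕ, Primrec₂ F ∧ ∀ a t p q n, n = Nat.pair t (Nat.pair p q) → ∀ e,
      e ∈ F a n ↔ e < E a ∧ step (a, (t, p, q),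
        (if p < n then F a p else [], if q < n then F a q else []), e) := by
  classical
  -- The list `l` holds the values at all smaller numbers, so its length is the current number. The
  -- default `[]` of `getD` accounts for the guards `p < n` and `q < n`.
  let data : α → List (List ℕ) → ℕ → RecData α := fun a l e =>
    (a, (l.length.unpair.1, l.length.unpair.2.unpair.1, l.length.unpair.2.unpair.2),
      (l.getD l.length.unpair.2.unpair.1 [], l.getD l.length.unpair.2.unpair.2 []), e)
  let G : α → List (List ℕ) → List ℕ := fun a l =>
    (List.range (E a)).filter fun e => decide (step (data a l e))
  have hG : Primrec₂ G := by
    have hl : Primrec fun x : (α × List (List ℕ)) × ℕ => x.1.2 :=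
      Primrec.snd.comp Primrec.fst
    have hu : Primrec fun x : (α × List (List ℕ)) × ℕ => x.1.2.length.unpair :=
      Primrec.unpair.comp (Primrec.list_length.comp hl)
    have hu₂ : Primrec fun x : (α × List (List ℕ)) × ℕ => x.1.2.length.unpair.2.unpair :=
      Primrec.unpair.comp (Primrec.snd.comp hu)
    have hget : ∀ {f : (α × List (List ℕ)) × ℕ → ℕ}, Primrec f →
        Primrec fun x : (α × List (List ℕ)) × ℕ => x.1.2.getD (f x) [] := fun hf => (Primrec.list_getD []).comp hl hf
    have hdata : Primrec fun x : (α × List (List ℕ)) × ℕ => data x.1.1 x.1.2 x.2 :=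
      (Primrec.fst.comp Primrec.fst).pair
        (((Primrec.fst.comp hu).pair ((Primrec.fst.comp hu₂).pair (Primrec.snd.comp hu₂))).pair
          (((hget (Primrec.fst.comp hu₂)).pair (hget (Primrec.snd.comp hu₂))).pair Primrec.snd))
    exact Primrec.filter_range (p := fun (x : α × List (List ℕ)) e => step (data x.1 x.2 e))
      (hE.comp Primrec.fst) (hstep.comp hdata)
  let T : α → ℕ → List (List ℕ) := fun a n => n.rec [] fun _ l => l ++ [G a l]
  let F : α → ℕ → List ℕ := fun a n => G a (T a n)
  have hT : ∀ a n, (List.range n).map (F a) = T a n := by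
    intro a n
    induction n with
    | zero => rfl
    | succ n ih =>
      rw [List.range_succ, List.map_append, ih]
      rfl
  refine ⟨F, Primrec.nat_strong_rec F (g := fun a l => some (G a l))
    (Primrec.option_some.comp hG) (fun a n => by rw [hT]), ?_⟩
  rintro a t p q n rfl e
  have hget : ∀ n k, (T a n).getD k [] = if k < n then F a k else [] := by
    intro n k
    rw [← hT, List.getD_eq_getElem?_getD]
    split_ifs with h
    · simp [h]
    · simp [not_lt.1 h]
  have hlen : (T a (Nat.pair t (Nat.pair p q))).length = Nat.pair t (Nat.pair p q) := by
    rw [← hT]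
    simp
  change e ∈ (List.range (E a)).filter (fun e => decide (step (data a (T a _) e))) ↔ _
  rw [List.mem_filter, List.mem_range, decide_eq_true_eq]
  simp only [data, hlen, Nat.unpair_pair, hget]

/-- All codes of compound formulas have a positive tag, so subformulas have smaller codes and the
recursion reaches their values. -/
theorem Nat.lt_pair_of_pos {t : ℕ} (ht : 0 < t) (m : ℕ) : m < Nat.pair t m := by
  unfold Nat.pair
  split_ifs <;> nlinarith

theorem Nat.left_lt_pair_pair {t : ℕ} (ht : 0 < t) (p q : ℕ) :
    p < Nat.pair t (Nat.pair p q) :=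
  (Nat.left_le_pair p q).trans_lt (Nat.lt_pair_of_pos ht _)

theorem Nat.right_lt_pair_pair {t : ℕ} (ht : 0 < t) (p q : ℕ) :
    q < Nat.pair t (Nat.pair p q) :=
  (Nat.right_le_pair p q).trans_lt (Nat.lt_pair_of_pos ht _)

end PrimrecAux

/-! ### Syntactic properties read off from codes. -/

namespace MonadicFO

open Function Formula

variable {A : Type v} [Encodable A]

namespace Formula

/-- This makes the number of pebbles computable from the code. -/
theorem varsLT_code (φ : Formula A) : φ.VarsLT (φ.code + 1) := by
  have h : ∀ {t : ℕ}, 0 < t → ∀ p q, p < Nat.pair t (Nat.pair p q) + 1 ∧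
      q < Nat.pair t (Nat.pair p q) + 1 := fun ht p q =>
    ⟨(Nat.left_lt_pair_pair ht p q).trans (Nat.lt_succ_self _),
      (Nat.right_lt_pair_pair ht p q).trans (Nat.lt_succ_self _)⟩
  have h₁ : ∀ {t : ℕ}, 0 < t → ∀ p q, p + 1 ≤ Nat.pair t (Nat.pair p q) + 1 :=
    fun ht p q => (Nat.succ_le_succ (Nat.left_lt_pair_pair ht p q).le)
  have h₂ : ∀ {t : ℕ}, 0 < t → ∀ p q, q + 1 ≤ Nat.pair t (Nat.pair p q) + 1 :=
    fun ht p q => (Nat.succ_le_succ (Nat.right_lt_pair_pair ht p q).le)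
  induction φ with
  | top | bot => trivial
  | pos a x => exact (h (by norm_num) _ _).2
  | neg a x => exact (h (by norm_num) _ _).2
  | eq x y => exact h (by norm_num) _ _
  | ne x y => exact h (by norm_num) _ _
  | or φ ψ ih₁ ih₂ => exact ⟨ih₁.mono (h₁ (by norm_num) _ _), ih₂.mono (h₂ (by norm_num) _ _)⟩
  | and φ ψ ih₁ ih₂ => exact ⟨ih₁.mono (h₁ (by norm_num) _ _), ih₂.mono (h₂ (by norm_num) _ _)⟩
  | ex x φ ih => exact ⟨(h (by norm_num) _ _).1, ih.mono (h₂ (by norm_num) _ _)⟩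
  | all x φ ih => exact ⟨(h (by norm_num) _ _).1, ih.mono (h₂ (by norm_num) _ _)⟩
  | exInf x φ ih => exact ⟨(h (by norm_num) _ _).1, ih.mono (h₂ (by norm_num) _ _)⟩
  | allInf x φ ih => exact ⟨(h (by norm_num) _ _).1, ih.mono (h₂ (by norm_num) _ _)⟩

open RecData in
/-- Whether a formula is a sentence can be read off primitive recursively from its code. -/
theorem exists_primrecPred_isSentence :
    ∃ P : ℕ → Prop, PrimrecPred P ∧ ∀ φ : Formula A, P φ.code ↔ φ.IsSentence := by
  -- The value at a code is the set of free variables below the parameter.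
  let step : RecData ℕ → Prop := fun x =>
    ((x.2.1.1 = 2 ∨ x.2.1.1 = 3) ∧ x.2.2.2 = x.2.1.2.2) ∨
    ((x.2.1.1 = 4 ∨ x.2.1.1 = 5) ∧ (x.2.2.2 = x.2.1.2.1 ∨ x.2.2.2 = x.2.1.2.2)) ∨
    ((x.2.1.1 = 6 ∨ x.2.1.1 = 7) ∧ (x.2.2.2 ∈ x.2.2.1.1 ∨ x.2.2.2 ∈ x.2.2.1.2)) ∨
    (8 ≤ x.2.1.1 ∧ x.2.2.2 ≠ x.2.1.2.1 ∧ x.2.2.2 ∈ x.2.2.1.2)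
  have heq₁ : PrimrecPred fun x : RecData ℕ => x.2.2.2 = x.2.1.2.1 :=
    Primrec.eq.comp primrec_elem primrec_arg₁
  have heq₂ : PrimrecPred fun x : RecData ℕ => x.2.2.2 = x.2.1.2.2 :=
    Primrec.eq.comp primrec_elem primrec_arg₂
  have hmem₁ : PrimrecPred fun x : RecData ℕ => x.2.2.2 ∈ x.2.2.1.1 :=
    .mem_list primrec_elem primrec_val₁
  have hmem₂ : PrimrecPred fun x : RecData ℕ => x.2.2.2 ∈ x.2.2.1.2 :=
    .mem_list primrec_elem primrec_val₂
  have htag : ∀ t, PrimrecPred fun x : RecData ℕ => x.2.1.1 = t := primrecPred_tag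
  have hstep : PrimrecPred step :=
    (((htag 2).or (htag 3)).and heq₂).or <|
    (((htag 4).or (htag 5)).and (heq₁.or heq₂)).or <|
    (((htag 6).or (htag 7)).and (hmem₁.or hmem₂)).or <|
    (Primrec.nat_le.comp (Primrec.const 8) primrec_tag).and (heq₁.not.and hmem₂)
  obtain ⟨F, hF, hspec⟩ := exists_primrec_pair_rec Primrec.id hstep
  have key : ∀ (φ : Formula A) K e, e ∈ F K φ.code ↔ e < K ∧ e ∈ φ.freeVars := by
    intro φ
    induction φ with
    | top =>
      intro K e
      -- Since `Nat.pair 0 0 = 0`, the code of `top` also has the form of a tag with two arguments.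
      refine (hspec K 0 0 0 _ rfl e).trans ?_
      simp [step, freeVars]
    | bot =>
      intro K e
      refine (hspec K 1 0 0 _ rfl e).trans ?_
      simp [step, freeVars]
    | pos a x | neg a x | eq x y | ne x y =>
      intro K e
      refine (hspec K _ _ _ _ rfl e).trans ?_
      simp [step, freeVars]
    | or φ ψ ih₁ ih₂ | and φ ψ ih₁ ih₂ =>
      intro K e
      refine (hspec K _ _ _ _ rfl e).trans ?_
      simp only [step, Nat.left_lt_pair_pair, Nat.right_lt_pair_pair,
        Nat.zero_lt_succ, if_true, ih₁, ih₂, freeVars, Finset.mem_union]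
      norm_num
      tauto
    | ex x φ ih | all x φ ih | exInf x φ ih | allInf x φ ih =>
      intro K e
      refine (hspec K _ _ _ _ rfl e).trans ?_
      simp only [step, Nat.right_lt_pair_pair,
        Nat.zero_lt_succ, if_true, ih, freeVars, Finset.mem_erase]
      norm_num
      tauto
  refine ⟨fun m => ∀ x < m + 1, x ∉ F (m + 1) m, ?_, fun φ => ?_⟩
  · refine PrimrecPred.forall_lt' (p := fun m x => x ∉ F (m + 1) m) (PrimrecPred.not (PrimrecPred.mem_list Primrec.snd
      (hF.comp (Primrec.succ.comp Primrec.fst) Primrec.fst))) Primrec.succ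
  · simp only [key, IsSentence, Finset.eq_empty_iff_forall_notMem]
    exact ⟨fun h x hx => h x (φ.varsLT_code.lt_of_mem_freeVars hx)
      ⟨φ.varsLT_code.lt_of_mem_freeVars hx, hx⟩, fun h x _ hx => h x hx.2⟩

open RecData in
/-- Truth in the empty model can be read off primitive recursively from the code. -/
theorem exists_primrecPred_trueOnEmpty :
    ∃ P : ℕ → Prop, PrimrecPred P ∧ ∀ φ : Formula A, P φ.code ↔ φ.TrueOnEmpty := by
  -- The values are subsets of `{0}`, and membership of `0` means truth.
  let step : RecData Unit → Prop := fun x =>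
    x.2.1.1 = 0 ∨ x.2.1.1 = 9 ∨ x.2.1.1 = 11 ∨
    (x.2.1.1 = 6 ∧ (x.2.2.2 ∈ x.2.2.1.1 ∨ x.2.2.2 ∈ x.2.2.1.2)) ∨
    (x.2.1.1 = 7 ∧ x.2.2.2 ∈ x.2.2.1.1 ∧ x.2.2.2 ∈ x.2.2.1.2)
  have hmem₁ : PrimrecPred fun x : RecData Unit => x.2.2.2 ∈ x.2.2.1.1 :=
    .mem_list primrec_elem primrec_val₁
  have hmem₂ : PrimrecPred fun x : RecData Unit => x.2.2.2 ∈ x.2.2.1.2 :=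
    .mem_list primrec_elem primrec_val₂
  have htag : ∀ t, PrimrecPred fun x : RecData Unit => x.2.1.1 = t := primrecPred_tag
  have hstep : PrimrecPred step :=
    (htag 0).or <| (htag 9).or <| (htag 11).or <|
    ((htag 6).and (hmem₁.or hmem₂)).or ((htag 7).and (hmem₁.and hmem₂))
  obtain ⟨F, hF, hspec⟩ := exists_primrec_pair_rec (Primrec.const 1) hstep
  refine ⟨fun m => 0 ∈ F () m, PrimrecPred.mem_list (Primrec.const 0)
    (hF.comp (Primrec.const ()) Primrec.id), fun φ => ?_⟩
  induction φ with
  | top =>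
    refine (hspec () 0 0 0 _ rfl 0).trans ?_
    simp [step, TrueOnEmpty]
  | bot =>
    refine (hspec () 1 0 0 _ rfl 0).trans ?_
    simp [step, TrueOnEmpty]
  | pos a x | neg a x | eq x y | ne x y | ex x φ | all x φ | exInf x φ | allInf x φ =>
    refine (hspec () _ _ _ _ rfl 0).trans ?_
    simp [step, TrueOnEmpty]
  | or φ ψ ih₁ ih₂ | and φ ψ ih₁ ih₂ =>
    refine (hspec () _ _ _ _ rfl 0).trans ?_
    simp only [step, Nat.left_lt_pair_pair, Nat.right_lt_pair_pair,
      Nat.zero_lt_succ, if_true, ih₁, ih₂, TrueOnEmpty]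
    norm_num

end Formula

end MonadicFO

namespace MonadicFO

open Function Formula RecData

variable {A : Type v} [Encodable A]

namespace Formula

theorem exists_list_of_codes [Finite A] (B : Set A) :
    ∃ l : List ℕ, ∀ m, m ∈ l ↔ ∃ a ∈ B, Encodable.encode a = m :=
  ⟨((Set.toFinite B).image Encodable.encode).toFinset.toList, by simp⟩

/-- Membership in the set of `B`-free formulas of a logic can be read off from the code. -/
theorem exists_primrecPred_avoids [Finite A] (L : MLogic) (B : Set A) :
    ∃ P : ℕ → Prop, PrimrecPred P ∧
      ∀ m, P m ↔ ∃ φ : Formula A, φ.code = m ∧ φ.InLogic L ∧ φ.Avoids B := by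
  obtain ⟨l, hl⟩ := exists_list_of_codes Bᶜ
  let step : RecData Unit → Prop := fun x =>
    -- Arguments must vanish at the tags of `top` and `bot`: other numbers with these tags code no
    -- formula.
    (x.2.1.1 ≤ 1 ∧ x.2.1.2.1 = 0 ∧ x.2.1.2.2 = 0) ∨
    ((x.2.1.1 = 2 ∨ x.2.1.1 = 3) ∧ x.2.1.2.1 ∈ l) ∨
    ((x.2.1.1 = 4 ∨ x.2.1.1 = 5) ∧ L = MLogic.FOEinf) ∨
    ((x.2.1.1 = 6 ∨ x.2.1.1 = 7) ∧ 0 ∈ x.2.2.1.1 ∧ 0 ∈ x.2.2.1.2) ∨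
    ((x.2.1.1 = 8 ∨ x.2.1.1 = 9) ∧ 0 ∈ x.2.2.1.2) ∨
    ((x.2.1.1 = 10 ∨ x.2.1.1 = 11) ∧ L = MLogic.FOEinf ∧ 0 ∈ x.2.2.1.2)
  have htag : ∀ t, PrimrecPred fun x : RecData Unit => x.2.1.1 = t := primrecPred_tag
  have hmem₁ : PrimrecPred fun x : RecData Unit => 0 ∈ x.2.2.1.1 :=
    .mem_list (Primrec.const 0) primrec_val₁
  have hmem₂ : PrimrecPred fun x : RecData Unit => 0 ∈ x.2.2.1.2 :=
    .mem_list (Primrec.const 0) primrec_val₂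
  have hL : PrimrecPred fun _ : RecData Unit => L = MLogic.FOEinf := .of_const _
  have hstep : PrimrecPred step :=
    ((Primrec.nat_le.comp primrec_tag (Primrec.const 1)).and
      ((Primrec.eq.comp primrec_arg₁ (Primrec.const 0)).and
        (Primrec.eq.comp primrec_arg₂ (Primrec.const 0)))).or <|
    (((htag 2).or (htag 3)).and (.mem_list primrec_arg₁ (Primrec.const l))).or <|
    (((htag 4).or (htag 5)).and hL).or <|
    (((htag 6).or (htag 7)).and (hmem₁.and hmem₂)).or <|
    (((htag 8).or (htag 9)).and hmem₂).or <|
    ((htag 10).or (htag 11)).and (hL.and hmem₂)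
  obtain ⟨F, hF, hspec⟩ := exists_primrec_pair_rec (Primrec.const 1) hstep
  refine ⟨fun m => 0 ∈ F () m, PrimrecPred.mem_list (Primrec.const 0)
    (hF.comp (Primrec.const ()) Primrec.id), fun m => ⟨?_, ?_⟩⟩
  · induction m using Nat.strong_induction_on with
    | _ m ih =>
    intro hm
    obtain ⟨t, p, q, rfl⟩ : ∃ t p q, m = Nat.pair t (Nat.pair p q) :=
      ⟨m.unpair.1, m.unpair.2.unpair.1, m.unpair.2.unpair.2, by simp⟩
    have hval : ∀ k, 0 ∈ (if k < Nat.pair t (Nat.pair p q) then F () k else []) →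
        ∃ φ : Formula A, φ.code = k ∧ φ.InLogic L ∧ φ.Avoids B := by
      intro k hk
      split_ifs at hk with h
      · exact ih k h hk
      · simp at hk
    obtain ⟨-, h⟩ := (hspec () t p q _ rfl 0).1 hm
    simp only [step] at h
    have hfoe : ∀ φ : Formula A, L = MLogic.FOEinf → φ.InLogic L := by
      rintro φ rfl
      trivial
    rcases h with ⟨ht, rfl, rfl⟩ | ⟨ht, ha⟩ | ⟨ht, hL⟩ | ⟨ht, h₁, h₂⟩ | ⟨ht, h⟩ | ⟨ht, hL, h⟩
    · interval_cases t
      · exact ⟨top, rfl, IsM.inLogic (φ := top) trivial L, trivial⟩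
      · exact ⟨bot, rfl, IsM.inLogic (φ := bot) trivial L, trivial⟩
    · obtain ⟨a, haB, rfl⟩ := (hl _).1 ha
      rcases ht with rfl | rfl
      · exact ⟨pos a q, rfl, IsM.inLogic (φ := pos a q) trivial L, haB⟩
      · exact ⟨neg a q, rfl, IsM.inLogic (φ := neg a q) trivial L, haB⟩
    · rcases ht with rfl | rfl
      · exact ⟨eq p q, rfl, hfoe _ hL, trivial⟩
      · exact ⟨ne p q, rfl, hfoe _ hL, trivial⟩
    · obtain ⟨φ, rfl, hφ, hφB⟩ := hval _ h₁
      obtain ⟨ψ, rfl, hψ, hψB⟩ := hval _ h₂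
      rcases ht with rfl | rfl
      · exact ⟨or φ ψ, rfl, by cases L; exacts [⟨hφ, hψ⟩, trivial], hφB, hψB⟩
      · exact ⟨and φ ψ, rfl, by cases L; exacts [⟨hφ, hψ⟩, trivial], hφB, hψB⟩
    · obtain ⟨φ, rfl, hφ, hφB⟩ := hval _ h
      rcases ht with rfl | rfl
      · exact ⟨ex p φ, rfl, by cases L; exacts [hφ, trivial], hφB⟩
      · exact ⟨all p φ, rfl, by cases L; exacts [hφ, trivial], hφB⟩
    · obtain ⟨φ, rfl, hφ, hφB⟩ := hval _ h
      rcases ht with rfl | rfl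
      · exact ⟨exInf p φ, rfl, hfoe _ hL, hφB⟩
      · exact ⟨allInf p φ, rfl, hfoe _ hL, hφB⟩
  · rintro ⟨φ, rfl, hφ, hφB⟩
    have hatom : ∀ a, a ∉ B → Encodable.encode a ∈ l := fun a ha => (hl _).2 ⟨a, ha, rfl⟩
    induction φ with
    | top => exact (hspec () 0 0 0 _ rfl 0).2 (by simp [step])
    | bot => exact (hspec () 1 0 0 _ rfl 0).2 (by simp [step])
    | pos a x | neg a x =>
      exact (hspec () _ _ _ _ rfl 0).2 (by simpa [step] using hatom a hφB)
    | eq x y | ne x y =>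
      refine (hspec () _ _ _ _ rfl 0).2 ?_
      cases L
      · exact hφ.elim
      · simp [step]
    | or φ ψ ih₁ ih₂ | and φ ψ ih₁ ih₂ =>
      have h₁ := ih₁ (by cases L; exacts [hφ.1, trivial]) hφB.1
      have h₂ := ih₂ (by cases L; exacts [hφ.2, trivial]) hφB.2
      refine (hspec () _ _ _ _ rfl 0).2 ?_
      simp [step, Nat.left_lt_pair_pair, Nat.right_lt_pair_pair, h₁, h₂]
    | ex x φ ih | all x φ ih =>
      have h := ih (by cases L; exacts [hφ, trivial]) hφB
      refine (hspec () _ _ _ _ rfl 0).2 ?_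
      simp [step, Nat.right_lt_pair_pair, h]
    | exInf x φ ih | allInf x φ ih =>
      cases L
      · exact hφ.elim
      have h := ih trivial hφB
      refine (hspec () _ _ _ _ rfl 0).2 ?_
      simp [step, Nat.right_lt_pair_pair, h]

/-- Membership in the syntactically continuous fragment can be read off from the code. -/
theorem exists_primrecPred_synContinuous [Finite A] (L : MLogic) (B : Set A) :
    ∃ P : ℕ → Prop, PrimrecPred P ∧
      ∀ m, P m ↔ ∃ φ : Formula A, φ.code = m ∧ SynContinuous L B φ := by
  obtain ⟨l, hl⟩ := exists_list_of_codes B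
  obtain ⟨Q, hQ, hQspec⟩ := exists_primrecPred_avoids L B
  -- Here `p` and `q` must be the codes of `∀x.(φ ∨ ψ)` and `∀∞x.ψ`; `x` and `ψ` are extracted from
  -- `q`, and `φ` from `p`.
  let isW : ℕ → ℕ → Prop := fun p q =>
    p = Nat.pair 9 (Nat.pair q.unpair.2.unpair.1
      (Nat.pair 6 (Nat.pair p.unpair.2.unpair.2.unpair.2.unpair.1 q.unpair.2.unpair.2))) ∧
    q = Nat.pair 11 (Nat.pair q.unpair.2.unpair.1 q.unpair.2.unpair.2) ∧ Q q.unpair.2.unpair.2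
  -- Mark `0` means membership in the fragment. The recursion sees only immediate components,
  -- whereas `W` hides `φ` under `∀` and `∨`; mark `1` carries the information about `φ` up through
  -- these two symbols.
  let step : RecData Unit → Prop := fun x =>
    (x.2.2.2 = 0 ∧ (Q (Nat.pair x.2.1.1 (Nat.pair x.2.1.2.1 x.2.1.2.2)) ∨
      (x.2.1.1 = 2 ∧ x.2.1.2.1 ∈ l) ∨
      ((x.2.1.1 = 6 ∨ x.2.1.1 = 7) ∧ 0 ∈ x.2.2.1.1 ∧ 0 ∈ x.2.2.1.2) ∨
      (x.2.1.1 = 8 ∧ 0 ∈ x.2.2.1.2) ∨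
      (x.2.1.1 = 7 ∧ L = MLogic.FOEinf ∧ isW x.2.1.2.1 x.2.1.2.2 ∧ 1 ∈ x.2.2.1.1))) ∨
    (x.2.2.2 = 1 ∧ ((x.2.1.1 = 6 ∧ 0 ∈ x.2.2.1.1) ∨ (x.2.1.1 = 9 ∧ 1 ∈ x.2.2.1.2)))
  have htag : ∀ t, PrimrecPred fun x : RecData Unit => x.2.1.1 = t := primrecPred_tag
  have helem : ∀ t, PrimrecPred fun x : RecData Unit => x.2.2.2 = t := fun t =>
    Primrec.eq.comp primrec_elem (Primrec.const t)
  have hmem₁ : ∀ i, PrimrecPred fun x : RecData Unit => i ∈ x.2.2.1.1 := fun i =>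
    .mem_list (Primrec.const i) primrec_val₁
  have hmem₂ : ∀ i, PrimrecPred fun x : RecData Unit => i ∈ x.2.2.1.2 := fun i =>
    .mem_list (Primrec.const i) primrec_val₂
  have hisW : PrimrecRel isW := by
    have hu : ∀ {f : ℕ × ℕ → ℕ}, Primrec f → Primrec fun x => (f x).unpair.2.unpair :=
      fun hf => Primrec.unpair.comp (Primrec.snd.comp (Primrec.unpair.comp hf))
    have hq₁ : Primrec fun x : ℕ × ℕ => x.2.unpair.2.unpair.1 :=
      Primrec.fst.comp (hu Primrec.snd)
    have hq₂ : Primrec fun x : ℕ × ℕ => x.2.unpair.2.unpair.2 :=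
      Primrec.snd.comp (hu Primrec.snd)
    have hp : Primrec fun x : ℕ × ℕ => x.1.unpair.2.unpair.2.unpair.2.unpair.1 :=
      Primrec.fst.comp (hu (Primrec.snd.comp (hu Primrec.fst)))
    have hpair : ∀ (t : ℕ) {f g : ℕ × ℕ → ℕ}, Primrec f → Primrec g →
        Primrec fun x => Nat.pair t (Nat.pair (f x) (g x)) := fun t f g hf hg =>
      Primrec₂.natPair.comp (Primrec.const t) (Primrec₂.natPair.comp hf hg)
    exact (Primrec.eq.comp Primrec.fst (hpair 9 hq₁ (hpair 6 hp hq₂))).and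
      ((Primrec.eq.comp Primrec.snd (hpair 11 hq₁ hq₂)).and (hQ.comp hq₂))
  have hstep : PrimrecPred step :=
    ((helem 0).and <|
      (hQ.comp (Primrec₂.natPair.comp primrec_tag
        (Primrec₂.natPair.comp primrec_arg₁ primrec_arg₂))).or <|
      ((htag 2).and (.mem_list primrec_arg₁ (Primrec.const l))).or <|
      (((htag 6).or (htag 7)).and ((hmem₁ 0).and (hmem₂ 0))).or <|
      ((htag 8).and (hmem₂ 0)).or <|
      (htag 7).and <| (PrimrecPred.of_const (L = MLogic.FOEinf)).and <|
        (hisW.comp primrec_arg₁ primrec_arg₂).and (hmem₁ 1)).or <|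
    (helem 1).and <| ((htag 6).and (hmem₁ 0)).or ((htag 9).and (hmem₂ 1))
  obtain ⟨F, hF, hspec⟩ := exists_primrec_pair_rec (Primrec.const 2) hstep
  refine ⟨fun m => 0 ∈ F () m, PrimrecPred.mem_list (Primrec.const 0)
    (hF.comp (Primrec.const ()) Primrec.id), fun m => ⟨?_, ?_⟩⟩
  · induction m using Nat.strong_induction_on with
    | _ m ih =>
    intro hm
    obtain ⟨t, p, q, rfl⟩ : ∃ t p q, m = Nat.pair t (Nat.pair p q) :=
      ⟨m.unpair.1, m.unpair.2.unpair.1, m.unpair.2.unpair.2, by simp⟩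
    have hval : ∀ {i k}, i ∈ (if k < Nat.pair t (Nat.pair p q) then F () k else []) →
        k < Nat.pair t (Nat.pair p q) ∧ i ∈ F () k := by
      intro i k hk
      split_ifs at hk with h
      · exact ⟨h, hk⟩
      · simp at hk
    have hval' : ∀ {k}, 0 ∈ (if k < Nat.pair t (Nat.pair p q) then F () k else []) →
        ∃ φ : Formula A, φ.code = k ∧ SynContinuous L B φ :=
      fun hk => ih _ (hval hk).1 (hval hk).2
    obtain ⟨-, h⟩ := (hspec () t p q _ rfl 0).1 hm
    simp only [step, true_and, zero_ne_one, false_and, or_false] at h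
    rcases h with h | ⟨rfl, ha⟩ | ⟨ht, h₁, h₂⟩ | ⟨rfl, h⟩ | ⟨rfl, hL, ⟨hp, hq, hψ⟩, h⟩
    · obtain ⟨φ, hφ, hφL, hφB⟩ := (hQspec _).1 h
      exact ⟨φ, hφ, .free φ hφL hφB⟩
    · obtain ⟨a, haB, rfl⟩ := (hl _).1 ha
      exact ⟨pos a q, rfl, .atom a haB q⟩
    · obtain ⟨φ, rfl, hφ⟩ := hval' h₁
      obtain ⟨ψ, rfl, hψ⟩ := hval' h₂
      rcases ht with rfl | rfl
      · exact ⟨or φ ψ, rfl, hφ.or hψ⟩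
      · exact ⟨and φ ψ, rfl, hφ.and hψ⟩
    · obtain ⟨φ, rfl, hφ⟩ := hval' h
      exact ⟨ex p φ, rfl, hφ.ex p⟩
    · obtain ⟨ψ, hψq, -, hψB⟩ := (hQspec _).1 hψ
      generalize q.unpair.2.unpair.1 = x at hp hq
      generalize p.unpair.2.unpair.2.unpair.2.unpair.1 = r at hp
      rw [← hψq] at hp hq
      obtain ⟨hlt, h⟩ := hval h
      have hr : r < p := by
        rw [hp]
        exact (Nat.left_lt_pair_pair (t := 6) (by norm_num) _ _).trans
          (Nat.right_lt_pair_pair (t := 9) (by norm_num) _ _)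
      rw [hp] at h
      -- Following mark `1` down through `∀` and then `∨` shows that `r` has mark `0`.
      have h₁ := ((hspec () _ _ _ _ rfl 1).1 h).2
      simp only [step, Nat.right_lt_pair_pair, Nat.zero_lt_succ, if_true] at h₁
      norm_num at h₁
      have h₂ := ((hspec () _ _ _ _ rfl 1).1 h₁).2
      simp only [step, Nat.left_lt_pair_pair, Nat.zero_lt_succ, if_true] at h₂
      norm_num at h₂
      obtain ⟨φ, rfl, hφ⟩ := ih r (hr.trans hlt) h₂
      exact ⟨W x φ ψ, by rw [hp, hq]; rfl, .w x hL hφ hψB⟩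
  · rintro ⟨φ, rfl, hφ⟩
    induction hφ with
    | free ψ hL hB =>
      have hex : ∃ t p q, ψ.code = Nat.pair t (Nat.pair p q) :=
        ⟨ψ.code.unpair.1, ψ.code.unpair.2.unpair.1, ψ.code.unpair.2.unpair.2, by simp⟩
      obtain ⟨t, p, q, h⟩ := hex
      refine (hspec () _ _ _ _ h 0).2 ⟨by norm_num, Or.inl ⟨rfl, Or.inl ?_⟩⟩
      exact (hQspec _).2 ⟨ψ, h, hL, hB⟩
    | atom b hb x =>
      refine (hspec () _ _ _ _ rfl 0).2 ⟨by norm_num, Or.inl ⟨rfl, Or.inr (Or.inl ⟨rfl, ?_⟩)⟩⟩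
      exact (hl _).2 ⟨b, hb, rfl⟩
    | and h₁ h₂ ih₁ ih₂ | or h₁ h₂ ih₁ ih₂ =>
      refine (hspec () _ _ _ _ rfl 0).2 ?_
      simp [step, Nat.left_lt_pair_pair, Nat.right_lt_pair_pair, ih₁, ih₂]
    | ex x h ih =>
      refine (hspec () _ _ _ _ rfl 0).2 ?_
      simp [step, Nat.right_lt_pair_pair, ih]
    | @w x φ ψ hL h hB ih =>
      have h₁ : 1 ∈ F () (or φ ψ).code := by
        refine (hspec () _ _ _ _ rfl 1).2 ?_
        simp [step, Nat.left_lt_pair_pair, ih]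
      have h₂ : 1 ∈ F () (all x (or φ ψ)).code := by
        refine (hspec () _ _ _ _ rfl 1).2 ?_
        simp [step, Nat.right_lt_pair_pair, h₁]
      have hψ : Q ψ.code := (hQspec _).2 ⟨ψ, rfl, hL ▸ trivial, hB⟩
      refine (hspec () _ _ _ _ rfl 0).2 ⟨by norm_num, Or.inl ⟨rfl, ?_⟩⟩
      refine Or.inr (Or.inr (Or.inr (Or.inr ⟨rfl, hL, ?_, ?_⟩)))
      · simp [isW, Formula.code, hψ]
      · simpa [Nat.left_lt_pair_pair] using h₂

end Formula

end MonadicFO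

/-! ### Numbers as assignments, and evaluation in finite labelled structures. -/

section Digits

/-- The `i`-th digit of `m` in base `b`. -/
def Nat.digit (b m i : ℕ) : ℕ := m / b ^ i % b

theorem Nat.digit_lt {b : ℕ} (hb : 0 < b) (m i : ℕ) : Nat.digit b m i < b := Nat.mod_lt _ hb

theorem Nat.exists_digit_eq {b k : ℕ} {f : ℕ → ℕ} (hf : ∀ i < k, f i < b) :
    ∃ m < b ^ k, ∀ i < k, Nat.digit b m i = f i := by
  let f' : Fin k → Fin b := fun i => ⟨f i, hf i i.2⟩
  refine ⟨finFunctionFinEquiv f', (finFunctionFinEquiv f').2, fun i hi => ?_⟩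
  have h : finFunctionFinEquiv.symm (finFunctionFinEquiv f') ⟨i, hi⟩ = f' ⟨i, hi⟩ := by simp
  exact congrArg Fin.val h

theorem Primrec.digit {α : Type*} [Primcodable α] {b m i : α → ℕ} (hb : Primrec b)
    (hm : Primrec m) (hi : Primrec i) : Primrec fun a => Nat.digit (b a) (m a) (i a) :=
  Primrec.nat_mod.comp (Primrec.nat_div.comp hm (Primrec.nat_pow hb hi)) hb

end Digits

namespace MonadicFO

open Function Formula RecData

variable {A : Type v} {X : Type*}

section Eval

/-- The number of the value of the variable `y` in the assignment with number `e`. Elements of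
finite labelled structures are numbers below `n * K`; the label of an element is its remainder
modulo `n`. -/
def eltAt (n K e y : ℕ) : ℕ := Nat.digit (n * K) e y

/-- `e` is the number of an assignment to the elements of the structure counted by `w`. -/
def ValidAt (n K w e : ℕ) : Prop :=
  ∀ y < K, eltAt n K e y / n < Nat.digit (K + 1) w (eltAt n K e y % n)

/-- The assignments differ at most in the variable `x`. -/
def AgreeAt (n K x e e' : ℕ) : Prop := ∀ y < K, y ≠ x → eltAt n K e' y = eltAt n K e y

/-- The value of `x` under `e'` is different from the other values under `e`. -/
def FreshAt (n K x e e' : ℕ) : Prop := ∀ y < K, y ≠ x → eltAt n K e y ≠ eltAt n K e' x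

section Primrec

variable {α : Type*} [Primcodable α] (n : ℕ) {K w x e e' y : α → ℕ}

theorem primrec_eltAt (hK : Primrec K) (he : Primrec e) (hy : Primrec y) :
    Primrec fun a => eltAt n (K a) (e a) (y a) :=
  Primrec.digit (Primrec.nat_mul.comp (Primrec.const n) hK) he hy

theorem primrecPred_validAt (hK : Primrec K) (hw : Primrec w) (he : Primrec e) :
    PrimrecPred fun a => ValidAt n (K a) (w a) (e a) := by
  have helt : Primrec fun b : α × ℕ => eltAt n (K b.1) (e b.1) b.2 :=
    primrec_eltAt n (hK.comp Primrec.fst) (he.comp Primrec.fst) Primrec.snd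
  exact PrimrecPred.forall_lt'
    (p := fun a y => eltAt n (K a) (e a) y / n <
      Nat.digit (K a + 1) (w a) (eltAt n (K a) (e a) y % n))
    (Primrec.nat_lt.comp (Primrec.nat_div.comp helt (Primrec.const n))
      (Primrec.digit (Primrec.succ.comp (hK.comp Primrec.fst)) (hw.comp Primrec.fst)
        (Primrec.nat_mod.comp helt (Primrec.const n)))) hK

theorem primrecPred_agreeAt (hK : Primrec K) (hx : Primrec x) (he : Primrec e)
    (he' : Primrec e') : PrimrecPred fun a => AgreeAt n (K a) (x a) (e a) (e' a) := by
  have hK' : Primrec fun b : α × ℕ => K b.1 := hK.comp Primrec.fst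
  exact PrimrecPred.forall_lt'
    (p := fun a y => y ≠ x a → eltAt n (K a) (e' a) y = eltAt n (K a) (e a) y)
    (PrimrecPred.imp (Primrec.eq.comp Primrec.snd (hx.comp Primrec.fst)).not
      (Primrec.eq.comp (primrec_eltAt n hK' (he'.comp Primrec.fst) Primrec.snd)
        (primrec_eltAt n hK' (he.comp Primrec.fst) Primrec.snd))) hK

theorem primrecPred_freshAt (hK : Primrec K) (hx : Primrec x) (he : Primrec e)
    (he' : Primrec e') : PrimrecPred fun a => FreshAt n (K a) (x a) (e a) (e' a) := by
  have hK' : Primrec fun b : α × ℕ => K b.1 := hK.comp Primrec.fst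
  exact PrimrecPred.forall_lt'
    (p := fun a y => y ≠ x a → eltAt n (K a) (e a) y ≠ eltAt n (K a) (e' a) (x a))
    (PrimrecPred.imp (Primrec.eq.comp Primrec.snd (hx.comp Primrec.fst)).not
      (Primrec.eq.comp (primrec_eltAt n hK' (he.comp Primrec.fst) Primrec.snd)
        (primrec_eltAt n hK' (he'.comp Primrec.fst) (hx.comp Primrec.fst))).not) hK

variable {l : α → List ℕ} (li : List ℕ)

theorem primrecPred_fresh_value (hK : Primrec K) (hx : Primrec x) (he : Primrec e)
    (he' : Primrec e') : PrimrecPred fun a =>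
      eltAt n (K a) (e' a) (x a) % n ∈ li ∧ FreshAt n (K a) (x a) (e a) (e' a) :=
  (PrimrecPred.mem_list (Primrec.nat_mod.comp (primrec_eltAt n hK he' hx) (Primrec.const n))
    (Primrec.const li)).and (primrecPred_freshAt n hK hx he he')

theorem primrecPred_exists_agreeAt (hK : Primrec K) (hx : Primrec x) (he : Primrec e)
    (hl : Primrec l) : PrimrecPred fun a => ∃ e' ∈ l a, AgreeAt n (K a) (x a) (e a) e' :=
  PrimrecPred.exists_mem_list' (p := fun a e' => AgreeAt n (K a) (x a) (e a) e')
    (primrecPred_agreeAt n (hK.comp Primrec.fst) (hx.comp Primrec.fst) (he.comp Primrec.fst)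
      Primrec.snd) hl

theorem primrecPred_exists_freshAt (hK : Primrec K) (hx : Primrec x) (he : Primrec e)
    (hl : Primrec l) : PrimrecPred fun a => ∃ e' ∈ l a, AgreeAt n (K a) (x a) (e a) e' ∧
      eltAt n (K a) e' (x a) % n ∈ li ∧ FreshAt n (K a) (x a) (e a) e' :=
  PrimrecPred.exists_mem_list' (p := fun a e' => AgreeAt n (K a) (x a) (e a) e' ∧
      eltAt n (K a) e' (x a) % n ∈ li ∧ FreshAt n (K a) (x a) (e a) e')
    ((primrecPred_agreeAt n (hK.comp Primrec.fst) (hx.comp Primrec.fst) (he.comp Primrec.fst)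
      Primrec.snd).and (primrecPred_fresh_value n li (hK.comp Primrec.fst)
        (hx.comp Primrec.fst) (he.comp Primrec.fst) Primrec.snd)) hl

theorem primrecPred_forall_agreeAt (hK : Primrec K) (hw : Primrec w) (hx : Primrec x)
    (he : Primrec e) (hl : Primrec l) : PrimrecPred fun a => ∀ e' < (n * K a) ^ K a,
      ValidAt n (K a) (w a) e' → AgreeAt n (K a) (x a) (e a) e' → e' ∈ l a :=
  PrimrecPred.forall_lt' (p := fun a e' => ValidAt n (K a) (w a) e' →
      AgreeAt n (K a) (x a) (e a) e' → e' ∈ l a)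
    ((primrecPred_validAt n (hK.comp Primrec.fst) (hw.comp Primrec.fst) Primrec.snd).imp
      ((primrecPred_agreeAt n (hK.comp Primrec.fst) (hx.comp Primrec.fst)
        (he.comp Primrec.fst) Primrec.snd).imp
          (PrimrecPred.mem_list Primrec.snd (hl.comp Primrec.fst))))
    (Primrec.nat_pow (Primrec.nat_mul.comp (Primrec.const n) hK) hK)

theorem primrecPred_forall_freshAt (hK : Primrec K) (hw : Primrec w) (hx : Primrec x)
    (he : Primrec e) (hl : Primrec l) : PrimrecPred fun a => ∀ e' < (n * K a) ^ K a,
      ValidAt n (K a) (w a) e' → AgreeAt n (K a) (x a) (e a) e' →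
      eltAt n (K a) e' (x a) % n ∈ li ∧ FreshAt n (K a) (x a) (e a) e' → e' ∈ l a :=
  PrimrecPred.forall_lt' (p := fun a e' => ValidAt n (K a) (w a) e' →
      AgreeAt n (K a) (x a) (e a) e' →
      eltAt n (K a) e' (x a) % n ∈ li ∧ FreshAt n (K a) (x a) (e a) e' → e' ∈ l a)
    ((primrecPred_validAt n (hK.comp Primrec.fst) (hw.comp Primrec.fst) Primrec.snd).imp
      ((primrecPred_agreeAt n (hK.comp Primrec.fst) (hx.comp Primrec.fst)
        (he.comp Primrec.fst) Primrec.snd).imp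
          ((primrecPred_fresh_value n li (hK.comp Primrec.fst)
            (hx.comp Primrec.fst) (he.comp Primrec.fst) Primrec.snd).imp
              (PrimrecPred.mem_list Primrec.snd (hl.comp Primrec.fst)))))
    (Primrec.nat_pow (Primrec.nat_mul.comp (Primrec.const n) hK) hK)

end Primrec

/-- The recursion step for the truth of formulas in finite labelled structures. The parameter is
the pair of `K` and the number of the counting function; `lm` lists the pairs of a predicate
and a label that has it, and `li` the labels of infinitely many elements. -/
def EvalStep (n : ℕ) (lm : List (ℕ × ℕ)) (li : List ℕ) (x : RecData (ℕ × ℕ)) : Prop :=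
  -- Values contain only valid assignments, so validity of `e'` has to be required only in the
  -- universal clauses.
  ValidAt n x.1.1 x.1.2 x.2.2.2 ∧
  (x.2.1.1 = 0 ∨
  (x.2.1.1 = 2 ∧ (x.2.1.2.1, eltAt n x.1.1 x.2.2.2 x.2.1.2.2 % n) ∈ lm) ∨
  (x.2.1.1 = 3 ∧ (x.2.1.2.1, eltAt n x.1.1 x.2.2.2 x.2.1.2.2 % n) ∉ lm) ∨
  (x.2.1.1 = 4 ∧ eltAt n x.1.1 x.2.2.2 x.2.1.2.1 = eltAt n x.1.1 x.2.2.2 x.2.1.2.2) ∨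
  (x.2.1.1 = 5 ∧ eltAt n x.1.1 x.2.2.2 x.2.1.2.1 ≠ eltAt n x.1.1 x.2.2.2 x.2.1.2.2) ∨
  (x.2.1.1 = 6 ∧ (x.2.2.2 ∈ x.2.2.1.1 ∨ x.2.2.2 ∈ x.2.2.1.2)) ∨
  (x.2.1.1 = 7 ∧ x.2.2.2 ∈ x.2.2.1.1 ∧ x.2.2.2 ∈ x.2.2.1.2) ∨
  (x.2.1.1 = 8 ∧ ∃ e' ∈ x.2.2.1.2, AgreeAt n x.1.1 x.2.1.2.1 x.2.2.2 e') ∨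
  (x.2.1.1 = 9 ∧ ∀ e' < (n * x.1.1) ^ x.1.1, ValidAt n x.1.1 x.1.2 e' →
    AgreeAt n x.1.1 x.2.1.2.1 x.2.2.2 e' → e' ∈ x.2.2.1.2) ∨
  (x.2.1.1 = 10 ∧ ∃ e' ∈ x.2.2.1.2, AgreeAt n x.1.1 x.2.1.2.1 x.2.2.2 e' ∧
    eltAt n x.1.1 e' x.2.1.2.1 % n ∈ li ∧ FreshAt n x.1.1 x.2.1.2.1 x.2.2.2 e') ∨
  (x.2.1.1 = 11 ∧ ∀ e' < (n * x.1.1) ^ x.1.1, ValidAt n x.1.1 x.1.2 e' →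
    AgreeAt n x.1.1 x.2.1.2.1 x.2.2.2 e' → eltAt n x.1.1 e' x.2.1.2.1 % n ∈ li ∧
    FreshAt n x.1.1 x.2.1.2.1 x.2.2.2 e' → e' ∈ x.2.2.1.2))

theorem primrecPred_evalStep (n : ℕ) (lm : List (ℕ × ℕ)) (li : List ℕ) :
    PrimrecPred (EvalStep n lm li) := by
  have hK : Primrec fun x : RecData (ℕ × ℕ) => x.1.1 := Primrec.fst.comp primrec_param
  have hw : Primrec fun x : RecData (ℕ × ℕ) => x.1.2 := Primrec.snd.comp primrec_param
  have htag : ∀ t, PrimrecPred fun x : RecData (ℕ × ℕ) => x.2.1.1 = t := primrecPred_tag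
  have hp : Primrec fun x : RecData (ℕ × ℕ) => x.2.1.2.1 := primrec_arg₁
  have hq : Primrec fun x : RecData (ℕ × ℕ) => x.2.1.2.2 := primrec_arg₂
  have he : Primrec fun x : RecData (ℕ × ℕ) => x.2.2.2 := primrec_elem
  have hl₁ : Primrec fun x : RecData (ℕ × ℕ) => x.2.2.1.1 := primrec_val₁
  have hl₂ : Primrec fun x : RecData (ℕ × ℕ) => x.2.2.1.2 := primrec_val₂
  have hatom : PrimrecPred fun x : RecData (ℕ × ℕ) =>
      (x.2.1.2.1, eltAt n x.1.1 x.2.2.2 x.2.1.2.2 % n) ∈ lm :=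
    .mem_list (hp.pair (Primrec.nat_mod.comp (primrec_eltAt n hK he hq) (Primrec.const n)))
      (Primrec.const lm)
  have heq : PrimrecPred fun x : RecData (ℕ × ℕ) =>
      eltAt n x.1.1 x.2.2.2 x.2.1.2.1 = eltAt n x.1.1 x.2.2.2 x.2.1.2.2 :=
    Primrec.eq.comp (primrec_eltAt n hK he hp) (primrec_eltAt n hK he hq)
  have hmem₁ := PrimrecPred.mem_list he hl₁
  have hmem₂ := PrimrecPred.mem_list he hl₂
  exact (primrecPred_validAt n hK hw he).and <|
    (htag 0).or <|
    ((htag 2).and hatom).or <|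
    ((htag 3).and hatom.not).or <|
    ((htag 4).and heq).or <|
    ((htag 5).and heq.not).or <|
    ((htag 6).and (hmem₁.or hmem₂)).or <|
    ((htag 7).and (hmem₁.and hmem₂)).or <|
    ((htag 8).and (primrecPred_exists_agreeAt n hK hp he hl₂)).or <|
    ((htag 9).and (primrecPred_forall_agreeAt n hK hw hp he hl₂)).or <|
    ((htag 10).and (primrecPred_exists_freshAt n li hK hp he hl₂)).or <|
    (htag 11).and (primrecPred_forall_freshAt n li hK hw hp he hl₂)

variable {n K wc : ℕ} (ε : X ≃ Fin n)

/-- The counting function with number `wc`. -/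
def countOf (K wc : ℕ) (c : X) : ℕ := Nat.digit (K + 1) wc (ε c)

theorem countOf_le (c : X) : countOf ε K wc c ≤ K :=
  Nat.lt_succ_iff.1 (Nat.digit_lt K.succ_pos _ _)

theorem exists_countOf_eq {w : X → ℕ} (hw : ∀ c, w c ≤ K) :
    ∃ wc < (K + 1) ^ n, countOf ε K wc = w := by
  obtain ⟨m, hm, hd⟩ := Nat.exists_digit_eq (b := K + 1) (k := n)
    (f := fun i => if h : i < n then w (ε.symm ⟨i, h⟩) else 0) (fun i hi => by
      simpa [hi] using Nat.lt_succ_of_le (hw _))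
  refine ⟨m, hm, funext fun c => ?_⟩
  rw [countOf, hd _ (ε c).2]
  simp

/-- The number of an element of a finite labelled structure. -/
def eltNum (z : Σ c, Fin (countOf ε K wc c)) : ℕ := n * z.2 + ε z.1

theorem eltNum_mod (z : Σ c, Fin (countOf ε K wc c)) : eltNum ε z % n = ε z.1 := by
  rw [eltNum, Nat.mul_add_mod, Nat.mod_eq_of_lt (ε z.1).2]

theorem eltNum_div (z : Σ c, Fin (countOf ε K wc c)) : eltNum ε z / n = z.2 := by
  have hn : 0 < n := (ε z.1).pos
  rw [eltNum, Nat.mul_add_div hn, Nat.div_eq_of_lt (ε z.1).2, add_zero]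

theorem eltNum_lt (z : Σ c, Fin (countOf ε K wc c)) : eltNum ε z < n * K := by
  have h : (z.2 : ℕ) + 1 ≤ K := z.2.2.trans_le (countOf_le ε _)
  calc eltNum ε z < n * z.2 + n := Nat.add_lt_add_left (ε z.1).2 _
    _ = n * (z.2 + 1) := by ring
    _ ≤ n * K := Nat.mul_le_mul_left n h

theorem eltNum_injective : Injective (eltNum ε (K := K) (wc := wc)) := by
  rintro ⟨c, i⟩ ⟨c', i'⟩ h
  have h₁ := eltNum_mod ε ⟨c, i⟩
  have h₂ := eltNum_div ε ⟨c, i⟩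
  rw [h] at h₁ h₂
  rw [eltNum_mod] at h₁
  rw [eltNum_div] at h₂
  obtain rfl : c' = c := ε.injective (Fin.ext h₁)
  obtain rfl : i' = i := Fin.ext h₂
  rfl

theorem eltNum_valid (z : Σ c, Fin (countOf ε K wc c)) :
    eltNum ε z / n < Nat.digit (K + 1) wc (eltNum ε z % n) := by
  rw [eltNum_mod, eltNum_div]
  exact z.2.2

theorem exists_eltNum_eq (hn : 0 < n) {d : ℕ}
    (hd : d / n < Nat.digit (K + 1) wc (d % n)) :
    ∃ z : Σ c, Fin (countOf ε K wc c), eltNum ε z = d := by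
  refine ⟨⟨ε.symm ⟨d % n, Nat.mod_lt _ hn⟩, ⟨d / n, by simpa [countOf] using hd⟩⟩, ?_⟩
  simp [eltNum, Nat.div_add_mod]

theorem exists_assignment (g : ℕ → Σ c, Fin (countOf ε K wc c)) :
    ∃ e < (n * K) ^ K, ∀ y < K, eltAt n K e y = eltNum ε (g y) :=
  Nat.exists_digit_eq fun y _ => eltNum_lt ε (g y)

theorem validAt_of_eq {e : ℕ} {g : ℕ → Σ c, Fin (countOf ε K wc c)}
    (h : ∀ y < K, eltAt n K e y = eltNum ε (g y)) : ValidAt n K wc e := fun y hy => by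
  rw [h y hy]
  exact eltNum_valid ε (g y)

variable {e : ℕ} {g : ℕ → Σ c, Fin (countOf ε K wc c)}

theorem exists_update_of_agreeAt (hn : 0 < n) {x e' : ℕ} (hx : x < K)
    (hg : ∀ y < K, eltAt n K e y = eltNum ε (g y)) (hv : ValidAt n K wc e')
    (ha : AgreeAt n K x e e') : ∃ z, ∀ y < K, eltAt n K e' y = eltNum ε (update g x z y) := by
  obtain ⟨z, hz⟩ := exists_eltNum_eq ε hn (hv x hx)
  refine ⟨z, fun y hy => ?_⟩
  rcases eq_or_ne y x with rfl | hne
  · simpa using hz.symm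
  · rw [ha y hy hne, hg y hy, update_of_ne hne]

theorem agreeAt_of_update {x e' : ℕ} {z : Σ c, Fin (countOf ε K wc c)}
    (hg : ∀ y < K, eltAt n K e y = eltNum ε (g y))
    (hg' : ∀ y < K, eltAt n K e' y = eltNum ε (update g x z y)) : AgreeAt n K x e e' := by
  intro y hy hne
  rw [hg' y hy, hg y hy, update_of_ne hne]

theorem freshAt_iff {x e' : ℕ} {z : Σ c, Fin (countOf ε K wc c)} (hx : x < K)
    (hg : ∀ y < K, eltAt n K e y = eltNum ε (g y))
    (hg' : ∀ y < K, eltAt n K e' y = eltNum ε (update g x z y)) :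
    FreshAt n K x e e' ↔ IsFresh K x g z := by
  refine forall_congr' fun y => forall_congr' fun hy => forall_congr' fun _ => ?_
  rw [hg y hy, hg' x hx, update_self, (eltNum_injective ε).ne_iff]

variable [Encodable A]

/-- The value at a code is the set of numbers of satisfying assignments. Only variables below `K`
are recorded, which is enough by `hφ`; a change of one digit corresponds to an update at that
variable. -/
theorem mem_eval_iff (hn : 0 < n) {π : X → Set A} {I : Set X} {lm : List (ℕ × ℕ)}
    {li : List ℕ} (hlm : ∀ a c, (Encodable.encode a, (ε c : ℕ)) ∈ lm ↔ a ∈ π c)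
    (hli : ∀ c, (ε c : ℕ) ∈ li ↔ c ∈ I) {F : ℕ × ℕ → ℕ → List ℕ}
    (hF : ∀ a t p q m, m = Nat.pair t (Nat.pair p q) → ∀ e,
      e ∈ F a m ↔ e < (n * a.1) ^ a.1 ∧ EvalStep n lm li (a, (t, p, q),
        (if p < m then F a p else [], if q < m then F a q else []), e))
    {φ : Formula A} (hφ : φ.VarsLT K) {e : ℕ} (he : e < (n * K) ^ K)
    {g : ℕ → Σ c, Fin (countOf ε K wc c)} (hg : ∀ y < K, eltAt n K e y = eltNum ε (g y)) :
    e ∈ F (K, wc) φ.code ↔ FreshRealize π I K Sigma.fst φ g := by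
  have hF' : ∀ m e, e ∈ F (K, wc) m → e < (n * K) ^ K ∧ ValidAt n K wc e := by
    intro m e h
    have := (hF (K, wc) m.unpair.1 m.unpair.2.unpair.1 m.unpair.2.unpair.2 m (by simp) e).1 h
    exact ⟨this.1, this.2.1⟩
  induction φ generalizing e g with
  | top =>
    refine (hF (K, wc) 0 0 0 _ rfl e).trans ?_
    simp [EvalStep, FreshRealize, he, validAt_of_eq ε hg]
  | bot =>
    refine (hF (K, wc) 1 0 0 _ rfl e).trans ?_
    simp [EvalStep, FreshRealize]
  | pos a x | neg a x =>
    refine (hF (K, wc) _ _ _ _ rfl e).trans ?_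
    simp [EvalStep, FreshRealize, he, validAt_of_eq ε hg, hg x hφ, eltNum_mod, hlm]
  | eq x y | ne x y =>
    refine (hF (K, wc) _ _ _ _ rfl e).trans ?_
    simp [EvalStep, FreshRealize, he, validAt_of_eq ε hg, hg x hφ.1, hg y hφ.2,
      (eltNum_injective ε).eq_iff]
  | or φ ψ ih₁ ih₂ | and φ ψ ih₁ ih₂ =>
    refine (hF (K, wc) _ _ _ _ rfl e).trans ?_
    simp [EvalStep, FreshRealize, he, validAt_of_eq ε hg, Nat.left_lt_pair_pair,
      Nat.right_lt_pair_pair, ih₁ hφ.1 he hg, ih₂ hφ.2 he hg]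
  | ex x φ ih =>
    refine (hF (K, wc) _ _ _ _ rfl e).trans ?_
    simp only [EvalStep, FreshRealize, he, validAt_of_eq ε hg, Nat.right_lt_pair_pair,
      Nat.zero_lt_succ, if_true, true_and]
    norm_num
    constructor
    · rintro ⟨e', he', ha⟩
      obtain ⟨hlt, hv⟩ := hF' _ _ he'
      obtain ⟨z, hz⟩ := exists_update_of_agreeAt ε hn hφ.1 hg hv ha
      exact ⟨z.1, z.2, (ih hφ.2 hlt hz).1 he'⟩
    · rintro ⟨c, i, hz⟩
      obtain ⟨e', hlt, he'⟩ := exists_assignment ε (update g x ⟨c, i⟩)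
      exact ⟨e', (ih hφ.2 hlt he').2 hz, agreeAt_of_update ε hg he'⟩
  | all x φ ih =>
    refine (hF (K, wc) _ _ _ _ rfl e).trans ?_
    simp only [EvalStep, FreshRealize, he, validAt_of_eq ε hg, Nat.right_lt_pair_pair,
      Nat.zero_lt_succ, if_true, true_and]
    norm_num
    constructor
    · intro h z
      obtain ⟨e', hlt, he'⟩ := exists_assignment ε (update g x z)
      exact (ih hφ.2 hlt he').1 (h e' hlt (validAt_of_eq ε he') (agreeAt_of_update ε hg he'))
    · intro h e' hlt hv ha
      obtain ⟨z, hz⟩ := exists_update_of_agreeAt ε hn hφ.1 hg hv ha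
      exact (ih hφ.2 hlt hz).2 (h z)
  | exInf x φ ih =>
    refine (hF (K, wc) _ _ _ _ rfl e).trans ?_
    simp only [EvalStep, FreshRealize, he, validAt_of_eq ε hg, Nat.right_lt_pair_pair,
      Nat.zero_lt_succ, if_true, true_and]
    norm_num
    constructor
    · rintro ⟨e', he', ha, hi, hf⟩
      obtain ⟨hlt, hv⟩ := hF' _ _ he'
      obtain ⟨z, hz⟩ := exists_update_of_agreeAt ε hn hφ.1 hg hv ha
      rw [hz x hφ.1, update_self, eltNum_mod, hli] at hi
      exact ⟨z.1, hi, z.2, (freshAt_iff ε hφ.1 hg hz).1 hf, (ih hφ.2 hlt hz).1 he'⟩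
    · rintro ⟨c, hi, i, hf, hz⟩
      obtain ⟨e', hlt, he'⟩ := exists_assignment ε (update g x ⟨c, i⟩)
      refine ⟨e', (ih hφ.2 hlt he').2 hz, agreeAt_of_update ε hg he', ?_,
        (freshAt_iff ε hφ.1 hg he').2 hf⟩
      rw [he' x hφ.1, update_self, eltNum_mod, hli]
      exact hi
  | allInf x φ ih =>
    refine (hF (K, wc) _ _ _ _ rfl e).trans ?_
    simp only [EvalStep, FreshRealize, he, validAt_of_eq ε hg, Nat.right_lt_pair_pair,
      Nat.zero_lt_succ, if_true, true_and]
    norm_num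
    constructor
    · intro h z hi hf
      obtain ⟨e', hlt, he'⟩ := exists_assignment ε (update g x z)
      refine (ih hφ.2 hlt he').1 (h e' hlt (validAt_of_eq ε he') (agreeAt_of_update ε hg he') ?_
        ((freshAt_iff ε hφ.1 hg he').2 hf))
      rw [he' x hφ.1, update_self, eltNum_mod, hli]
      exact hi
    · intro h e' hlt hv ha hi hf
      obtain ⟨z, hz⟩ := exists_update_of_agreeAt ε hn hφ.1 hg hv ha
      rw [hz x hφ.1, update_self, eltNum_mod, hli] at hi
      exact (ih hφ.2 hlt hz).2 (h z hi ((freshAt_iff ε hφ.1 hg hz).1 hf))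

/-- Truth in finite labelled structures is primitive recursive. -/
theorem exists_primrecPred_countTrue [Finite A] [Finite X] (hn : 0 < n) (π : X → Set A)
    (I : Set X) : ∃ P : ℕ → ℕ → ℕ → Prop,
      (PrimrecPred fun x : ℕ × ℕ × ℕ => P x.1 x.2.1 x.2.2) ∧
      ∀ K wc (φ : Formula A), 0 < K → φ.VarsLT K →
        (P K wc φ.code ↔ CountTrue π I K (countOf ε K wc) φ) := by
  let lm : List (ℕ × ℕ) := ((Set.toFinite {p : A × X | p.1 ∈ π p.2}).image
    fun p => (Encodable.encode p.1, (ε p.2 : ℕ))).toFinset.toList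
  let li : List ℕ := ((Set.toFinite I).image fun c => (ε c : ℕ)).toFinset.toList
  have hlm : ∀ a c, (Encodable.encode a, (ε c : ℕ)) ∈ lm ↔ a ∈ π c := by
    intro a c
    simp only [lm, Finset.mem_toList, Set.Finite.mem_toFinset, Set.mem_image, Set.mem_ofPred_eq,
      Prod.exists, Prod.mk.injEq, Encodable.encode_inj, Fin.val_inj, EmbeddingLike.apply_eq_iff_eq]
    exact ⟨fun ⟨a', c', h, ha, hc⟩ => ha ▸ hc ▸ h, fun h => ⟨a, c, h, rfl, rfl⟩⟩
  have hli : ∀ c, (ε c : ℕ) ∈ li ↔ c ∈ I := by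
    intro c
    simp [li, Fin.val_inj]
  have hE : Primrec fun a : ℕ × ℕ => (n * a.1) ^ a.1 :=
    Primrec.nat_pow (Primrec.nat_mul.comp (Primrec.const n) Primrec.fst) Primrec.fst
  obtain ⟨F, hF, hspec⟩ := exists_primrec_pair_rec hE (primrecPred_evalStep n lm li)
  -- The number `e` must code a constant assignment, as in `CountTrue`; `0 < K` ensures that digit
  -- `0` is a valid element.
  refine ⟨fun K wc m => ∃ e ∈ F (K, wc) m, ∀ y < K, eltAt n K e y = eltAt n K e 0, ?_,
    fun K wc φ hK hφ => ?_⟩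
  · refine PrimrecPred.exists_mem_list'
      (p := fun (x : ℕ × ℕ × ℕ) e => ∀ y < x.1, eltAt n x.1 e y = eltAt n x.1 e 0)
      (PrimrecPred.forall_lt'
        (p := fun (b : (ℕ × ℕ × ℕ) × ℕ) y => eltAt n b.1.1 b.2 y = eltAt n b.1.1 b.2 0)
        ?_ (Primrec.fst.comp Primrec.fst))
      (hF.comp (Primrec.fst.pair (Primrec.fst.comp Primrec.snd))
        (Primrec.snd.comp Primrec.snd))
    have hK : Primrec fun c : ((ℕ × ℕ × ℕ) × ℕ) × ℕ => c.1.1.1 :=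
      Primrec.fst.comp (Primrec.fst.comp Primrec.fst)
    have he : Primrec fun c : ((ℕ × ℕ × ℕ) × ℕ) × ℕ => c.1.2 :=
      Primrec.snd.comp Primrec.fst
    exact Primrec.eq.comp (primrec_eltAt n hK he Primrec.snd)
      (primrec_eltAt n hK he (Primrec.const 0))
  · constructor
    · rintro ⟨e, he, hconst⟩
      have h := (hspec (K, wc) φ.code.unpair.1 φ.code.unpair.2.unpair.1
        φ.code.unpair.2.unpair.2 _ (by simp) e).1 he
      obtain ⟨z, hz⟩ := exists_eltNum_eq ε hn (h.2.1 0 hK)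
      refine ⟨z, (mem_eval_iff ε hn hlm hli hspec hφ h.1 fun y hy => ?_).1 he⟩
      rw [hconst y hy, hz]
    · rintro ⟨z, hz⟩
      obtain ⟨e, hlt, he⟩ := exists_assignment ε fun _ => z
      refine ⟨e, (mem_eval_iff ε hn hlm hli hspec hφ hlt he).2 hz, fun y hy => ?_⟩
      rw [he y hy, he 0 hK]

end Eval

end MonadicFO

/-! ### Decision procedures and the search for a normal form. -/

namespace MonadicFO

open Formula

section Decision

variable {A : Type v} {X : Type*} {α : Type*} [Primcodable α] {n : ℕ} {K wc : α → ℕ}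

theorem primrec_countOf (ε : X ≃ Fin n) (hK : Primrec K) (hwc : Primrec wc) (c : X) :
    Primrec fun a => countOf ε (K a) (wc a) c :=
  Primrec.digit (Primrec.succ.comp hK) hwc (Primrec.const _)

theorem primrecPred_isCount [Finite X] (ε : X ≃ Fin n) (I : Set X) (hK : Primrec K)
    (hwc : Primrec wc) : PrimrecPred fun a => IsCount (K a) I (countOf ε (K a) (wc a)) :=
  PrimrecPred.forall_finite
    (p := fun c a => countOf ε (K a) (wc a) c ≤ K a ∧
      (c ∈ I → countOf ε (K a) (wc a) c = 0 ∨ countOf ε (K a) (wc a) c = K a)) fun c =>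
    have h := primrec_countOf ε hK hwc c
    (Primrec.nat_le.comp h hK).and
      ((PrimrecPred.of_const _).imp ((Primrec.eq.comp h (Primrec.const 0)).or
        (Primrec.eq.comp h hK)))

theorem primrecPred_forall_countOf_pos [Finite X] (ε : X ≃ Fin n) (p : X → Prop)
    (hK : Primrec K) (hwc : Primrec wc) :
    PrimrecPred fun a => ∀ c, 0 < countOf ε (K a) (wc a) c → p c :=
  PrimrecPred.forall_finite (p := fun c a => 0 < countOf ε (K a) (wc a) c → p c) fun c =>
    (Primrec.nat_lt.comp (Primrec.const 0) (primrec_countOf ε hK hwc c)).imp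
      (PrimrecPred.of_const _)

theorem top_mem_contSentences (L : MLogic) (B : Set A) : top ∈ ContSentences L B :=
  ⟨.free _ (by cases L <;> trivial) trivial, rfl⟩

variable [Finite A]

theorem primrecPred_largePart (ε : PairLabel A ≃ Fin n) (B : Set A) (hK : Primrec K)
    (hwc : Primrec wc) : PrimrecPred fun a => LargePart B (K a) (countOf ε (K a) (wc a)) :=
  PrimrecPred.forall_finite
    (p := fun (c : PairLabel A) a => 0 < countOf ε (K a) (wc a) c →
      ColourLE B (firstColour c) (secondColour c) ∧ (firstColour c = secondColour c ∨
        c.2 = true ∧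
          countOf ε (K a) (wc a) ((secondColour c, secondColour c), false) = K a)) fun c =>
    (Primrec.nat_lt.comp (Primrec.const 0) (primrec_countOf ε hK hwc c)).imp
      ((PrimrecPred.of_const _).and ((PrimrecPred.of_const _).or ((PrimrecPred.of_const _).and
        (Primrec.eq.comp (primrec_countOf ε hK hwc _) hK))))

/-- A property holds for all counting functions iff it holds for those with small numbers. -/
theorem forall_isCount_iff [Finite X] (ε : X ≃ Fin n) {K : ℕ} {I : Set X}
    {p : (X → ℕ) → Prop} : (∀ w, IsCount K I w → p w) ↔
      ∀ k < (K + 1) ^ n, IsCount K I (countOf ε K k) → p (countOf ε K k) := by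
  refine ⟨fun h k _ => h _, fun h w hw => ?_⟩
  obtain ⟨k, hk, rfl⟩ := exists_countOf_eq ε fun c => (hw c).1
  exact h k hk hw

variable [Encodable A]

/-- Continuity of a sentence can be read off primitive recursively from its code. -/
theorem exists_primrecPred_continuousIn (B : Set A) :
    ∃ P : ℕ → Prop, PrimrecPred P ∧
      ∀ φ : Formula A, φ.IsSentence → (P φ.code ↔ ContinuousIn.{u} B φ) := by
  obtain ⟨n, ⟨ε⟩⟩ := Finite.exists_equiv_fin (PairLabel A)
  have hn : 0 < n := (ε ((∅, ∅), false)).pos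
  obtain ⟨T₁, hT₁, h₁⟩ := exists_primrecPred_countTrue ε hn firstColour (infLabels _)
  obtain ⟨T₂, hT₂, h₂⟩ := exists_primrecPred_countTrue ε hn secondColour (infLabels _)
  -- The criterion with `K = m + 1`, a bound for the variables; counting functions are `n`-digit
  -- numbers in base `K + 1`.
  refine ⟨fun m => ∀ k < (m + 1 + 1) ^ n, IsCount (m + 1) (infLabels _) (countOf ε (m + 1) k) →
    ((∀ c, 0 < countOf ε (m + 1) k c → ColourLE B (firstColour c) (secondColour c)) →
      T₁ (m + 1) k m → T₂ (m + 1) k m) ∧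
    (LargePart B (m + 1) (countOf ε (m + 1) k) → T₂ (m + 1) k m → T₁ (m + 1) k m),
    ?_, fun φ hs => ?_⟩
  · have hm : Primrec fun x : ℕ × ℕ => x.1 := Primrec.fst
    have hK : Primrec fun x : ℕ × ℕ => x.1 + 1 := Primrec.succ.comp hm
    have hk : Primrec fun x : ℕ × ℕ => x.2 := Primrec.snd
    have hT₁' : PrimrecPred fun x : ℕ × ℕ => T₁ (x.1 + 1) x.2 x.1 := hT₁.comp (hK.pair (hk.pair hm))
    have hT₂' : PrimrecPred fun x : ℕ × ℕ => T₂ (x.1 + 1) x.2 x.1 := hT₂.comp (hK.pair (hk.pair hm))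
    exact PrimrecPred.forall_lt'
      (p := fun m k => IsCount (m + 1) (infLabels _) (countOf ε (m + 1) k) →
        ((∀ c, 0 < countOf ε (m + 1) k c → ColourLE B (firstColour c) (secondColour c)) →
          T₁ (m + 1) k m → T₂ (m + 1) k m) ∧
        (LargePart B (m + 1) (countOf ε (m + 1) k) → T₂ (m + 1) k m → T₁ (m + 1) k m))
      ((primrecPred_isCount ε _ hK hk).imp
        (((primrecPred_forall_countOf_pos ε _ hK hk).imp (hT₁'.imp hT₂')).and
          ((primrecPred_largePart ε B hK hk).imp (hT₂'.imp hT₁'))))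
      (Primrec.nat_pow (Primrec.succ.comp Primrec.succ) (Primrec.const n))
  · rw [continuousIn_iff_forall_count (Nat.succ_pos φ.code) hs (varsLT_code φ),
      forall_isCount_iff ε]
    simp only [h₁ _ _ φ (Nat.succ_pos _) (varsLT_code φ), h₂ _ _ φ (Nat.succ_pos _) (varsLT_code φ)]
    rfl

/-- Equivalence of sentences can be read off primitive recursively from their codes. -/
theorem exists_primrecRel_equivalent :
    ∃ P : ℕ → ℕ → Prop, PrimrecRel P ∧ ∀ φ ψ : Formula A, φ.IsSentence → ψ.IsSentence →
      (P φ.code ψ.code ↔ Equivalent.{u} φ ψ) := by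
  obtain ⟨n, ⟨ε⟩⟩ := Finite.exists_equiv_fin (PairLabel A)
  have hn : 0 < n := (ε ((∅, ∅), false)).pos
  obtain ⟨T, hT, h⟩ := exists_primrecPred_countTrue ε hn firstColour (infLabels _)
  obtain ⟨E, hE, hEspec⟩ := exists_primrecPred_trueOnEmpty (A := A)
  -- The number `m + m' + 1` bounds the variables of both sentences.
  refine ⟨fun m m' => (E m ↔ E m') ∧ ∀ k < (m + m' + 1 + 1) ^ n,
    IsCount (m + m' + 1) (infLabels _) (countOf ε (m + m' + 1) k) →
      (T (m + m' + 1) k m ↔ T (m + m' + 1) k m'), ?_, fun φ ψ hs hs' => ?_⟩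
  · have hm : Primrec fun x : (ℕ × ℕ) × ℕ => x.1.1 := Primrec.fst.comp Primrec.fst
    have hm' : Primrec fun x : (ℕ × ℕ) × ℕ => x.1.2 := Primrec.snd.comp Primrec.fst
    have hadd : Primrec fun x : ℕ × ℕ => x.1 + x.2 + 1 :=
      Primrec.succ.comp (Primrec.nat_add.comp Primrec.fst Primrec.snd)
    have hK : Primrec fun x : (ℕ × ℕ) × ℕ => x.1.1 + x.1.2 + 1 := hadd.comp Primrec.fst
    have hk : Primrec fun x : (ℕ × ℕ) × ℕ => x.2 := Primrec.snd
    have hl : PrimrecPred fun x : (ℕ × ℕ) × ℕ => T (x.1.1 + x.1.2 + 1) x.2 x.1.1 :=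
      hT.comp (hK.pair (hk.pair hm))
    have hr : PrimrecPred fun x : (ℕ × ℕ) × ℕ => T (x.1.1 + x.1.2 + 1) x.2 x.1.2 :=
      hT.comp (hK.pair (hk.pair hm'))
    exact ((hE.comp Primrec.fst).iff (hE.comp Primrec.snd)).and <| PrimrecPred.forall_lt'
      (p := fun (x : ℕ × ℕ) k =>
        IsCount (x.1 + x.2 + 1) (infLabels _) (countOf ε (x.1 + x.2 + 1) k) →
          (T (x.1 + x.2 + 1) k x.1 ↔ T (x.1 + x.2 + 1) k x.2))
      ((primrecPred_isCount ε _ hK hk).imp (hl.iff hr))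
      (Primrec.nat_pow (Primrec.succ.comp hadd) (Primrec.const n))
  · have hφ : φ.VarsLT (φ.code + ψ.code + 1) := (varsLT_code φ).mono (by omega)
    have hψ : ψ.VarsLT (φ.code + ψ.code + 1) := (varsLT_code ψ).mono (by omega)
    rw [equivalent_iff hs hs', forall_realize_iff (Nat.succ_pos _) hs hs' hφ hψ,
      forall_isCount_iff ε]
    simp only [hEspec, h _ _ φ (Nat.succ_pos _) hφ, h _ _ ψ (Nat.succ_pos _) hψ]
    rfl

theorem exists_primrecPred_sentences (L : MLogic) :
    ∃ P : ℕ → Prop, PrimrecPred P ∧ ∀ m, P m ↔ ∃ φ ∈ Sentences L A, φ.code = m := by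
  -- For `B = ∅` the predicate recognises the codes of all formulas of the logic.
  obtain ⟨P, hP, h⟩ := exists_primrecPred_avoids L (∅ : Set A)
  obtain ⟨S, hS, hS'⟩ := exists_primrecPred_isSentence (A := A)
  refine ⟨fun m => P m ∧ S m, hP.and hS, fun m => ?_⟩
  have havoids : ∀ φ : Formula A, φ.Avoids ∅ := fun φ => by
    induction φ <;> simp_all [Avoids]
  refine (and_congr_left' (h m)).trans ?_
  constructor
  · rintro ⟨⟨φ, rfl, hL, -⟩, hs⟩
    exact ⟨φ, ⟨hL, (hS' φ).1 hs⟩, rfl⟩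
  · rintro ⟨φ, ⟨hL, hs⟩, rfl⟩
    exact ⟨⟨φ, rfl, hL, havoids φ⟩, (hS' φ).2 hs⟩

theorem exists_primrecPred_contSentences (L : MLogic) (B : Set A) :
    ∃ P : ℕ → Prop, PrimrecPred P ∧ ∀ m, P m ↔ ∃ φ ∈ ContSentences L B, φ.code = m := by
  obtain ⟨P, hP, h⟩ := exists_primrecPred_synContinuous L B
  obtain ⟨S, hS, hS'⟩ := exists_primrecPred_isSentence (A := A)
  refine ⟨fun m => P m ∧ S m, hP.and hS, fun m => ?_⟩
  refine (and_congr_left' (h m)).trans ?_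
  constructor
  · rintro ⟨⟨φ, rfl, hφ⟩, hs⟩
    exact ⟨φ, ⟨hφ, (hS' φ).1 hs⟩, rfl⟩
  · rintro ⟨φ, ⟨hφ, hs⟩, rfl⟩
    exact ⟨⟨φ, rfl, hφ⟩, (hS' φ).2 hs⟩

/-- Some computable function sends the codes of the continuous sentences of a logic to codes of
equivalent syntactically continuous sentences, and those of all sentences of the logic to codes
of syntactically continuous sentences. -/
theorem exists_computable_normalForm (L : MLogic) (B : Set A) :
    ∃ f : ℕ → ℕ, Computable f ∧ ∀ φ ∈ Sentences L A, ∃ χ ∈ ContSentences L B,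
      χ.code = f φ.code ∧ (ContinuousIn.{u} B φ → Equivalent.{u} φ χ) := by
  obtain ⟨S, hS, hSspec⟩ := exists_primrecPred_sentences (A := A) L
  obtain ⟨C, hC, hCspec⟩ := exists_primrecPred_contSentences L B
  obtain ⟨P, hP, hPspec⟩ := exists_primrecPred_continuousIn.{u} B
  obtain ⟨E, hE, hEspec⟩ := exists_primrecRel_equivalent.{u} (A := A)
  -- Equivalence is demanded only for codes of continuous sentences, so that the search terminates
  -- on every input.
  have hex : ∀ m, ∃ c, C c ∧ (S m ∧ P m → E m c) := by
    intro m
    by_cases hm : S m ∧ P m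
    · obtain ⟨φ, hφ, rfl⟩ := (hSspec m).1 hm.1
      obtain ⟨χ, hχ, he⟩ := (continuousIn_iff_exists_equivalent hφ).1 ((hPspec φ hφ.2).1 hm.2)
      exact ⟨χ.code, (hCspec _).2 ⟨χ, hχ, rfl⟩, fun _ => (hEspec φ χ hφ.2 hχ.2).2 he⟩
    · exact ⟨_, (hCspec _).2 ⟨top, top_mem_contSentences L B, rfl⟩, fun h => absurd h hm⟩
  obtain ⟨f, hf, hfspec⟩ := exists_computable_witness (p := fun m c => C c ∧ (S m ∧ P m → E m c))
    ((hC.comp Primrec.snd).and (((hS.comp Primrec.fst).and (hP.comp Primrec.fst)).imp hE)) hex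
  refine ⟨f, hf, fun φ hφ => ?_⟩
  obtain ⟨hc, he⟩ := hfspec φ.code
  obtain ⟨χ, hχ, hcode⟩ := (hCspec _).1 hc
  refine ⟨χ, hχ, hcode, fun hcont => (hEspec φ χ hφ.2 hχ.2).1 ?_⟩
  rw [hcode]
  exact he ⟨(hSspec _).2 ⟨φ, hφ, rfl⟩, (hPspec φ hφ.2).2 hcont⟩

end Decision

end MonadicFO

theorem theoremt {A : Type v} [Finite A] [Encodable A] (L : MonadicFO.MLogic) (B : Set A) :
    (∀ φ ∈ MonadicFO.Sentences L A,
      (MonadicFO.ContinuousIn.{u} B φ ↔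
        ∃ φ' ∈ MonadicFO.ContSentences L B, MonadicFO.Formula.Equivalent.{u} φ φ')) ∧
    (∃ t : MonadicFO.Formula A → MonadicFO.Formula A,
      MonadicFO.EffectiveOn (MonadicFO.Sentences L A) t ∧
      ∀ φ ∈ MonadicFO.Sentences L A,
        t φ ∈ MonadicFO.ContSentences L B ∧
        (MonadicFO.ContinuousIn.{u} B φ ↔ MonadicFO.Formula.Equivalent.{u} φ (t φ))) ∧
    MonadicFO.DecidableOn (MonadicFO.Sentences L A) (fun φ => MonadicFO.ContinuousIn.{u} B φ) := by
  classical
  have hiff : ∀ φ ∈ MonadicFO.Sentences L A, (MonadicFO.ContinuousIn.{u} B φ ↔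
      ∃ φ' ∈ MonadicFO.ContSentences L B, MonadicFO.Formula.Equivalent.{u} φ φ') :=
    fun φ hφ => MonadicFO.continuousIn_iff_exists_equivalent hφ
  refine ⟨hiff, ?_, ?_⟩
  · obtain ⟨f, hf, h⟩ := MonadicFO.exists_computable_normalForm.{u} L B
    choose! t ht using h
    -- Whatever the search returns for a sentence that is not continuous, it is not equivalent to
    -- it, by the first part.
    exact ⟨t, ⟨f, hf, fun φ hφ => (ht φ hφ).2.1.symm⟩, fun φ hφ => ⟨(ht φ hφ).1,
      (ht φ hφ).2.2, fun he => (hiff φ hφ).2 ⟨t φ, (ht φ hφ).1, he⟩⟩⟩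
  · obtain ⟨P, hP, h⟩ := MonadicFO.exists_primrecPred_continuousIn.{u} B
    exact ⟨fun m => decide (P m), hP.decide.to_comp, fun φ hφ => by
      rw [decide_eq_true_iff, h φ hφ.2]⟩
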